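/- Let $\mathbf Z=(V,W)$ be a random vector in $\mathbb R^2$ with $E[\mathbf Z]=\mathbf 0$, with positive-definite covariance matrix $\Sigma$, and with $E[|\mathbf Z|^{2+\delta}]<\infty$ for some $\delta\in(0,1]$, where $|\mathbf Z|=\sqrt{V^2+W^2}$. Assume that $W\in\rho+\mathbb Z$ almost surely for some $\rho\in\mathbb R$ and that $W$ has a lattice distribution with span $1$, i.e. there are no $h>1$ and $a\in\mathbb R$ with $W\in a+h\mathbb Z$ almost surely. Let $\mathbf Z_i=(V_i,W_i)$, $i\ge 1$, be i.i.d. copies of $\mathbf Z$, and put $X_n=\sum_{i=1}^nV_i$, $Y_n=\sum_{i=1}^nW_i$, and $y_n=(y+n\rho)/\sqrt n$ for $y\in\mathbb Z$. Let $$\psi_\Sigma(x,y)=\int_{-\infty}^x\gamma_\Sigma(t,y)\,dt,\qquad \gamma_\Sigma(\mathbf x)=\frac{1}{2\pi\sqrt{\det\Sigma}}\,e^{-\mathbf x^T\Sigma^{-1}\mathbf x/2},\quad \mathbf x\in\mathbb R^2,$$ so that $\gamma_\Sigma$ is the density of the centered Gaussian distribution on $\mathbb R^2$ with covariance matrix $\Sigma$.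 Then there is a constant $C<\infty$, depending only on $\delta$, $\rho$ and the law of $\mathbf Z$, such that for every $n\ge 1$ $$\sup_{x\in\mathbb R,\;y\in\mathbb Z}(1+y_n^2)\left|P\left(\frac{X_n}{\sqrt n}\le x,\ \frac{Y_n}{\sqrt n}=y_n\right)-\frac1{\sqrt n}\,\psi_\Sigma(x,y_n)\right|\le C\,n^{-(1+\delta)/2}.$$ -/

import Mathlib

open MeasureTheory ProbabilityTheory

noncomputable section

/-- Almost surely, `W` takes its values in the shifted lattice `a + h ℤ`. -/
def SupportedOnLattice {Ω : Type*} [MeasurableSpace Ω] (P : Measure Ω) (W : Ω → ℝ)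
    (a h : ℝ) : Prop :=
  ∀ᵐ ω ∂P, ∃ k : ℤ, W ω = a + h * k

/-- `W` has a lattice distribution with span `h`: `h > 0` is the largest step for which `W` is
almost surely in some shifted lattice `a + h ℤ`. -/
def IsLatticeWithSpan {Ω : Type*} [MeasurableSpace Ω] (P : Measure Ω) (W : Ω → ℝ)
    (h : ℝ) : Prop :=
  0 < h ∧ (∃ a : ℝ, SupportedOnLattice P W a h) ∧
    ∀ h' : ℝ, h < h' → ∀ a : ℝ, ¬ SupportedOnLattice P W a h'

/-- The covariance matrix of the random vector `(V, W)`. -/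
def covMatrix {Ω : Type*} [MeasurableSpace Ω] (P : Measure Ω) (V W : Ω → ℝ) :
    Matrix (Fin 2) (Fin 2) ℝ :=
  !![variance V P, covariance V W P; covariance V W P, variance W P]

/-- The density at `v` of the centered Gaussian on `ℝ²` with positive definite covariance
matrix `A`. -/
def gaussianDensity (A : Matrix (Fin 2) (Fin 2) ℝ) (v : Fin 2 → ℝ) : ℝ :=
  (2 * Real.pi * Real.sqrt A.det)⁻¹ * Real.exp (-(v ⬝ᵥ (A⁻¹).mulVec v) / 2)

/-- `ψ_A(x, y) = ∫_{-∞}^x γ_A(t, y) dt`, where `γ_A` is the centered Gaussian density. -/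
def semiLocalGaussian (A : Matrix (Fin 2) (Fin 2) ℝ) (x y : ℝ) : ℝ :=
  ∫ t in Set.Iic x, gaussianDensity A ![t, y]

/-- The point `y_n = (y + n ρ) / √n` of the rescaled lattice that carries `Y_n / √n`. -/
def latticePoint (ρ : ℝ) (n : ℕ) (y : ℤ) : ℝ :=
  ((y : ℝ) + n * ρ) / Real.sqrt n

end

/-! Fix `y` and put `v = y_n`. Let `μ` be the law of `X_n / √n` restricted to the event that `Y_n /
√n = v`. On the Gaussian side, `ψ_Σ(x, v)` factors into the marginal density at `v` times the
distribution function of a conditional normal law `ν`. The theorem is thus a Berry-Esseen bound,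
uniform in `v`, for the distribution functions of `√n (1 + v²) μ` and of a multiple of `ν`; dividing
by `√n` at the end gives the rate.

Fourier transforms in the lattice direction make the comparison possible. The weight `1 + v²` is
produced by weighting the joint transform by `1 + Y_n² / n`, that is, by taking two derivatives in
the dual variable `t`. Inversion over one period `|t| ≤ π√n` (`integral_sumCharFunTrunc_mul_cexp`)
and over the whole line for the Gaussian (`integral_limitCharFun_mul_cexp`) writes the difference of
the two one-dimensional transforms at `s` as an integral over `t` of the difference of
`sumCharFunTrunc` and `limitCharFun` against a unimodular factor (`mul_charFun_sub_eq`). The factor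
carries all the dependence on `v`, so absolute values give uniformity.

The integrand is at most a constant times `n^(-δ/2) exp(-c(s² + t²))` when `|s| ≤ c₀√n`
(`exists_norm_sumCharFunTrunc_sub_le`). This combines Taylor expansion with the `2 + δ` moment and
decay of the one-step characteristic function. The decay holds for `|t| ≤ π` because `W` has span
`1`, but only for small `s`, since `V` is arbitrary; a cutoff `T = c₀√n` is all that smoothing
needs.

Esseen's inequality divides the difference of transforms by `|s|`, and at `s = 0` this difference is
a difference of masses, which need not vanish. Subtracting that mass times a standard normal law
repairs this, provided that the increments from `s = 0` are bounded by `n^(-δ/2) |s|^δ`; then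
`|s|^(δ-1)` is integrable. Such a bound concerns mixed differences, in both the point `s` and the
passage from the sum to its limit. `GridBound` packages mixed differences so that they pass through
products and powers. -/

noncomputable section

/-! ### The Fejér kernel -/

/-- The Fejér kernel, the Fourier transform of the triangle function on `[-T, T]`. -/
def fejerKernel (T x : ℝ) : ℝ := 2 * (1 - Real.cos (T * x)) / (T * x ^ 2)

theorem fejerKernel_nonneg {T : ℝ} (hT : 0 < T) (x : ℝ) : 0 ≤ fejerKernel T x := by
  unfold fejerKernel
  have := Real.cos_le_one (T * x)
  exact div_nonneg (by linarith) (by positivity)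

theorem fejerKernel_neg (T x : ℝ) : fejerKernel T (-x) = fejerKernel T x := by
  simp [fejerKernel]

theorem fejerKernel_eq_mul {T : ℝ} (hT : 0 < T) (x : ℝ) :
    fejerKernel T x = T * fejerKernel 1 (T * x) := by
  unfold fejerKernel
  rcases eq_or_ne x 0 with rfl | hx
  · simp
  · field_simp

theorem measurable_fejerKernel (T : ℝ) : Measurable (fejerKernel T) := by
  unfold fejerKernel; fun_prop

/-- The estimates `1 - cos x ≤ x²/2` and `1 - cos x ≤ 2` bound the kernel by `1` and `x²` times it
by `4`, whence the constant `5`. -/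
theorem fejerKernel_one_le (x : ℝ) : fejerKernel 1 x ≤ 5 * (1 + x ^ 2)⁻¹ := by
  unfold fejerKernel
  rcases eq_or_ne x 0 with rfl | hx
  · simp
  · have h1 := Real.one_sub_sq_div_two_le_cos (x := x)
    have h2 := Real.neg_one_le_cos x
    have hx2 : 0 < x ^ 2 := by positivity
    rw [one_mul, one_mul, ← div_eq_mul_inv, div_le_div_iff₀ hx2 (by positivity)]
    nlinarith

theorem integrable_fejerKernel_one : Integrable (fejerKernel 1) := by
  refine (integrable_inv_one_add_sq.const_mul 5).mono'
    (measurable_fejerKernel 1).aestronglyMeasurable (ae_of_all _ fun x => ?_)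
  rw [Real.norm_of_nonneg (fejerKernel_nonneg one_pos x)]
  exact fejerKernel_one_le x

theorem integrable_fejerKernel {T : ℝ} (hT : 0 < T) : Integrable (fejerKernel T) := by
  have := (integrable_fejerKernel_one.comp_mul_left' hT.ne').const_mul T
  exact this.congr (ae_of_all _ fun x => (fejerKernel_eq_mul hT x).symm)

theorem integral_fejerKernel {T : ℝ} (hT : 0 < T) :
    ∫ x, fejerKernel T x = ∫ x, fejerKernel 1 x := by
  simp_rw [fejerKernel_eq_mul hT]
  rw [integral_const_mul, Measure.integral_comp_mul_left, abs_of_pos (inv_pos.2 hT), smul_eq_mul,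
    mul_inv_cancel_left₀ hT.ne']

theorem integral_fejerKernel_one_pos : 0 < ∫ x, fejerKernel 1 x := by
  rw [integral_pos_iff_support_of_nonneg (fejerKernel_nonneg one_pos) integrable_fejerKernel_one]
  refine lt_of_lt_of_le (b := volume (Set.Ioo (0 : ℝ) 1)) (by simp) (measure_mono fun x hx => ?_)
  have h : Real.cos x < 1 := by
    have := Real.cos_lt_cos_of_nonneg_of_le_pi le_rfl (by linarith [hx.2, Real.pi_gt_three]) hx.1
    simpa using this
  have hx0 := hx.1
  have : 0 < fejerKernel 1 x := by
    unfold fejerKernel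
    rw [one_mul, one_mul]
    exact div_pos (by linarith) (by positivity)
  exact this.ne'

/-- An explicit primitive handles the half `[0, T]`; reflection gives the other half with `x`
replaced by `-x`, and the odd terms `I / x` cancel. -/
theorem integral_triangle_mul_cexp {T x : ℝ} (hT : 0 < T) (hx : x ≠ 0) :
    ∫ s in (-T)..T, ((1 - |s| / T : ℝ) : ℂ) * Complex.exp (s * x * Complex.I) =
      fejerKernel T x := by
  have key : ∀ x : ℝ, x ≠ 0 →
      ∫ s in (0 : ℝ)..T, ((1 - s / T : ℝ) : ℂ) * Complex.exp (s * x * Complex.I) =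
        (1 - Complex.exp (T * x * Complex.I)) / (T * x ^ 2) + Complex.I / x := by
    intro x hx
    have hxc : (x : ℂ) ≠ 0 := by exact_mod_cast hx
    have hTc : (T : ℂ) ≠ 0 := by exact_mod_cast hT.ne'
    have hd : ∀ s ∈ Set.uIcc (0 : ℝ) T, HasDerivAt (fun s : ℝ =>
        ((1 - s / T : ℂ)) * Complex.exp (s * x * Complex.I) / (x * Complex.I)
          - Complex.exp (s * x * Complex.I) / (T * x ^ 2))
        (((1 - s / T : ℝ) : ℂ) * Complex.exp (s * x * Complex.I)) s := by
      intro s _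
      have h0 : HasDerivAt (fun s : ℝ => (s : ℂ)) 1 s := Complex.ofRealCLM.hasDerivAt
      have h1 := ((h0.mul_const (x : ℂ)).mul_const Complex.I).cexp
      have h2 := (h0.div_const (T : ℂ)).const_sub 1
      have h3 := ((h2.mul h1).div_const (x * Complex.I)).sub (h1.div_const ((T : ℂ) * x ^ 2))
      refine h3.congr_deriv ?_
      push_cast
      field_simp
      ring_nf
      simp only [Complex.I_sq]
      ring
    rw [intervalIntegral.integral_eq_sub_of_hasDerivAt hd
      (Continuous.intervalIntegrable (by fun_prop) _ _)]
    have : (T : ℂ) / T = 1 := div_self hTc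
    simp only [this, Complex.ofReal_zero, zero_mul, Complex.exp_zero, zero_div, sub_zero, sub_self]
    have hI : (1 : ℂ) * 1 / (x * Complex.I) = -(Complex.I / x) := by
      field_simp
      simp
    rw [hI]
    ring
  have hcont : Continuous
      fun s : ℝ => ((1 - |s| / T : ℝ) : ℂ) * Complex.exp (s * x * Complex.I) := by fun_prop
  rw [← intervalIntegral.integral_add_adjacent_intervals (b := 0)
    (hcont.intervalIntegrable _ _) (hcont.intervalIntegrable _ _)]
  have hpos : ∫ s in (0 : ℝ)..T, ((1 - |s| / T : ℝ) : ℂ) * Complex.exp (s * x * Complex.I) =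
      (1 - Complex.exp (T * x * Complex.I)) / (T * x ^ 2) + Complex.I / x := by
    rw [← key x hx]
    refine intervalIntegral.integral_congr fun s hs => ?_
    rw [Set.uIcc_of_le hT.le] at hs
    simp only [abs_of_nonneg hs.1]
  have hneg : ∫ s in (-T)..0, ((1 - |s| / T : ℝ) : ℂ) * Complex.exp (s * x * Complex.I) =
      (1 - Complex.exp (-(T * x * Complex.I))) / (T * x ^ 2) - Complex.I / x := by
    have h := key (-x) (neg_ne_zero.2 hx)
    rw [← neg_zero, ← intervalIntegral.integral_comp_neg]
    have e : ∫ s in (0 : ℝ)..T, ((1 - |(-s)| / T : ℝ) : ℂ) *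
        Complex.exp (((-s : ℝ) : ℂ) * x * Complex.I) =
        ∫ s in (0 : ℝ)..T, ((1 - s / T : ℝ) : ℂ) *
          Complex.exp (s * ((-x : ℝ) : ℂ) * Complex.I) := by
      refine intervalIntegral.integral_congr fun s hs => ?_
      rw [Set.uIcc_of_le hT.le] at hs
      simp only [abs_neg, abs_of_nonneg hs.1]
      push_cast
      ring_nf
    rw [e, h]
    push_cast
    rw [div_neg, neg_sq]
    ring_nf
  rw [hpos, hneg, fejerKernel]
  push_cast
  rw [Complex.cos]
  have e1 : -(T * x : ℂ) * Complex.I = -(T * x * Complex.I) := by ring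
  rw [e1]
  ring
end

/-! ### Smoothed distribution functions: Fourier representation and desmoothing -/

noncomputable section

/-- Both sides integrate the kernel in `v` over the strip `a < u + v ≤ b`, so this is Fubini.
Increments are used because a distribution function alone has no convergent Fourier integral; `a` is
sent to `-∞` later. -/
theorem integral_fejerKernel_mul_cdf_sub {μ : Measure ℝ} [IsFiniteMeasure μ] {T a b : ℝ}
    (hT : 0 < T) (hab : a ≤ b) :
    ∫ v, fejerKernel T v * (μ.real (Set.Iic (b - v)) - μ.real (Set.Iic (a - v))) =
      ∫ u, (∫ x in Set.Ioc a b, fejerKernel T (x - u)) ∂μ := by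
  set S : Set (ℝ × ℝ) := {z | a < z.1 + z.2 ∧ z.1 + z.2 ≤ b} with hS
  have hSm : MeasurableSet S := by
    exact (measurableSet_lt measurable_const (measurable_fst.add measurable_snd)).inter
      (measurableSet_le (measurable_fst.add measurable_snd) measurable_const)
  have hint : Integrable (Function.uncurry fun v u : ℝ => S.indicator (fun z => fejerKernel T z.1) (v, u))
      (volume.prod μ) :=
    ((integrable_fejerKernel hT).comp_fst μ).indicator hSm
  have h1 : ∀ v, fejerKernel T v * (μ.real (Set.Iic (b - v)) - μ.real (Set.Iic (a - v))) =
      ∫ u, S.indicator (fun z => fejerKernel T z.1) (v, u) ∂μ := by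
    intro v
    have e : (fun u => S.indicator (fun z : ℝ × ℝ => fejerKernel T z.1) (v, u)) =
        (Set.Ioc (a - v) (b - v)).indicator fun _ => fejerKernel T v := by
      ext u
      simp only [Set.indicator, hS, Set.mem_ofPred_eq, Set.mem_Ioc]
      congr 1
      apply propext
      constructor <;> rintro ⟨h, h'⟩ <;> constructor <;> linarith
    rw [e, integral_indicator_const _ measurableSet_Ioc, smul_eq_mul, mul_comm]
    congr 1
    rw [← Set.Iic_union_Ioc_eq_Iic (show a - v ≤ b - v by linarith),
      measureReal_union (Set.Iic_disjoint_Ioc le_rfl) measurableSet_Ioc]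
    ring
  simp_rw [h1]
  rw [integral_integral_swap hint]
  refine integral_congr_ae (ae_of_all _ fun u => ?_)
  simp only
  rw [← integral_indicator measurableSet_Ioc,
    ← integral_add_right_eq_self (fun x => (Set.Ioc a b).indicator
      (fun x => fejerKernel T (x - u)) x) u]
  refine integral_congr_ae (ae_of_all _ fun v => ?_)
  simp [Set.indicator, hS]

/-- Insert the triangle representation of the kernel and move the `μ`-integral innermost. Everything
is bounded on a product of finite measures, so both exchanges are free. -/
theorem integral_fejerKernel_mul_cdf_sub_eq_charFun {μ : Measure ℝ} [IsFiniteMeasure μ]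
    {T a b : ℝ} (hT : 0 < T) (hab : a ≤ b) :
    ((∫ v, fejerKernel T v * (μ.real (Set.Iic (b - v)) - μ.real (Set.Iic (a - v))) : ℝ) : ℂ) =
      ∫ x in Set.Ioc a b, ∫ s in Set.Ioc (-T) T,
        ((1 - |s| / T : ℝ) : ℂ) * Complex.exp (s * x * Complex.I) * charFun μ (-s) := by
  rw [integral_fejerKernel_mul_cdf_sub hT hab, ← integral_complex_ofReal]
  have hb : ∀ s ∈ Set.Ioc (-T) T, |(1 - |s| / T)| ≤ 1 := by
    intro s hs
    have h1 : |s| ≤ T := abs_le.2 ⟨hs.1.le, hs.2⟩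
    have h2 : |s| / T ≤ 1 := (div_le_one hT).2 h1
    have h3 : 0 ≤ |s| / T := by positivity
    rw [abs_le]; constructor <;> linarith
  have h1 : ∀ u : ℝ, ((∫ x in Set.Ioc a b, fejerKernel T (x - u) : ℝ) : ℂ) =
      ∫ x in Set.Ioc a b, ∫ s in Set.Ioc (-T) T,
        ((1 - |s| / T : ℝ) : ℂ) * Complex.exp (s * (x - u : ℝ) * Complex.I) := by
    intro u
    rw [← integral_complex_ofReal]
    have hne : ∀ᵐ x : ℝ, x ≠ u := compl_mem_ae_iff.2 (measure_singleton u)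
    refine integral_congr_ae ?_
    filter_upwards [ae_restrict_of_ae hne] with x hx
    rw [← integral_triangle_mul_cexp hT (sub_ne_zero.2 hx),
      intervalIntegral.integral_of_le (by linarith)]
  simp_rw [h1]
  have hbd : ∀ s ∈ Set.Ioc (-T) T, ∀ y : ℝ,
      ‖((1 - |s| / T : ℝ) : ℂ) * Complex.exp (s * (y : ℝ) * Complex.I)‖ ≤ 1 := by
    intro s hs y
    have : ‖Complex.exp (s * (y : ℝ) * Complex.I)‖ = 1 := by
      rw [← Complex.ofReal_mul, Complex.norm_exp_ofReal_mul_I]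
    rw [norm_mul, this, mul_one, Complex.norm_real]
    exact hb s hs
  rw [integral_integral_swap]
  · refine integral_congr_ae (ae_of_all _ fun x => ?_)
    simp only
    rw [integral_integral_swap]
    · refine integral_congr_ae (ae_of_all _ fun s => ?_)
      simp only
      rw [charFun_apply_real, ← integral_const_mul]
      refine integral_congr_ae (ae_of_all _ fun u => ?_)
      simp only
      rw [mul_assoc ((1 - |s| / T : ℝ) : ℂ) (Complex.exp _), ← Complex.exp_add]
      congr 2
      push_cast
      ring
    · refine Integrable.of_bound (C := 1) ?_ ?_
      · exact Continuous.aestronglyMeasurable (by unfold Function.uncurry; fun_prop)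
      · have : ∀ᵐ z : ℝ × ℝ ∂(μ.prod (volume.restrict (Set.Ioc (-T) T))), z.2 ∈ Set.Ioc (-T) T :=
          Measure.quasiMeasurePreserving_snd.ae (ae_restrict_mem measurableSet_Ioc)
        filter_upwards [this] with z hz
        exact hbd z.2 hz _
  · refine Integrable.of_bound (C := 2 * T) ?_ ?_
    · refine StronglyMeasurable.aestronglyMeasurable ?_
      have : StronglyMeasurable (Function.uncurry fun (z : ℝ × ℝ) (s : ℝ) =>
        ((1 - |s| / T : ℝ) : ℂ) * Complex.exp (s * (z.2 - z.1 : ℝ) * Complex.I)) :=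
        Continuous.stronglyMeasurable (by unfold Function.uncurry; fun_prop)
      exact this.integral_prod_right
    · refine ae_of_all _ fun z => ?_
      have := norm_setIntegral_le_of_norm_le_const (μ := volume) (s := Set.Ioc (-T) T) (by simp)
        fun s hs => hbd s hs (z.2 - z.1)
      refine this.trans ?_
      simp only [Real.volume_real_Ioc]
      rw [max_eq_left (by linarith)]
      linarith

theorem norm_integral_cexp_mul_I_le {a b s : ℝ} (hab : a ≤ b) (hs : s ≠ 0) :
    ‖∫ x in Set.Ioc a b, Complex.exp (s * x * Complex.I)‖ ≤ 2 / |s| := by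
  have hc : (s * Complex.I : ℂ) ≠ 0 := by simp [hs]
  have e : ∀ x : ℝ, Complex.exp (s * x * Complex.I) = Complex.exp ((s * Complex.I) * x) := by
    intro x; congr 1; ring
  simp_rw [e]
  rw [← intervalIntegral.integral_of_le hab, integral_exp_mul_complex hc, norm_div]
  have h2 : ‖(s * Complex.I : ℂ)‖ = |s| := by simp
  rw [h2]
  gcongr
  refine (norm_sub_le _ _).trans ?_
  have h3 : ∀ x : ℝ, ‖Complex.exp (s * Complex.I * x)‖ = 1 := by
    intro x
    rw [← e, ← Complex.ofReal_mul, Complex.norm_exp_ofReal_mul_I]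
  rw [h3, h3]; norm_num

/-- Integrating the exponential in `x` first gains `2 / |s|`, whatever the length of `(a, b]`. This
cancels the factor `|s|` in the hypothesis and leaves a bound that survives `a → -∞`. -/
theorem norm_integral_triangle_mul_le {T a b : ℝ} (hT : 0 < T) (hab : a ≤ b) {f : ℝ → ℂ}
    (hf : Measurable f) {M : ℝ} (hM : ∀ s, ‖f s‖ ≤ M) {B : ℝ → ℝ} (hB : Integrable B)
    (hB0 : ∀ s, 0 ≤ B s)
    (hfB : ∀ s, |s| ≤ T → s ≠ 0 → ‖f s‖ ≤ |s| * B s) :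
    ‖∫ x in Set.Ioc a b, ∫ s in Set.Ioc (-T) T,
        ((1 - |s| / T : ℝ) : ℂ) * Complex.exp (s * x * Complex.I) * f s‖ ≤ 2 * ∫ s, B s := by
  have hb : ∀ s ∈ Set.Ioc (-T) T, ‖((1 - |s| / T : ℝ) : ℂ)‖ ≤ 1 := by
    intro s hs
    have h1 : |s| ≤ T := abs_le.2 ⟨hs.1.le, hs.2⟩
    have h2 : |s| / T ≤ 1 := (div_le_one hT).2 h1
    have h3 : 0 ≤ |s| / T := by positivity
    rw [Complex.norm_real, Real.norm_eq_abs, abs_le]; constructor <;> linarith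
  have hM0 : 0 ≤ M := (norm_nonneg _).trans (hM 0)
  rw [integral_integral_swap]
  · have hne : ∀ᵐ s : ℝ, s ≠ 0 := compl_mem_ae_iff.2 (measure_singleton 0)
    calc _ ≤ ∫ s in Set.Ioc (-T) T, 2 * B s := by
          refine norm_integral_le_of_norm_le (hB.const_mul 2).restrict ?_
          filter_upwards [ae_restrict_of_ae hne, ae_restrict_mem measurableSet_Ioc] with s hs hsT
          have e : ∀ x : ℝ, ((1 - |s| / T : ℝ) : ℂ) * Complex.exp (s * x * Complex.I) * f s =
              ((1 - |s| / T : ℝ) : ℂ) * f s * Complex.exp (s * x * Complex.I) := by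
            intro x; ring
          simp_rw [e]
          rw [integral_const_mul, norm_mul, norm_mul]
          have h1 := hb s hsT
          have h2 := hfB s (abs_le.2 ⟨hsT.1.le, hsT.2⟩) hs
          have h3 := norm_integral_cexp_mul_I_le hab hs
          have hs0 : 0 < |s| := abs_pos.2 hs
          have hBs := hB0 s
          calc _ ≤ 1 * (|s| * B s) * (2 / |s|) := by gcongr
            _ = 2 * B s := by field_simp
      _ ≤ ∫ s, 2 * B s := setIntegral_le_integral (hB.const_mul 2)
          (ae_of_all _ fun s => mul_nonneg zero_le_two (hB0 s))
      _ = _ := integral_const_mul _ _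
  · refine Integrable.of_bound (C := 1 * 1 * M) ?_ ?_
    · refine AEStronglyMeasurable.mul ?_ (hf.comp measurable_snd).aestronglyMeasurable
      exact Continuous.aestronglyMeasurable (by fun_prop)
    · have : ∀ᵐ z : ℝ × ℝ ∂((volume.restrict (Set.Ioc a b)).prod
          (volume.restrict (Set.Ioc (-T) T))), z.2 ∈ Set.Ioc (-T) T :=
        Measure.quasiMeasurePreserving_snd.ae (ae_restrict_mem measurableSet_Ioc)
      filter_upwards [this] with z hz
      have h1 := hb z.2 hz
      simp only [Function.uncurry]
      rw [norm_mul, norm_mul, ← Complex.ofReal_mul z.2, Complex.norm_exp_ofReal_mul_I]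
      gcongr
      exact hM _

/-- A one-sided bound for a function of one-sided bounded increase from a bound on its
smoothing. -/
theorem le_of_smoothing_le {K : ℝ → ℝ} {H : ℝ → ℝ} {I A S m M : ℝ} (hK0 : ∀ x, 0 ≤ K x)
    (hK : Integrable K) (hKI : ∫ x, K x = I) (hI : 0 < I) (hA : 0 ≤ A)
    (hKA : 3 / 4 * I ≤ ∫ x in Set.Icc (-A) A, K x) (hH : Measurable H) (hM : ∀ x, |H x| ≤ M)
    (hm : 0 ≤ m) (hinc : ∀ x y, x ≤ y → H x - H y ≤ m * (y - x))
    (hS0 : 0 ≤ S) (hS : ∀ x, ∫ v, K v * H (x - v) ≤ S) (x : ℝ) :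
    H x ≤ 4 / 3 * (S / I + 2 * m * A) + M / 3 := by
  by_contra! hcon
  have hM0 : 0 ≤ M := (abs_nonneg _).trans (hM 0)
  have hint : Integrable fun v => K v * H (x + A - v) :=
    hK.mul_bdd (c := M) (hH.comp (by fun_prop)).aestronglyMeasurable (ae_of_all _ fun v => hM _)
  -- The smoothing is evaluated at `x + A` so that the window `|v| ≤ A` only sees points of `[x, x +
  -- 2A]`, where `H` has dropped by at most `2mA`. Outside the window only `H ≥ -M` is used.
  have h1 := hS (x + A)
  rw [← integral_add_compl (measurableSet_Icc (a := -A) (b := A)) hint] at h1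
  rw [← integral_add_compl (measurableSet_Icc (a := -A) (b := A)) hK] at hKI
  set J := ∫ v in Set.Icc (-A) A, K v
  set J' := ∫ v in (Set.Icc (-A) A)ᶜ, K v
  have hJ' : 0 ≤ J' := integral_nonneg hK0
  have h2 : J * (H x - 2 * m * A) ≤ ∫ v in Set.Icc (-A) A, K v * H (x + A - v) := by
    rw [← integral_mul_const]
    refine setIntegral_mono_on (hK.mul_const _).integrableOn hint.integrableOn measurableSet_Icc
      fun v hv => ?_
    refine mul_le_mul_of_nonneg_left ?_ (hK0 v)
    have := hinc x (x + A - v) (by linarith [hv.2])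
    nlinarith [hv.1]
  have h3 : J' * (-M) ≤ ∫ v in (Set.Icc (-A) A)ᶜ, K v * H (x + A - v) := by
    rw [← integral_mul_const]
    refine setIntegral_mono_on (hK.mul_const _).integrableOn hint.integrableOn
      measurableSet_Icc.compl fun v hv => ?_
    exact mul_le_mul_of_nonneg_left (neg_le_of_abs_le (hM _)) (hK0 v)
  set c := S / I
  have hc : S = c * I := by simp only [c]; field_simp
  -- The negated claim makes this quantity nonnegative, which allows the window mass `J` to be
  -- replaced by its lower bound `3/4 * I`.
  have h4 : 0 ≤ H x - 2 * m * A + M := by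
    have : 0 ≤ c := div_nonneg hS0 hI.le
    nlinarith [mul_nonneg hm hA]
  have h5 : 3 / 4 * I * (H x - 2 * m * A + M) - M * I ≤ c * I := by
    have := mul_le_mul_of_nonneg_right hKA h4
    have e : J' = I - J := by linarith
    rw [e] at h3
    nlinarith
  have h6 : 3 / 4 * (H x - 2 * m * A + M) - M ≤ c := by
    by_contra! h
    nlinarith
  linarith [mul_nonneg hm hA]

/-- With the supremum `η` of `|H|` in place of `M`, the one-sided bound gives `η ≤ 4/3 (...) + η/3`,
and `η/3` is absorbed. The lower bound comes from `y ↦ -H (-y)`, which has the same one-sided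
increments; the kernel is even. -/
theorem abs_le_of_smoothing_le {K : ℝ → ℝ} {H : ℝ → ℝ} {I A S m M : ℝ} (hK0 : ∀ x, 0 ≤ K x)
    (hKneg : ∀ x, K (-x) = K x)
    (hK : Integrable K) (hKI : ∫ x, K x = I) (hI : 0 < I) (hA : 0 ≤ A)
    (hKA : 3 / 4 * I ≤ ∫ x in Set.Icc (-A) A, K x) (hH : Measurable H) (hM : ∀ x, |H x| ≤ M)
    (hm : 0 ≤ m) (hinc : ∀ x y, x ≤ y → H x - H y ≤ m * (y - x))
    (hS : ∀ x, |∫ v, K v * H (x - v)| ≤ S) (x : ℝ) :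
    |H x| ≤ 2 * (S / I + 2 * m * A) := by
  have hbdd : BddAbove (Set.range fun x => |H x|) := ⟨M, by rintro _ ⟨x, rfl⟩; exact hM x⟩
  set η := ⨆ x, |H x|
  have hη : ∀ x, |H x| ≤ η := fun x => le_ciSup hbdd x
  have hup : ∀ x, |H x| ≤ 4 / 3 * (S / I + 2 * m * A) + η / 3 := by
    intro x
    rw [abs_le']
    refine ⟨le_of_smoothing_le hK0 hK hKI hI hA hKA hH hη hm hinc
      ((abs_nonneg _).trans (hS x)) (fun x => (le_abs_self _).trans (hS x)) x, ?_⟩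
    have := le_of_smoothing_le (H := fun y => -H (-y)) hK0 hK hKI hI hA hKA
      (hH.comp measurable_neg).neg (fun y => by rw [abs_neg]; exact hη _) hm
      (fun y z hyz => by have := hinc (-z) (-y) (by linarith); linarith)
      ((abs_nonneg _).trans (hS x)) (fun y => ?_) (-x)
    · simpa using this
    · have e : ∫ v, K v * -H (-(y - v)) = - ∫ v, K v * H (-y - v) := by
        rw [← integral_neg, ← integral_neg_eq_self]
        refine integral_congr_ae (ae_of_all _ fun v => ?_)
        simp only [hKneg]
        rw [mul_neg]
        congr 3
        ring
      rw [e]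
      exact (neg_le_abs _).trans (hS _)
  have : η ≤ 4 / 3 * (S / I + 2 * m * A) + η / 3 := ciSup_le hup
  linarith [hη x]
end

/-! ### Esseen's smoothing inequality -/

noncomputable section

theorem integral_const_mul_sub_sub {α 𝕜 : Type*} [MeasurableSpace α] [RCLike 𝕜] {μ : Measure α}
    {f g h : α → 𝕜} (hf : Integrable f μ) (hg : Integrable g μ) (hh : Integrable h μ) (a b c : 𝕜) :
    ∫ x, (a * f x - b * g x - c * h x) ∂μ = a * ∫ x, f x ∂μ - b * ∫ x, g x ∂μ - c * ∫ x, h x ∂μ := by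
  rw [integral_sub (f := fun x => a * f x - b * g x) ((hf.const_mul a).sub (hg.const_mul b))
    (hh.const_mul c), integral_sub (hf.const_mul a) (hg.const_mul b), integral_const_mul,
    integral_const_mul, integral_const_mul]

/-- The window is chosen for `T = 1` and rescaled, so its width is of order `1 / T`; this is the
source of the term `m / T` in Esseen's inequality. -/
theorem exists_integral_fejerKernel_Icc_ge : ∃ A : ℝ, 0 ≤ A ∧ ∀ T : ℝ, 0 < T →
    3 / 4 * (∫ x, fejerKernel 1 x) ≤ ∫ x in Set.Icc (-(A / T)) (A / T), fejerKernel T x := by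
  have hlim := intervalIntegral_tendsto_integral integrable_fejerKernel_one
    Filter.tendsto_neg_atTop_atBot Filter.tendsto_id
  have hI := integral_fejerKernel_one_pos
  have hev := (hlim.eventually (eventually_ge_nhds (show 3 / 4 * (∫ x, fejerKernel 1 x) <
    ∫ x, fejerKernel 1 x by linarith))).and (Filter.eventually_ge_atTop 0)
  obtain ⟨A, hA, hA0⟩ := hev.exists
  refine ⟨A, hA0, fun T hT => hA.trans (le_of_eq ?_)⟩
  have hAT : 0 ≤ A / T := by positivity
  rw [integral_Icc_eq_integral_Ioc, ← intervalIntegral.integral_of_le (by linarith)]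
  simp_rw [fejerKernel_eq_mul hT]
  rw [intervalIntegral.integral_const_mul, intervalIntegral.mul_integral_comp_mul_left]
  rw [mul_neg, show T * (A / T) = A by field_simp]
  rfl

theorem tendsto_integral_fejerKernel_mul_cdf_atBot {T : ℝ} (hT : 0 < T) (μ : Measure ℝ)
    [IsFiniteMeasure μ] :
    Filter.Tendsto (fun a : ℝ => ∫ v, fejerKernel T v * μ.real (Set.Iic (a - v))) Filter.atBot
      (nhds 0) := by
  have h0 : (0 : ℝ) = ∫ v : ℝ, fejerKernel T v * 0 := by simp
  rw [h0]
  refine tendsto_integral_filter_of_dominated_convergence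
    (fun v => fejerKernel T v * μ.real Set.univ) ?_ ?_ ((integrable_fejerKernel hT).mul_const _) ?_
  · refine Filter.Eventually.of_forall fun a => ?_
    refine (measurable_fejerKernel T).aestronglyMeasurable.mul ?_
    have : Monotone fun x => μ.real (Set.Iic x) := fun x y h =>
      measureReal_mono (Set.Iic_subset_Iic.2 h)
    exact (this.measurable.comp (measurable_const.sub measurable_id)).aestronglyMeasurable
  · refine Filter.Eventually.of_forall fun a => ae_of_all _ fun v => ?_
    rw [norm_mul, Real.norm_of_nonneg (fejerKernel_nonneg hT v),
      Real.norm_of_nonneg measureReal_nonneg]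
    exact mul_le_mul_of_nonneg_left (measureReal_mono (Set.subset_univ _)) (fejerKernel_nonneg hT v)
  · refine ae_of_all _ fun v => ?_
    refine Filter.Tendsto.const_mul _ ?_
    have h1 : Filter.Tendsto (fun x => μ.real (Set.Iic x)) Filter.atBot (nhds 0) := by
      have h := tendsto_measure_iInter_atBot (μ := μ) (s := fun x : ℝ => Set.Iic x)
        (fun _ => measurableSet_Iic.nullMeasurableSet) monotone_Iic ⟨0, measure_ne_top _ _⟩
      have e : ⋂ x : ℝ, Set.Iic x = ∅ := 
        Set.eq_empty_of_forall_notMem fun y hy => by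
          have h1 : y ≤ y - 1 := Set.mem_iInter.1 hy (y - 1)
          linarith
      rw [e, measure_empty] at h
      exact (ENNReal.tendsto_toReal ENNReal.zero_ne_top).comp h
    exact h1.comp (Filter.tendsto_atBot_add_const_right _ _ Filter.tendsto_id)

theorem measurable_measureReal_Iic (μ : Measure ℝ) [IsFiniteMeasure μ] :
    Measurable fun x => μ.real (Set.Iic x) :=
  Monotone.measurable fun _ _ h => measureReal_mono (Set.Iic_subset_Iic.2 h)

theorem integrable_fejerKernel_mul_cdf {T : ℝ} (hT : 0 < T) (μ : Measure ℝ) [IsFiniteMeasure μ]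
    (x : ℝ) : Integrable fun v => fejerKernel T v * μ.real (Set.Iic (x - v)) := by
  refine (integrable_fejerKernel hT).mul_bdd (c := μ.real Set.univ)
    ((measurable_measureReal_Iic μ).comp (measurable_const.sub measurable_id)).aestronglyMeasurable
    (ae_of_all _ fun v => ?_)
  rw [Real.norm_of_nonneg measureReal_nonneg]
  exact measureReal_mono (Set.subset_univ _)

/-- Esseen's smoothing inequality for a linear combination of distribution functions of finite
measures, the first of which enters with a nonnegative coefficient. -/
theorem exists_esseen_smoothing : ∃ C : ℝ, 0 < C ∧ ∀ (μ ν₁ ν₂ : Measure ℝ) [IsFiniteMeasure μ]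
    [IsFiniteMeasure ν₁] [IsFiniteMeasure ν₂] (w c₁ c₂ T m : ℝ) (B : ℝ → ℝ), 0 ≤ w → 0 < T →
    0 ≤ m → Integrable B → (∀ s, 0 ≤ B s) →
    (∀ x y, x ≤ y → c₁ * ν₁.real (Set.Iic y) + c₂ * ν₂.real (Set.Iic y)
      - (c₁ * ν₁.real (Set.Iic x) + c₂ * ν₂.real (Set.Iic x)) ≤ m * (y - x)) →
    (∀ s, |s| ≤ T → s ≠ 0 →
      ‖w * charFun μ s - c₁ * charFun ν₁ s - c₂ * charFun ν₂ s‖ ≤ |s| * B s) →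
    ∀ x, |w * μ.real (Set.Iic x) - c₁ * ν₁.real (Set.Iic x) - c₂ * ν₂.real (Set.Iic x)| ≤
      C * ((∫ s, B s) + m / T) := by
  obtain ⟨A, hA0, hA⟩ := exists_integral_fejerKernel_Icc_ge
  have hI := integral_fejerKernel_one_pos
  set I := ∫ x, fejerKernel 1 x
  refine ⟨4 / I + 4 * A, by positivity, ?_⟩
  intro μ ν₁ ν₂ _ _ _ w c₁ c₂ T m B hw hT hm hB hB0 hlip hfB x
  set H : ℝ → ℝ := fun x =>
    w * μ.real (Set.Iic x) - c₁ * ν₁.real (Set.Iic x) - c₂ * ν₂.real (Set.Iic x) with hH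
  -- The argument is `-s` because the kernel is centred at the point `u` of the measure and
  -- contributes `exp(is(x - u))`.
  set f : ℝ → ℂ := fun s =>
    w * charFun μ (-s) - c₁ * charFun ν₁ (-s) - c₂ * charFun ν₂ (-s) with hf
  have hBneg : Integrable fun s => B (-s) := hB.comp_neg
  have hKH : ∀ b, ∫ v, fejerKernel T v * H (b - v) =
      w * (∫ v, fejerKernel T v * μ.real (Set.Iic (b - v)))
      - c₁ * (∫ v, fejerKernel T v * ν₁.real (Set.Iic (b - v)))
      - c₂ * (∫ v, fejerKernel T v * ν₂.real (Set.Iic (b - v))) := by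
    intro b
    rw [← integral_const_mul_sub_sub (integrable_fejerKernel_mul_cdf hT μ b)
      (integrable_fejerKernel_mul_cdf hT ν₁ b) (integrable_fejerKernel_mul_cdf hT ν₂ b)]
    refine integral_congr_ae (ae_of_all _ fun v => ?_)
    simp only [hH]
    ring
  have hinc : ∀ a b, a ≤ b → |(∫ v, fejerKernel T v * H (b - v)) -
      ∫ v, fejerKernel T v * H (a - v)| ≤ 2 * ∫ s, B s := by
    intro a b hab
    have e : ∀ (ν : Measure ℝ) [IsFiniteMeasure ν],
        (((∫ v, fejerKernel T v * ν.real (Set.Iic (b - v))) -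
          ∫ v, fejerKernel T v * ν.real (Set.Iic (a - v)) : ℝ) : ℂ) =
        ∫ x in Set.Ioc a b, ∫ s in Set.Ioc (-T) T,
          ((1 - |s| / T : ℝ) : ℂ) * Complex.exp (s * x * Complex.I) * charFun ν (-s) := by
      intro ν _
      rw [← integral_fejerKernel_mul_cdf_sub_eq_charFun hT hab, ← integral_sub
        (integrable_fejerKernel_mul_cdf hT ν b) (integrable_fejerKernel_mul_cdf hT ν a)]
      simp_rw [mul_sub]
    have hint : ∀ (ν : Measure ℝ) [IsFiniteMeasure ν] (x : ℝ), IntegrableOn (fun s : ℝ =>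
        ((1 - |s| / T : ℝ) : ℂ) * Complex.exp (s * x * Complex.I) * charFun ν (-s))
        (Set.Ioc (-T) T) := by
      intro ν _ x
      have h : IntegrableOn (fun s : ℝ =>
          ((1 - |s| / T : ℝ) : ℂ) * Complex.exp (s * x * Complex.I)) (Set.Ioc (-T) T) :=
        (Continuous.integrableOn_Icc (by fun_prop)).mono_set Set.Ioc_subset_Icc_self
      exact h.mul_bdd (c := ν.real Set.univ)
        (measurable_charFun.comp measurable_neg).aestronglyMeasurable
        (ae_of_all _ fun s => norm_charFun_le _)
    have hint2 : ∀ (ν : Measure ℝ) [IsFiniteMeasure ν], IntegrableOn (fun x : ℝ =>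
        ∫ s in Set.Ioc (-T) T, ((1 - |s| / T : ℝ) : ℂ) * Complex.exp (s * x * Complex.I) *
          charFun ν (-s)) (Set.Ioc a b) := by
      intro ν _
      refine Measure.integrableOn_of_bounded (M := ν.real Set.univ * (2 * T)) (by simp) ?_ ?_
      · have : StronglyMeasurable (Function.uncurry fun (x s : ℝ) =>
            ((1 - |s| / T : ℝ) : ℂ) * Complex.exp (s * x * Complex.I) * charFun ν (-s)) := by
          refine StronglyMeasurable.mul (Continuous.stronglyMeasurable (by fun_prop)) ?_
          exact ((measurable_charFun.comp measurable_neg).comp measurable_snd).stronglyMeasurable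
        exact this.integral_prod_right.aestronglyMeasurable
      · refine ae_of_all _ fun x => ?_
        have := norm_setIntegral_le_of_norm_le_const (μ := volume) (s := Set.Ioc (-T) T)
          (C := ν.real Set.univ) (f := fun s : ℝ => ((1 - |s| / T : ℝ) : ℂ) *
            Complex.exp (s * x * Complex.I) * charFun ν (-s)) (by simp) fun s hs => by
              have h1 : |s| ≤ T := abs_le.2 ⟨hs.1.le, hs.2⟩
              have h2 : |s| / T ≤ 1 := (div_le_one hT).2 h1
              have h3 : 0 ≤ |s| / T := by positivity
              rw [norm_mul, norm_mul, ← Complex.ofReal_mul s, Complex.norm_exp_ofReal_mul_I,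
                mul_one, Complex.norm_real, Real.norm_eq_abs, abs_of_nonneg (by linarith)]
              calc _ ≤ 1 * ν.real Set.univ := by
                    gcongr
                    · linarith
                    · exact norm_charFun_le _
                _ = _ := one_mul _
        refine this.trans (le_of_eq ?_)
        simp only [Real.volume_real_Ioc]
        rw [max_eq_left (by linarith)]
        ring
    have key := norm_integral_triangle_mul_le hT hab (f := f) (M := w * μ.real Set.univ +
      |c₁| * ν₁.real Set.univ + |c₂| * ν₂.real Set.univ) (B := fun s => B (-s)) ?_ ?_ hBneg
      (fun s => hB0 _) ?_
    · rw [integral_neg_eq_self (fun s => B s)] at key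
      refine le_trans (le_of_eq ?_) key
      rw [← Real.norm_eq_abs, ← Complex.norm_real, hKH, hKH]
      congr 1
      have e1 : ∀ x : ℝ, ∫ s in Set.Ioc (-T) T,
          ((1 - |s| / T : ℝ) : ℂ) * Complex.exp (s * x * Complex.I) * f s =
          w * (∫ s in Set.Ioc (-T) T,
            ((1 - |s| / T : ℝ) : ℂ) * Complex.exp (s * x * Complex.I) * charFun μ (-s))
          - c₁ * (∫ s in Set.Ioc (-T) T,
            ((1 - |s| / T : ℝ) : ℂ) * Complex.exp (s * x * Complex.I) * charFun ν₁ (-s))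
          - c₂ * (∫ s in Set.Ioc (-T) T,
            ((1 - |s| / T : ℝ) : ℂ) * Complex.exp (s * x * Complex.I) * charFun ν₂ (-s)) := by
        intro x
        rw [← integral_const_mul_sub_sub (hint μ x) (hint ν₁ x) (hint ν₂ x)]
        refine integral_congr_ae (ae_of_all _ fun s => ?_)
        simp only [hf]
        ring
      simp_rw [e1]
      rw [integral_const_mul_sub_sub (hint2 μ) (hint2 ν₁) (hint2 ν₂), ← e μ, ← e ν₁, ← e ν₂]
      push_cast
      ring
    · have := fun (ν : Measure ℝ) [IsFiniteMeasure ν] =>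
        (measurable_charFun (μ := ν)).comp measurable_neg
      exact (((this μ).const_mul _).sub ((this ν₁).const_mul _)).sub ((this ν₂).const_mul _)
    · intro s
      refine (norm_sub_le _ _).trans (add_le_add ((norm_sub_le _ _).trans (add_le_add ?_ ?_)) ?_)
      all_goals
        rw [norm_mul, Complex.norm_real, Real.norm_eq_abs]
        first
          | exact mul_le_mul_of_nonneg_left (norm_charFun_le _) (abs_nonneg _)
          | (rw [abs_of_nonneg hw]; exact mul_le_mul_of_nonneg_left (norm_charFun_le _) hw)
    · intro s hs hs0
      have := hfB (-s) (by rwa [abs_neg]) (neg_ne_zero.2 hs0)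
      rwa [abs_neg] at this
  have hlim : Filter.Tendsto (fun a : ℝ => ∫ v, fejerKernel T v * H (a - v)) Filter.atBot
      (nhds 0) := by
    simp_rw [hKH]
    have := (((tendsto_integral_fejerKernel_mul_cdf_atBot hT μ).const_mul w).sub
      ((tendsto_integral_fejerKernel_mul_cdf_atBot hT ν₁).const_mul c₁)).sub
      ((tendsto_integral_fejerKernel_mul_cdf_atBot hT ν₂).const_mul c₂)
    simpa using this
  -- The increment bound does not depend on `a`, and the smoothed function vanishes at `-∞`; letting
  -- `a → -∞` bounds the function itself.
  have hS : ∀ b, |∫ v, fejerKernel T v * H (b - v)| ≤ 2 * ∫ s, B s := by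
    intro b
    have h := (hlim.const_sub (∫ v, fejerKernel T v * H (b - v))).abs
    rw [sub_zero] at h
    refine le_of_tendsto h ?_
    filter_upwards [Filter.eventually_le_atBot b] with a ha using hinc a b ha
  have hfin := abs_le_of_smoothing_le (H := H) (fejerKernel_nonneg hT) (fejerKernel_neg T)
    (integrable_fejerKernel hT) (integral_fejerKernel hT) hI (div_nonneg hA0 hT.le) (hA T hT)
    (((measurable_measureReal_Iic μ).const_mul w).sub
      ((measurable_measureReal_Iic ν₁).const_mul c₁) |>.sub
      ((measurable_measureReal_Iic ν₂).const_mul c₂))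
    (M := w * μ.real Set.univ + |c₁| * ν₁.real Set.univ + |c₂| * ν₂.real Set.univ)
    (fun y => ?_) hm (fun y z hyz => ?_) hS x
  · refine hfin.trans ?_
    have hB1 : 0 ≤ ∫ s, B s := integral_nonneg hB0
    have h1 : 0 ≤ m / T := by positivity
    have h2 : 0 ≤ 4 / I * (m / T) + 4 * A * ∫ s, B s := by positivity
    have e : 2 * (2 * (∫ s, B s) / I + 2 * m * (A / T)) =
      4 / I * (∫ s, B s) + 4 * A * (m / T) := by ring
    rw [e]
    change _ ≤ (4 / I + 4 * A) * ((∫ s, B s) + m / T)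
    nlinarith
  · refine (abs_sub _ _).trans (add_le_add ((abs_sub _ _).trans (add_le_add ?_ ?_)) ?_)
    all_goals
      rw [abs_mul, abs_of_nonneg (measureReal_nonneg (s := Set.Iic y))]
      first
        | exact mul_le_mul_of_nonneg_left (measureReal_mono (Set.subset_univ _)) (abs_nonneg _)
        | (rw [abs_of_nonneg hw]
           exact mul_le_mul_of_nonneg_left (measureReal_mono (Set.subset_univ _)) hw)
  · have h1 := hlip y z hyz
    have h2 : μ.real (Set.Iic y) ≤ μ.real (Set.Iic z) := measureReal_mono (Set.Iic_subset_Iic.2 hyz)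
    have h3 := mul_le_mul_of_nonneg_left h2 hw
    simp only [hH]
    linarith
end

/-! ### Hölder estimates for Taylor remainders of weighted characteristic functions -/

noncomputable section

/-- Interpolation between the Lipschitz bound `|x - y|`, used when it is at most `1`, and the
trivial bound `2`. -/
theorem norm_cexp_sub_cexp_le_rpow {δ : ℝ} (hδ : δ ∈ Set.Icc (0 : ℝ) 1) (x y : ℝ) :
    ‖Complex.exp (x * Complex.I) - Complex.exp (y * Complex.I)‖ ≤ 2 * |x - y| ^ δ := by
  have e : Complex.exp (x * Complex.I) - Complex.exp (y * Complex.I) =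
      Complex.exp (y * Complex.I) * (Complex.exp (Complex.I * (x - y : ℝ)) - 1) := by
    rw [mul_sub, ← Complex.exp_add, mul_one]
    congr 2
    push_cast
    ring
  rw [e, norm_mul, Complex.norm_exp_ofReal_mul_I, one_mul]
  rcases le_total |x - y| 1 with h | h
  · calc _ ≤ ‖x - y‖ := Real.norm_exp_I_mul_ofReal_sub_one_le
      _ = |x - y| ^ (1 : ℝ) := by rw [Real.rpow_one, Real.norm_eq_abs]
      _ ≤ |x - y| ^ δ := Real.rpow_le_rpow_of_exponent_ge_of_imp (abs_nonneg _) h hδ.2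
          (fun _ h0 => absurd h0 one_ne_zero)
      _ ≤ _ := by linarith [Real.rpow_nonneg (abs_nonneg (x - y)) δ]
  · calc _ ≤ ‖Complex.exp (Complex.I * (x - y : ℝ))‖ + ‖(1 : ℂ)‖ := norm_sub_le _ _
      _ = 2 := by rw [mul_comm, Complex.norm_exp_ofReal_mul_I]; norm_num
      _ ≤ _ := by linarith [Real.one_le_rpow h hδ.1]

/-- Mean value inequality: the derivative is `i (exp(iz) - 1)`, which the previous estimate bounds
by `2 M^δ`. Increments of the remainder are needed here, and its size is the case `y = 0`. -/
theorem norm_cexp_sub_linear_sub_le {δ M : ℝ} (hδ : δ ∈ Set.Icc (0 : ℝ) 1) {x y : ℝ}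
    (hx : |x| ≤ M) (hy : |y| ≤ M) :
    ‖(Complex.exp (x * Complex.I) - x * Complex.I) -
      (Complex.exp (y * Complex.I) - y * Complex.I)‖ ≤ 2 * M ^ δ * |x - y| := by
  have hd : ∀ z ∈ Set.Icc (-M) M, HasDerivWithinAt
      (fun z : ℝ => Complex.exp (z * Complex.I) - z * Complex.I)
      (Complex.exp (z * Complex.I) * Complex.I - Complex.I) (Set.Icc (-M) M) z := by
    intro z _
    have h0 : HasDerivAt (fun s : ℝ => (s : ℂ) * Complex.I) Complex.I z := by
      simpa using (Complex.ofRealCLM.hasDerivAt (x := z)).mul_const Complex.I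
    exact (h0.cexp.sub h0).hasDerivWithinAt
  have := (convex_Icc (-M) M).norm_image_sub_le_of_norm_hasDerivWithin_le hd
    (C := 2 * M ^ δ) (fun z hz => ?_) (abs_le.1 hy) (abs_le.1 hx)
  · simpa using this
  · have h := norm_cexp_sub_cexp_le_rpow hδ z 0
    have hz' : |z| ≤ M := abs_le.2 hz
    have e : Complex.exp (z * Complex.I) * Complex.I - Complex.I =
      (Complex.exp (z * Complex.I) - Complex.exp ((0 : ℝ) * Complex.I)) * Complex.I := by
      simp [sub_mul]
    rw [e, norm_mul, Complex.norm_I, mul_one]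
    refine h.trans ?_
    rw [sub_zero]
    gcongr
    exact hδ.1

/-- The mean value inequality once more: the derivative is `i` times the first-order remainder minus
its value at `0`. -/
theorem norm_cexp_sub_quadratic_sub_le {δ M : ℝ} (hδ : δ ∈ Set.Icc (0 : ℝ) 1) {x y : ℝ}
    (hx : |x| ≤ M) (hy : |y| ≤ M) :
    ‖(Complex.exp (x * Complex.I) - x * Complex.I + (x ^ 2 / 2 : ℝ)) -
      (Complex.exp (y * Complex.I) - y * Complex.I + (y ^ 2 / 2 : ℝ))‖ ≤
      2 * (M * M ^ δ) * |x - y| := by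
  have hM : 0 ≤ M := (abs_nonneg _).trans hx
  have hd : ∀ z ∈ Set.Icc (-M) M, HasDerivWithinAt
      (fun z : ℝ => Complex.exp (z * Complex.I) - z * Complex.I + (z ^ 2 / 2 : ℝ))
      (Complex.exp (z * Complex.I) * Complex.I - Complex.I + (z : ℂ)) (Set.Icc (-M) M) z := by
    intro z _
    have h0 : HasDerivAt (fun s : ℝ => (s : ℂ) * Complex.I) Complex.I z := by
      simpa using (Complex.ofRealCLM.hasDerivAt (x := z)).mul_const Complex.I
    have h1 : HasDerivAt (fun s : ℝ => s ^ 2 / 2) z z := by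
      have := (hasDerivAt_pow 2 z).div_const 2
      simpa using this
    exact ((h0.cexp.sub h0).add h1.ofReal_comp).hasDerivWithinAt
  have := (convex_Icc (-M) M).norm_image_sub_le_of_norm_hasDerivWithin_le hd
    (C := 2 * (M * M ^ δ)) (fun z hz => ?_) (abs_le.1 hy) (abs_le.1 hx)
  · simpa using this
  · have hz' : |z| ≤ M := abs_le.2 hz
    have h := norm_cexp_sub_linear_sub_le hδ hz' (y := 0) (by simpa using hM)
    have e : Complex.exp (z * Complex.I) * Complex.I - Complex.I + (z : ℂ) =
        ((Complex.exp (z * Complex.I) - z * Complex.I) -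
        (Complex.exp ((0 : ℝ) * Complex.I) - (0 : ℝ) * Complex.I)) * Complex.I := by
      simp only [Complex.ofReal_zero, zero_mul, Complex.exp_zero, sub_zero]
      ring_nf
      simp [Complex.I_sq]
    rw [e, norm_mul, Complex.norm_I, mul_one]
    refine h.trans ?_
    rw [sub_zero]
    have : 0 ≤ M ^ δ := Real.rpow_nonneg hM _
    nlinarith

/-- A centered pair of random variables with a finite moment of order `2 + δ`. -/
structure IsCenteredPair {Ω : Type*} [MeasurableSpace Ω] (P : Measure Ω) (V W : Ω → ℝ)
    (δ : ℝ) : Prop where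
  aemeasurable_fst : AEMeasurable V P
  aemeasurable_snd : AEMeasurable W P
  pos : 0 < δ
  le_one : δ ≤ 1
  integrable_rpow : Integrable (fun ω => Real.sqrt (V ω ^ 2 + W ω ^ 2) ^ (2 + δ)) P
  integral_fst : ∫ ω, V ω ∂P = 0
  integral_snd : ∫ ω, W ω ∂P = 0

/-- The Fourier transform of the law of `(V, W)`, weighted by `W ^ k`. -/
def weightedCharFun {Ω : Type*} [MeasurableSpace Ω] (P : Measure Ω) (V W : Ω → ℝ) (k : ℕ)
    (s t : ℝ) : ℂ :=
  ∫ ω, (W ω ^ k : ℝ) * Complex.exp ((s * V ω + t * W ω : ℝ) * Complex.I) ∂P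

theorem abs_inner_le_mul_sqrt {s t r v w : ℝ} (hr : 0 ≤ r) (h : s ^ 2 + t ^ 2 ≤ r ^ 2) :
    |s * v + t * w| ≤ r * Real.sqrt (v ^ 2 + w ^ 2) := by
  rw [← Real.sqrt_sq hr, ← Real.sqrt_mul (sq_nonneg r)]
  refine Real.abs_le_sqrt ?_
  nlinarith [sq_nonneg (s * w - t * v), mul_le_mul_of_nonneg_right h
    (add_nonneg (sq_nonneg v) (sq_nonneg w))]

theorem abs_fst_le_sqrt (v w : ℝ) : |v| ≤ Real.sqrt (v ^ 2 + w ^ 2) :=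
  Real.abs_le_sqrt (by nlinarith [sq_nonneg w])

theorem abs_snd_le_sqrt (v w : ℝ) : |w| ≤ Real.sqrt (v ^ 2 + w ^ 2) :=
  Real.abs_le_sqrt (by nlinarith [sq_nonneg v])

namespace IsCenteredPair

variable {Ω : Type*} [MeasurableSpace Ω] {P : Measure Ω} {V W : Ω → ℝ} {δ : ℝ}

theorem mem_Icc (h : IsCenteredPair P V W δ) : δ ∈ Set.Icc (0 : ℝ) 1 := ⟨h.pos.le, h.le_one⟩

theorem memLp [IsProbabilityMeasure P] (h : IsCenteredPair P V W δ) {X : Ω → ℝ}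
    (hX : AEMeasurable X P) (hle : ∀ ω, |X ω| ≤ Real.sqrt (V ω ^ 2 + W ω ^ 2)) :
    MemLp X 2 P := by
  rw [memLp_two_iff_integrable_sq hX.aestronglyMeasurable]
  refine ((integrable_const (1 : ℝ)).add h.integrable_rpow).mono'
    (hX.pow_const 2).aestronglyMeasurable (ae_of_all _ fun ω => ?_)
  have h1 := hle ω
  simp only [Pi.add_apply]
  set R := Real.sqrt (V ω ^ 2 + W ω ^ 2)
  have hR : 0 ≤ R := Real.sqrt_nonneg _
  rw [Real.norm_of_nonneg (sq_nonneg _), ← sq_abs]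
  refine (pow_le_pow_left₀ (abs_nonneg _) h1 2).trans ?_
  rcases le_total R 1 with h2 | h2
  · have : R ^ 2 ≤ 1 := pow_le_one₀ hR h2
    have := Real.rpow_nonneg hR (2 + δ)
    linarith
  · have : R ^ (2 : ℝ) ≤ R ^ (2 + δ) := Real.rpow_le_rpow_of_exponent_le h2 (by linarith [h.pos])
    rw [Real.rpow_two] at this
    linarith

theorem memLp_fst [IsProbabilityMeasure P] (h : IsCenteredPair P V W δ) : MemLp V 2 P :=
  h.memLp h.aemeasurable_fst fun _ => abs_fst_le_sqrt _ _

theorem memLp_snd [IsProbabilityMeasure P] (h : IsCenteredPair P V W δ) : MemLp W 2 P :=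
  h.memLp h.aemeasurable_snd fun _ => abs_snd_le_sqrt _ _

theorem aestronglyMeasurable_cexp (h : IsCenteredPair P V W δ) (s t : ℝ) :
    AEStronglyMeasurable
      (fun ω => Complex.exp ((s * V ω + t * W ω : ℝ) * Complex.I)) P := by
  have h1 := h.aemeasurable_fst
  have h2 := h.aemeasurable_snd
  have : Measurable fun x : ℝ => Complex.exp (x * Complex.I) := by fun_prop
  exact (this.comp_aemeasurable
    ((h1.const_mul s).add (h2.const_mul t))).aestronglyMeasurable

theorem integrable_pow_mul_cexp [IsProbabilityMeasure P] (h : IsCenteredPair P V W δ) {k : ℕ}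
    (hk : k ≤ 2) (s t : ℝ) : Integrable
      (fun ω => ((W ω ^ k : ℝ) : ℂ) * Complex.exp ((s * V ω + t * W ω : ℝ) * Complex.I)) P := by
  have hi : Integrable (fun ω => W ω ^ k) P := by
    interval_cases k
    · simp
    · simpa using h.memLp_snd.integrable one_le_two
    · exact h.memLp_snd.integrable_sq
  exact hi.ofReal.mul_bdd (c := 1) (h.aestronglyMeasurable_cexp s t)
    (ae_of_all _ fun ω => (Complex.norm_exp_ofReal_mul_I _).le)

theorem norm_integral_le_moment (h : IsCenteredPair P V W δ) {f : Ω → ℂ} {c : ℝ}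
    (hf : ∀ ω, ‖f ω‖ ≤ c * (Real.sqrt (V ω ^ 2 + W ω ^ 2) ^ (2 : ℝ) *
      Real.sqrt (V ω ^ 2 + W ω ^ 2) ^ δ)) :
    ‖∫ ω, f ω ∂P‖ ≤ c * ∫ ω, Real.sqrt (V ω ^ 2 + W ω ^ 2) ^ (2 + δ) ∂P := by
  rw [← integral_const_mul]
  refine norm_integral_le_of_norm_le (h.integrable_rpow.const_mul c) (ae_of_all _ fun ω => ?_)
  rw [Real.rpow_add_of_nonneg (Real.sqrt_nonneg _) zero_le_two h.pos.le]
  exact hf ω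

/-- With `R = |(V, W)|` the integrand is at most `R² · 2 (dR)^δ`. The three lemmas for weights `2`,
`1`, `0` distribute the powers differently between weight and Taylor remainder, but each ends with
exactly `R^(2 + δ)`. -/
theorem norm_weightedCharFun_two_sub_le [IsProbabilityMeasure P] (h : IsCenteredPair P V W δ)
    {s t s₀ t₀ d : ℝ} (hd : 0 ≤ d) (hsd : (s - s₀) ^ 2 + (t - t₀) ^ 2 ≤ d ^ 2) :
    ‖weightedCharFun P V W 2 s t - weightedCharFun P V W 2 s₀ t₀‖ ≤
      2 * d ^ δ * ∫ ω, Real.sqrt (V ω ^ 2 + W ω ^ 2) ^ (2 + δ) ∂P := by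
  unfold weightedCharFun
  rw [← integral_sub (h.integrable_pow_mul_cexp le_rfl s t)
    (h.integrable_pow_mul_cexp le_rfl s₀ t₀)]
  refine h.norm_integral_le_moment fun ω => ?_
  have hR : 0 ≤ Real.sqrt (V ω ^ 2 + W ω ^ 2) := Real.sqrt_nonneg _
  have h1 := abs_inner_le_mul_sqrt (v := V ω) (w := W ω) hd hsd
  have h2 := abs_snd_le_sqrt (V ω) (W ω)
  set R := Real.sqrt (V ω ^ 2 + W ω ^ 2)
  have h3 := norm_cexp_sub_cexp_le_rpow h.mem_Icc (s * V ω + t * W ω) (s₀ * V ω + t₀ * W ω)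
  have e : s * V ω + t * W ω - (s₀ * V ω + t₀ * W ω) = (s - s₀) * V ω + (t - t₀) * W ω := by ring
  rw [e] at h3
  rw [← mul_sub, norm_mul, Complex.norm_real, Real.norm_of_nonneg (sq_nonneg _), ← sq_abs,
    Real.rpow_two]
  calc _ ≤ R ^ 2 * (2 * (d * R) ^ δ) := by
        refine mul_le_mul (pow_le_pow_left₀ (abs_nonneg _) h2 2) (h3.trans ?_) (norm_nonneg _)
          (sq_nonneg _)
        have := Real.rpow_le_rpow (abs_nonneg _) h1 h.pos.le
        linarith
    _ = _ := by rw [Real.mul_rpow hd hR]; ring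

/-- One power of `R` comes from the weight, the rest from the first-order remainder: `R · 2 (rR)^δ ·
dR`. No centring is needed, since the constant term `E[W]` cancels in the increment. -/
theorem norm_weightedCharFun_one_sub_le [IsProbabilityMeasure P] (h : IsCenteredPair P V W δ)
    {s t s₀ t₀ d r : ℝ} (hd : 0 ≤ d) (hsd : (s - s₀) ^ 2 + (t - t₀) ^ 2 ≤ d ^ 2) (hr : 0 ≤ r)
    (hsr : s ^ 2 + t ^ 2 ≤ r ^ 2) (hsr₀ : s₀ ^ 2 + t₀ ^ 2 ≤ r ^ 2) :
    ‖(weightedCharFun P V W 1 s t -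
        (s * (∫ ω, V ω * W ω ∂P) + t * ∫ ω, W ω ^ 2 ∂P : ℝ) * Complex.I) -
      (weightedCharFun P V W 1 s₀ t₀ -
        (s₀ * (∫ ω, V ω * W ω ∂P) + t₀ * ∫ ω, W ω ^ 2 ∂P : ℝ) * Complex.I)‖ ≤
      2 * r ^ δ * d * ∫ ω, Real.sqrt (V ω ^ 2 + W ω ^ 2) ^ (2 + δ) ∂P := by
  have hVW : Integrable (fun ω => V ω * W ω) P := h.memLp_fst.integrable_mul h.memLp_snd
  have hWW : Integrable (fun ω => W ω ^ 2) P := h.memLp_snd.integrable_sq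
  have hl : ∀ s t : ℝ, Integrable
      (fun ω => ((s * (V ω * W ω) + t * W ω ^ 2 : ℝ) : ℂ) * Complex.I) P := fun s t =>
    (((hVW.const_mul s).add (hWW.const_mul t)).ofReal).mul_const _
  have e : ∀ s t : ℝ, weightedCharFun P V W 1 s t -
      (s * (∫ ω, V ω * W ω ∂P) + t * ∫ ω, W ω ^ 2 ∂P : ℝ) * Complex.I =
      ∫ ω, (((W ω ^ 1 : ℝ) : ℂ) * Complex.exp ((s * V ω + t * W ω : ℝ) * Complex.I) -
        ((s * (V ω * W ω) + t * W ω ^ 2 : ℝ) : ℂ) * Complex.I) ∂P := by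
    intro s t
    rw [integral_sub (h.integrable_pow_mul_cexp one_le_two s t) (hl s t), integral_mul_const,
      integral_complex_ofReal, integral_add (hVW.const_mul s) (hWW.const_mul t),
      integral_const_mul, integral_const_mul]
    rfl
  have hall : ∀ s t : ℝ, Integrable (fun ω => ((W ω ^ 1 : ℝ) : ℂ) *
      Complex.exp ((s * V ω + t * W ω : ℝ) * Complex.I) -
        ((s * (V ω * W ω) + t * W ω ^ 2 : ℝ) : ℂ) * Complex.I) P := fun s t =>
    (h.integrable_pow_mul_cexp one_le_two s t).sub (hl s t)
  rw [e, e, ← integral_sub (hall s t) (hall s₀ t₀)]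
  refine h.norm_integral_le_moment fun ω => ?_
  have hR : 0 ≤ Real.sqrt (V ω ^ 2 + W ω ^ 2) := Real.sqrt_nonneg _
  have h1 := abs_inner_le_mul_sqrt (v := V ω) (w := W ω) hd hsd
  have h2 := abs_snd_le_sqrt (V ω) (W ω)
  have h4 := abs_inner_le_mul_sqrt (v := V ω) (w := W ω) hr hsr
  have h5 := abs_inner_le_mul_sqrt (v := V ω) (w := W ω) hr hsr₀
  set R := Real.sqrt (V ω ^ 2 + W ω ^ 2)
  have h3 := norm_cexp_sub_linear_sub_le h.mem_Icc h4 h5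
  have e : s * V ω + t * W ω - (s₀ * V ω + t₀ * W ω) = (s - s₀) * V ω + (t - t₀) * W ω := by ring
  rw [e] at h3
  have e2 : ((W ω ^ 1 : ℝ) : ℂ) * Complex.exp ((s * V ω + t * W ω : ℝ) * Complex.I) -
        ((s * (V ω * W ω) + t * W ω ^ 2 : ℝ) : ℂ) * Complex.I -
      (((W ω ^ 1 : ℝ) : ℂ) * Complex.exp ((s₀ * V ω + t₀ * W ω : ℝ) * Complex.I) -
        ((s₀ * (V ω * W ω) + t₀ * W ω ^ 2 : ℝ) : ℂ) * Complex.I) = (W ω : ℂ) *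
      (Complex.exp ((s * V ω + t * W ω : ℝ) * Complex.I) - (s * V ω + t * W ω : ℝ) * Complex.I -
      (Complex.exp ((s₀ * V ω + t₀ * W ω : ℝ) * Complex.I)
        - (s₀ * V ω + t₀ * W ω : ℝ) * Complex.I)) := by
    push_cast; ring
  rw [e2, norm_mul, Complex.norm_real, Real.norm_eq_abs, Real.rpow_two]
  have hc : 0 ≤ 2 * (r * R) ^ δ := by positivity
  calc _ ≤ R * (2 * (r * R) ^ δ * (d * R)) :=
        mul_le_mul h2 (h3.trans (mul_le_mul_of_nonneg_left h1 hc)) (norm_nonneg _) hR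
    _ = _ := by rw [Real.mul_rpow hr hR]; ring

/-- Centring removes the linear term, so the expression is the mean of second-order remainders, with
increments at most `2 (rR)^(1+δ) · dR`. -/
theorem norm_weightedCharFun_zero_sub_le [IsProbabilityMeasure P] (h : IsCenteredPair P V W δ)
    {s t s₀ t₀ d r : ℝ} (hd : 0 ≤ d) (hsd : (s - s₀) ^ 2 + (t - t₀) ^ 2 ≤ d ^ 2) (hr : 0 ≤ r)
    (hsr : s ^ 2 + t ^ 2 ≤ r ^ 2) (hsr₀ : s₀ ^ 2 + t₀ ^ 2 ≤ r ^ 2) :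
    ‖(weightedCharFun P V W 0 s t + ((s ^ 2 * (∫ ω, V ω ^ 2 ∂P) +
        2 * s * t * (∫ ω, V ω * W ω ∂P) + t ^ 2 * ∫ ω, W ω ^ 2 ∂P) / 2 : ℝ)) -
      (weightedCharFun P V W 0 s₀ t₀ + ((s₀ ^ 2 * (∫ ω, V ω ^ 2 ∂P) +
        2 * s₀ * t₀ * (∫ ω, V ω * W ω ∂P) + t₀ ^ 2 * ∫ ω, W ω ^ 2 ∂P) / 2 : ℝ))‖ ≤
      2 * (r * r ^ δ) * d * ∫ ω, Real.sqrt (V ω ^ 2 + W ω ^ 2) ^ (2 + δ) ∂P := by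
  have hV : Integrable V P := h.memLp_fst.integrable one_le_two
  have hW : Integrable W P := h.memLp_snd.integrable one_le_two
  have hVV : Integrable (fun ω => V ω ^ 2) P := h.memLp_fst.integrable_sq
  have hVW : Integrable (fun ω => V ω * W ω) P := h.memLp_fst.integrable_mul h.memLp_snd
  have hWW : Integrable (fun ω => W ω ^ 2) P := h.memLp_snd.integrable_sq
  have hi : ∀ s t : ℝ, Integrable
      (fun ω => Complex.exp ((s * V ω + t * W ω : ℝ) * Complex.I)) P := fun s t => by
    simpa using h.integrable_pow_mul_cexp zero_le_two s t
  have hl : ∀ s t : ℝ, Integrable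
      (fun ω => ((s * V ω + t * W ω : ℝ) : ℂ) * Complex.I) P := fun s t =>
    (((hV.const_mul s).add (hW.const_mul t)).ofReal).mul_const _
  have eq : ∀ s t : ℝ, (fun ω => (s * V ω + t * W ω) ^ 2 / 2) =
      fun ω => (s ^ 2 / 2) * V ω ^ 2 + (s * t) * (V ω * W ω) + (t ^ 2 / 2) * W ω ^ 2 := by
    intro s t; ext ω; ring
  have hq0 : ∀ s t : ℝ, Integrable (fun ω => (s * V ω + t * W ω) ^ 2 / 2) P := fun s t => by
    rw [eq]
    exact ((hVV.const_mul _).add (hVW.const_mul _)).add (hWW.const_mul _)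
  have hq : ∀ s t : ℝ, Integrable
      (fun ω => (((s * V ω + t * W ω) ^ 2 / 2 : ℝ) : ℂ)) P := fun s t => (hq0 s t).ofReal
  have e : ∀ s t : ℝ, weightedCharFun P V W 0 s t + ((s ^ 2 * (∫ ω, V ω ^ 2 ∂P) +
        2 * s * t * (∫ ω, V ω * W ω ∂P) + t ^ 2 * ∫ ω, W ω ^ 2 ∂P) / 2 : ℝ) =
      ∫ ω, (Complex.exp ((s * V ω + t * W ω : ℝ) * Complex.I) -
        ((s * V ω + t * W ω : ℝ) : ℂ) * Complex.I +
        (((s * V ω + t * W ω) ^ 2 / 2 : ℝ) : ℂ)) ∂P := by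
    intro s t
    rw [integral_add (f := fun ω => Complex.exp ((s * V ω + t * W ω : ℝ) * Complex.I) -
        ((s * V ω + t * W ω : ℝ) : ℂ) * Complex.I) ((hi s t).sub (hl s t)) (hq s t),
      integral_sub (hi s t) (hl s t), integral_mul_const, integral_complex_ofReal,
      integral_complex_ofReal, integral_add (hV.const_mul s) (hW.const_mul t),
      integral_const_mul, integral_const_mul, h.integral_fst, h.integral_snd, eq,
      integral_add (f := fun ω => (s ^ 2 / 2) * V ω ^ 2 + (s * t) * (V ω * W ω))
        ((hVV.const_mul _).add (hVW.const_mul _)) (hWW.const_mul _),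
      integral_add (hVV.const_mul _) (hVW.const_mul _),
      integral_const_mul, integral_const_mul, integral_const_mul, weightedCharFun]
    simp only [pow_zero, Complex.ofReal_one, one_mul]
    push_cast
    ring
  have hall : ∀ s t : ℝ, Integrable (fun ω => Complex.exp ((s * V ω + t * W ω : ℝ) * Complex.I) -
        ((s * V ω + t * W ω : ℝ) : ℂ) * Complex.I +
        (((s * V ω + t * W ω) ^ 2 / 2 : ℝ) : ℂ)) P := fun s t =>
    ((hi s t).sub (hl s t)).add (hq s t)
  rw [e, e, ← integral_sub (hall s t) (hall s₀ t₀)]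
  refine h.norm_integral_le_moment fun ω => ?_
  have hR : 0 ≤ Real.sqrt (V ω ^ 2 + W ω ^ 2) := Real.sqrt_nonneg _
  have h1 := abs_inner_le_mul_sqrt (v := V ω) (w := W ω) hd hsd
  have h4 := abs_inner_le_mul_sqrt (v := V ω) (w := W ω) hr hsr
  have h5 := abs_inner_le_mul_sqrt (v := V ω) (w := W ω) hr hsr₀
  set R := Real.sqrt (V ω ^ 2 + W ω ^ 2)
  have h3 := norm_cexp_sub_quadratic_sub_le h.mem_Icc h4 h5
  have e : s * V ω + t * W ω - (s₀ * V ω + t₀ * W ω) = (s - s₀) * V ω + (t - t₀) * W ω := by ring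
  rw [e] at h3
  rw [Real.rpow_two]
  have hc : 0 ≤ 2 * (r * R * (r * R) ^ δ) := by positivity
  refine h3.trans ((mul_le_mul_of_nonneg_left h1 hc).trans (le_of_eq ?_))
  rw [Real.mul_rpow hr hR]
  ring

end IsCenteredPair
end

/-! ### Calculus of mixed differences -/

noncomputable section

/-- Bounds of order `A` for `u, u₀, v, v₀`, in which passing from `u₀, v₀` to `u, v` gains a factor
`σ`, passing from `u, u₀` to `v, v₀` gains a factor `ε`, and the mixed difference gains both. -/
structure GridBound (A ε σ : ℝ) (u u₀ v v₀ : ℂ) : Prop where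
  nu : ‖u‖ ≤ A
  nu₀ : ‖u₀‖ ≤ A
  nv : ‖v‖ ≤ A
  nv₀ : ‖v₀‖ ≤ A
  du : ‖u - u₀‖ ≤ A * σ
  dv : ‖v - v₀‖ ≤ A * σ
  uv : ‖u - v‖ ≤ A * ε
  uv₀ : ‖u₀ - v₀‖ ≤ A * ε
  dd : ‖u - u₀ - (v - v₀)‖ ≤ A * ε * σ

namespace GridBound

variable {A B ε σ : ℝ} {u u₀ v v₀ u' u₀' v' v₀' : ℂ}

theorem nonneg (h : GridBound A ε σ u u₀ v v₀) : 0 ≤ A := (norm_nonneg _).trans h.nu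

theorem mono (hε : 0 ≤ ε) (hσ : 0 ≤ σ) (h : GridBound A ε σ u u₀ v v₀) (hAB : A ≤ B) :
    GridBound B ε σ u u₀ v v₀ where
  nu := h.nu.trans hAB
  nu₀ := h.nu₀.trans hAB
  nv := h.nv.trans hAB
  nv₀ := h.nv₀.trans hAB
  du := h.du.trans (by gcongr)
  dv := h.dv.trans (by gcongr)
  uv := h.uv.trans (by gcongr)
  uv₀ := h.uv₀.trans (by gcongr)
  dd := h.dd.trans (by gcongr)

theorem add (h : GridBound A ε σ u u₀ v v₀) (h' : GridBound B ε σ u' u₀' v' v₀') :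
    GridBound (A + B) ε σ (u + u') (u₀ + u₀') (v + v') (v₀ + v₀') where
  nu := (norm_add_le _ _).trans (add_le_add h.nu h'.nu)
  nu₀ := (norm_add_le _ _).trans (add_le_add h.nu₀ h'.nu₀)
  nv := (norm_add_le _ _).trans (add_le_add h.nv h'.nv)
  nv₀ := (norm_add_le _ _).trans (add_le_add h.nv₀ h'.nv₀)
  du := by
    rw [add_sub_add_comm, add_mul]; exact (norm_add_le _ _).trans (add_le_add h.du h'.du)
  dv := by
    rw [add_sub_add_comm, add_mul]; exact (norm_add_le _ _).trans (add_le_add h.dv h'.dv)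
  uv := by
    rw [add_sub_add_comm, add_mul]; exact (norm_add_le _ _).trans (add_le_add h.uv h'.uv)
  uv₀ := by
    rw [add_sub_add_comm, add_mul]; exact (norm_add_le _ _).trans (add_le_add h.uv₀ h'.uv₀)
  dd := by
    rw [add_sub_add_comm, add_sub_add_comm, add_sub_add_comm, add_mul, add_mul]
    exact (norm_add_le _ _).trans (add_le_add h.dd h'.dd)

theorem norm_mul_sub_mul_le {a b a' b' : ℂ} {x y x' y' : ℝ} (ha : ‖a - b‖ ≤ x) (ha' : ‖a'‖ ≤ x')
    (hb : ‖b‖ ≤ y) (hb' : ‖a' - b'‖ ≤ y') : ‖a * a' - b * b'‖ ≤ x * x' + y * y' := by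
  have e : a * a' - b * b' = (a - b) * a' + b * (a' - b') := by ring
  rw [e]
  refine (norm_add_le _ _).trans (add_le_add ?_ ?_)
  · rw [norm_mul]; exact mul_le_mul ha ha' (norm_nonneg _) ((norm_nonneg _).trans ha)
  · rw [norm_mul]; exact mul_le_mul hb hb' (norm_nonneg _) ((norm_nonneg _).trans hb)

/-- The discrete Leibniz rule splits the mixed difference of a product into four terms, each of
which carries one `ε` and one `σ`; hence the factor `4`. -/
theorem mul (hε : 0 ≤ ε) (hσ : 0 ≤ σ) (h : GridBound A ε σ u u₀ v v₀)
    (h' : GridBound B ε σ u' u₀' v' v₀') :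
    GridBound (4 * A * B) ε σ (u * u') (u₀ * u₀') (v * v') (v₀ * v₀') := by
  have hA := h.nonneg
  have hB := h'.nonneg
  have hAB : 0 ≤ A * B := mul_nonneg hA hB
  have hABσ : 0 ≤ A * B * σ := mul_nonneg hAB hσ
  have hABε : 0 ≤ A * B * ε := mul_nonneg hAB hε
  have hnorm : ∀ {x y : ℂ}, ‖x‖ ≤ A → ‖y‖ ≤ B → ‖x * y‖ ≤ 4 * A * B := by
    intro x y hx hy
    rw [norm_mul]
    have := mul_le_mul hx hy (norm_nonneg _) hA
    linarith
  have hdiff : ∀ {x y x' y' : ℂ} {κ : ℝ}, 0 ≤ A * B * κ → ‖x - y‖ ≤ A * κ → ‖x'‖ ≤ B → ‖y‖ ≤ A →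
      ‖x' - y'‖ ≤ B * κ → ‖x * x' - y * y'‖ ≤ 4 * A * B * κ := by
    intro x y x' y' κ hκ h1 h2 h3 h4
    refine (norm_mul_sub_mul_le h1 h2 h3 h4).trans ?_
    linarith
  refine ⟨hnorm h.nu h'.nu, hnorm h.nu₀ h'.nu₀, hnorm h.nv h'.nv, hnorm h.nv₀ h'.nv₀,
    hdiff hABσ h.du h'.nu h.nu₀ h'.du, hdiff hABσ h.dv h'.nv h.nv₀ h'.dv,
    hdiff hABε h.uv h'.nu h.nv h'.uv, hdiff hABε h.uv₀ h'.nu₀ h.nv₀ h'.uv₀, ?_⟩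
  have e : u * u' - u₀ * u₀' - (v * v' - v₀ * v₀') =
      ((u - u₀ - (v - v₀)) * u' + (u₀ - v₀) * (u' - u₀')) +
      ((v - v₀) * (u' - v') + v₀ * (u' - u₀' - (v' - v₀'))) := by ring
  rw [e]
  have b1 : ‖(u - u₀ - (v - v₀)) * u'‖ ≤ A * ε * σ * B := by
    rw [norm_mul]; exact mul_le_mul h.dd h'.nu (norm_nonneg _) (by positivity)
  have b2 : ‖(u₀ - v₀) * (u' - u₀')‖ ≤ A * ε * (B * σ) := by
    rw [norm_mul]; exact mul_le_mul h.uv₀ h'.du (norm_nonneg _) (by positivity)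
  have b3 : ‖(v - v₀) * (u' - v')‖ ≤ A * σ * (B * ε) := by
    rw [norm_mul]; exact mul_le_mul h.dv h'.uv (norm_nonneg _) (by positivity)
  have b4 : ‖v₀ * (u' - u₀' - (v' - v₀'))‖ ≤ A * (B * ε * σ) := by
    rw [norm_mul]; exact mul_le_mul h.nv₀ h'.dd (norm_nonneg _) (by positivity)
  have := norm_add_le ((u - u₀ - (v - v₀)) * u' + (u₀ - v₀) * (u' - u₀'))
    ((v - v₀) * (u' - v') + v₀ * (u' - u₀' - (v' - v₀')))
  have := norm_add_le ((u - u₀ - (v - v₀)) * u') ((u₀ - v₀) * (u' - u₀'))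
  have := norm_add_le ((v - v₀) * (u' - v')) (v₀ * (u' - u₀' - (v' - v₀')))
  nlinarith

/-- Bounds on the limit values `v, v₀` and on the differences suffice: since `ε ≤ 1`, the sizes and
increments of `u, u₀` follow by the triangle inequality. -/
theorem of_sub (hε : 0 ≤ ε) (hε1 : ε ≤ 1) (hσ : 0 ≤ σ) (nv : ‖v‖ ≤ A) (nv₀ : ‖v₀‖ ≤ A)
    (dv : ‖v - v₀‖ ≤ A * σ) (uv : ‖u - v‖ ≤ A * ε) (uv₀ : ‖u₀ - v₀‖ ≤ A * ε)
    (dd : ‖u - u₀ - (v - v₀)‖ ≤ A * ε * σ) : GridBound (2 * A) ε σ u u₀ v v₀ := by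
  have hA : 0 ≤ A := (norm_nonneg _).trans nv
  have hAσ : 0 ≤ A * σ := mul_nonneg hA hσ
  have hAε : 0 ≤ A * ε := mul_nonneg hA hε
  have hAεσ : 0 ≤ A * ε * σ := mul_nonneg hAε hσ
  have e1 : A * ε ≤ A := mul_le_of_le_one_right hA hε1
  have e2 : A * ε * σ ≤ A * σ := by gcongr
  have tri : ∀ {x y : ℂ} {a b : ℝ}, ‖x - y‖ ≤ a → ‖y‖ ≤ b → ‖x‖ ≤ a + b := by
    intro x y a b h1 h2
    have := norm_add_le (x - y) y
    rw [sub_add_cancel] at this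
    linarith
  refine ⟨(tri uv nv).trans ?_, (tri uv₀ nv₀).trans ?_, ?_, ?_, (tri dd dv).trans ?_, ?_, ?_, ?_, ?_⟩
    <;> linarith

theorem const (hε : 0 ≤ ε) (hσ : 0 ≤ σ) {a b : ℂ} (ha : ‖a‖ ≤ A) (hb : ‖b‖ ≤ A)
    (hab : ‖a - b‖ ≤ A * ε) : GridBound A ε σ a a b b := by
  have hA : 0 ≤ A := (norm_nonneg _).trans ha
  refine ⟨ha, ha, hb, hb, ?_, ?_, hab, hab, ?_⟩ <;> simp only [sub_self, norm_zero] <;> positivity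

/-- All hypotheses are relative to the size `θ`, so induction keeps a full `θ^N`. A single
difference costs `N a` and the mixed one `N a + (N a)²`. In the application `a` is of order `1 / n`
with `N ≤ n`, so these stay bounded. -/
theorem pow {a θ : ℝ} (hε : 0 ≤ ε) (hσ : 0 ≤ σ) (ha : 0 ≤ a) (hθ : 0 ≤ θ) (nu : ‖u‖ ≤ θ)
    (nu₀ : ‖u₀‖ ≤ θ) (nv : ‖v‖ ≤ θ) (nv₀ : ‖v₀‖ ≤ θ) (du : ‖u - u₀‖ ≤ a * σ * θ)
    (dv : ‖v - v₀‖ ≤ a * σ * θ) (uv : ‖u - v‖ ≤ a * ε * θ) (uv₀ : ‖u₀ - v₀‖ ≤ a * ε * θ)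
    (dd : ‖u - u₀ - (v - v₀)‖ ≤ a * ε * σ * θ) (N : ℕ) :
    GridBound ((1 + N * a) ^ 2 * θ ^ N) ε σ (u ^ N) (u₀ ^ N) (v ^ N) (v₀ ^ N) := by
  have hn : ∀ {x : ℂ} (N : ℕ), ‖x‖ ≤ θ → ‖x ^ N‖ ≤ θ ^ N := fun N hx => by
    rw [norm_pow]; exact pow_le_pow_left₀ (norm_nonneg _) hx N
  have hdiff : ∀ {x y : ℂ} {κ : ℝ} (N : ℕ), ‖x‖ ≤ θ → ‖y‖ ≤ θ → ‖x - y‖ ≤ a * κ * θ →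
      ‖x ^ N - y ^ N‖ ≤ N * a * κ * θ ^ N := by
    intro x y κ N hx hy hxy
    induction N with
    | zero => simp
    | succ N ih =>
      rw [pow_succ', pow_succ']
      refine (norm_mul_sub_mul_le hxy (hn N hx) hy ih).trans (le_of_eq ?_)
      push_cast; ring
  have hdd : ∀ N : ℕ, ‖u ^ N - u₀ ^ N - (v ^ N - v₀ ^ N)‖ ≤
      (N * a + (N * a) ^ 2) * ε * σ * θ ^ N := by
    intro N
    induction N with
    | zero => simp
    | succ N ih =>
      have e : u ^ (N + 1) - u₀ ^ (N + 1) - (v ^ (N + 1) - v₀ ^ (N + 1)) =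
        ((u - u₀ - (v - v₀)) * u ^ N + (u₀ - v₀) * (u ^ N - u₀ ^ N)) +
        ((v - v₀) * (u ^ N - v ^ N) + v₀ * (u ^ N - u₀ ^ N - (v ^ N - v₀ ^ N))) := by ring
      rw [e]
      have b1 : ‖(u - u₀ - (v - v₀)) * u ^ N‖ ≤ a * ε * σ * θ * θ ^ N := by
        rw [norm_mul]; exact mul_le_mul dd (hn N nu) (norm_nonneg _) (by positivity)
      have b2 : ‖(u₀ - v₀) * (u ^ N - u₀ ^ N)‖ ≤ a * ε * θ * (N * a * σ * θ ^ N) := by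
        rw [norm_mul]; exact mul_le_mul uv₀ (hdiff N nu nu₀ du) (norm_nonneg _) (by positivity)
      have b3 : ‖(v - v₀) * (u ^ N - v ^ N)‖ ≤ a * σ * θ * (N * a * ε * θ ^ N) := by
        rw [norm_mul]; exact mul_le_mul dv (hdiff N nu nv uv) (norm_nonneg _) (by positivity)
      have b4 : ‖v₀ * (u ^ N - u₀ ^ N - (v ^ N - v₀ ^ N))‖ ≤
          θ * ((N * a + (N * a) ^ 2) * ε * σ * θ ^ N) := by
        rw [norm_mul]; exact mul_le_mul nv₀ ih (norm_nonneg _) hθ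
      refine (norm_add_le _ _).trans ((add_le_add ((norm_add_le _ _).trans (add_le_add b1 b2))
        ((norm_add_le _ _).trans (add_le_add b3 b4))).trans ?_)
      have h0 : 0 ≤ a ^ 2 * (ε * σ * θ ^ (N + 1)) := by positivity
      push_cast
      rw [pow_succ θ N] at h0 ⊢
      nlinarith
  have hNa : 0 ≤ N * a := by positivity
  have hθN : 0 ≤ θ ^ N := pow_nonneg hθ N
  have hle : θ ^ N ≤ (1 + N * a) ^ 2 * θ ^ N := by
    refine le_mul_of_one_le_left hθN ?_; nlinarith
  have hle2 : ∀ κ, 0 ≤ κ → N * a * κ * θ ^ N ≤ (1 + N * a) ^ 2 * θ ^ N * κ := by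
    intro κ hκ
    have : 0 ≤ (1 + N * a + (N * a) ^ 2) * (θ ^ N * κ) := by positivity
    nlinarith
  refine ⟨(hn N nu).trans hle, (hn N nu₀).trans hle, (hn N nv).trans hle, (hn N nv₀).trans hle,
    (hdiff N nu nu₀ du).trans (hle2 σ hσ), (hdiff N nv nv₀ dv).trans (hle2 σ hσ),
    (hdiff N nu nv uv).trans (hle2 ε hε), (hdiff N nu₀ nv₀ uv₀).trans (hle2 ε hε),
    (hdd N).trans ?_⟩
  have : 0 ≤ (1 + N * a) * (θ ^ N * (ε * σ)) := by positivity
  nlinarith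

end GridBound

/-- The derivative `1 - exp(-z)` lies between `0` and `z ≤ M`. -/
theorem abs_exp_neg_sub_one_add_sub_le {x y M : ℝ} (hx : 0 ≤ x) (hy : 0 ≤ y) (hxM : x ≤ M)
    (hyM : y ≤ M) :
    |(Real.exp (-x) - 1 + x) - (Real.exp (-y) - 1 + y)| ≤ M * |x - y| := by
  have hd : ∀ z ∈ Set.Icc 0 M, HasDerivWithinAt (fun z : ℝ => Real.exp (-z) - 1 + z)
      (Real.exp (-z) * (-1) + 1) (Set.Icc 0 M) z := fun z _ =>
    (((hasDerivAt_neg z).exp.sub_const 1).add (hasDerivAt_id z)).hasDerivWithinAt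
  have := (convex_Icc 0 M).norm_image_sub_le_of_norm_hasDerivWithin_le hd (C := M)
    (fun z hz => ?_) ⟨hy, hyM⟩ ⟨hx, hxM⟩
  · simpa using this
  · have h1 := Real.add_one_le_exp (-z)
    have h2 : Real.exp (-z) ≤ 1 := Real.exp_le_one_iff.2 (by linarith [hz.1])
    rw [Real.norm_eq_abs, abs_le]
    constructor <;> linarith [hz.1, hz.2]

theorem abs_exp_neg_sub_le {x y : ℝ} (hx : 0 ≤ x) (hy : 0 ≤ y) :
    |Real.exp (-x) - Real.exp (-y)| ≤ |x - y| := by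
  have hd : ∀ z ∈ Set.Ici (0 : ℝ), HasDerivWithinAt (fun z : ℝ => Real.exp (-z))
      (Real.exp (-z) * (-1)) (Set.Ici 0) z := fun z _ =>
    (hasDerivAt_neg z).exp.hasDerivWithinAt
  have := (convex_Ici 0).norm_image_sub_le_of_norm_hasDerivWithin_le hd (C := 1)
    (fun z hz => ?_) hy hx
  · simpa using this
  · have h2 : Real.exp (-z) ≤ 1 := Real.exp_le_one_iff.2 (by simpa using hz)
    simpa using h2
end

/-! ### Rescaled transforms with weights `W` and `W²` -/

noncomputable section

variable {Ω : Type*} [MeasurableSpace Ω]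

/-- The quadratic form of the second moments of `(V, W)`. -/
def momentForm (P : Measure Ω) (V W : Ω → ℝ) (s t : ℝ) : ℝ :=
  s ^ 2 * (∫ ω, V ω ^ 2 ∂P) + 2 * s * t * (∫ ω, V ω * W ω ∂P) + t ^ 2 * ∫ ω, W ω ^ 2 ∂P

/-- The linear form `(s, t) ↦ E[(s V + t W) W]`. -/
def momentLin (P : Measure Ω) (V W : Ω → ℝ) (s t : ℝ) : ℝ :=
  s * (∫ ω, V ω * W ω ∂P) + t * ∫ ω, W ω ^ 2 ∂P

/-- A common bound for the second moments and the moment of order `2 + δ`. -/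
def momentBound (P : Measure Ω) (V W : Ω → ℝ) (δ : ℝ) : ℝ :=
  (∫ ω, V ω ^ 2 ∂P) + 2 * |∫ ω, V ω * W ω ∂P| + (∫ ω, W ω ^ 2 ∂P) +
    2 * ∫ ω, Real.sqrt (V ω ^ 2 + W ω ^ 2) ^ (2 + δ) ∂P

/-- The Fourier transform of the law of `(X_n, Y_n) / √n`, weighted by `1 + Y_n ^ 2 / n`, for a
sum `(X_n, Y_n)` of `n` independent copies of `(V, W)`. -/
def sumCharFun (P : Measure Ω) (V W : Ω → ℝ) (n : ℕ) (s t : ℝ) : ℂ :=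
  weightedCharFun P V W 0 (s / √n) (t / √n) ^ n +
    (((n - 1) / n : ℝ) : ℂ) * weightedCharFun P V W 0 (s / √n) (t / √n) ^ (n - 2) *
      ((√n : ℂ) * weightedCharFun P V W 1 (s / √n) (t / √n)) ^ 2 +
    weightedCharFun P V W 0 (s / √n) (t / √n) ^ (n - 1) *
      weightedCharFun P V W 2 (s / √n) (t / √n)

/-- The Gaussian limit of `sumCharFun`. -/
def limitCharFun (P : Measure Ω) (V W : Ω → ℝ) (s t : ℝ) : ℂ :=
  Real.exp (-(momentForm P V W s t / 2)) *
    (1 + (momentLin P V W s t * Complex.I) ^ 2 + (∫ ω, W ω ^ 2 ∂P : ℝ))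

variable {P : Measure Ω} {V W : Ω → ℝ} {δ : ℝ}

theorem momentForm_smul (c s t : ℝ) :
    momentForm P V W (s / c) (t / c) = momentForm P V W s t / c ^ 2 := by
  unfold momentForm; ring

theorem momentLin_smul (c s t : ℝ) :
    momentLin P V W (s / c) (t / c) = momentLin P V W s t / c := by
  unfold momentLin; ring

theorem integral_sqrt_rpow_nonneg :
    0 ≤ ∫ ω, Real.sqrt (V ω ^ 2 + W ω ^ 2) ^ (2 + δ) ∂P :=
  integral_nonneg fun _ => Real.rpow_nonneg (Real.sqrt_nonneg _) _

theorem momentBound_nonneg : 0 ≤ momentBound P V W δ := by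
  have h1 : 0 ≤ ∫ ω, V ω ^ 2 ∂P := integral_nonneg fun _ => sq_nonneg _
  have h2 : 0 ≤ ∫ ω, W ω ^ 2 ∂P := integral_nonneg fun _ => sq_nonneg _
  have h3 : 0 ≤ ∫ ω, Real.sqrt (V ω ^ 2 + W ω ^ 2) ^ (2 + δ) ∂P := integral_sqrt_rpow_nonneg
  unfold momentBound
  positivity

theorem abs_momentLin_sub_le {s t s₀ t₀ d : ℝ} (hd : 0 ≤ d)
    (hsd : (s - s₀) ^ 2 + (t - t₀) ^ 2 ≤ d ^ 2) :
    |momentLin P V W s t - momentLin P V W s₀ t₀| ≤ momentBound P V W δ * d := by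
  have h1 : 0 ≤ ∫ ω, V ω ^ 2 ∂P := integral_nonneg fun _ => sq_nonneg _
  have h2 : 0 ≤ ∫ ω, W ω ^ 2 ∂P := integral_nonneg fun _ => sq_nonneg _
  have h3 : 0 ≤ ∫ ω, Real.sqrt (V ω ^ 2 + W ω ^ 2) ^ (2 + δ) ∂P := integral_sqrt_rpow_nonneg
  have hs : |s - s₀| ≤ d := abs_le_of_sq_le_sq (by nlinarith [sq_nonneg (t - t₀)]) hd
  have ht : |t - t₀| ≤ d := abs_le_of_sq_le_sq (by nlinarith [sq_nonneg (s - s₀)]) hd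
  unfold momentLin momentBound
  set β := ∫ ω, V ω * W ω ∂P
  set τ := ∫ ω, W ω ^ 2 ∂P
  have e : s * β + t * τ - (s₀ * β + t₀ * τ) = (s - s₀) * β + (t - t₀) * τ := by ring
  rw [e]
  refine (abs_add_le _ _).trans ?_
  rw [abs_mul, abs_mul, abs_of_nonneg h2]
  have := mul_le_mul_of_nonneg_right hs (abs_nonneg β)
  have := mul_le_mul_of_nonneg_right ht h2
  have := mul_nonneg h1 hd
  have := mul_nonneg h3 hd
  have := mul_nonneg (abs_nonneg β) hd
  nlinarith

theorem abs_momentForm_sub_le {s t s₀ t₀ d r : ℝ} (hd : 0 ≤ d)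
    (hsd : (s - s₀) ^ 2 + (t - t₀) ^ 2 ≤ d ^ 2) (hr : 0 ≤ r)
    (hsr : s ^ 2 + t ^ 2 ≤ r ^ 2) (hsr₀ : s₀ ^ 2 + t₀ ^ 2 ≤ r ^ 2) :
    |momentForm P V W s t - momentForm P V W s₀ t₀| ≤ 2 * momentBound P V W δ * (r * d) := by
  have h1 : 0 ≤ ∫ ω, V ω ^ 2 ∂P := integral_nonneg fun _ => sq_nonneg _
  have h2 : 0 ≤ ∫ ω, W ω ^ 2 ∂P := integral_nonneg fun _ => sq_nonneg _
  have h3 : 0 ≤ ∫ ω, Real.sqrt (V ω ^ 2 + W ω ^ 2) ^ (2 + δ) ∂P := integral_sqrt_rpow_nonneg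
  have hs : |s - s₀| ≤ d := abs_le_of_sq_le_sq (by nlinarith [sq_nonneg (t - t₀)]) hd
  have ht : |t - t₀| ≤ d := abs_le_of_sq_le_sq (by nlinarith [sq_nonneg (s - s₀)]) hd
  have hs1 : |s| ≤ r := abs_le_of_sq_le_sq (by nlinarith [sq_nonneg t]) hr
  have ht1 : |t| ≤ r := abs_le_of_sq_le_sq (by nlinarith [sq_nonneg s]) hr
  have hs0 : |s₀| ≤ r := abs_le_of_sq_le_sq (by nlinarith [sq_nonneg t₀]) hr
  have ht0 : |t₀| ≤ r := abs_le_of_sq_le_sq (by nlinarith [sq_nonneg s₀]) hr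
  unfold momentForm momentBound
  set α := ∫ ω, V ω ^ 2 ∂P
  set β := ∫ ω, V ω * W ω ∂P
  set τ := ∫ ω, W ω ^ 2 ∂P
  have hss : |s ^ 2 - s₀ ^ 2| ≤ 2 * r * d := by
    rw [show s ^ 2 - s₀ ^ 2 = (s + s₀) * (s - s₀) by ring, abs_mul]
    exact mul_le_mul ((abs_add_le _ _).trans (by linarith)) hs (abs_nonneg _) (by positivity)
  have htt : |t ^ 2 - t₀ ^ 2| ≤ 2 * r * d := by
    rw [show t ^ 2 - t₀ ^ 2 = (t + t₀) * (t - t₀) by ring, abs_mul]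
    exact mul_le_mul ((abs_add_le _ _).trans (by linarith)) ht (abs_nonneg _) (by positivity)
  have hst : |s * t - s₀ * t₀| ≤ 2 * r * d := by
    rw [show s * t - s₀ * t₀ = (s - s₀) * t + s₀ * (t - t₀) by ring]
    refine (abs_add_le _ _).trans ?_
    rw [abs_mul, abs_mul]
    have := mul_le_mul hs ht1 (abs_nonneg _) hd
    have := mul_le_mul hs0 ht (abs_nonneg _) hr
    linarith
  have e : s ^ 2 * α + 2 * s * t * β + t ^ 2 * τ - (s₀ ^ 2 * α + 2 * s₀ * t₀ * β + t₀ ^ 2 * τ) =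
    (s ^ 2 - s₀ ^ 2) * α + (s * t - s₀ * t₀) * (2 * β) + (t ^ 2 - t₀ ^ 2) * τ := by ring
  rw [e]
  refine (abs_add_three _ _ _).trans ?_
  rw [abs_mul (s ^ 2 - s₀ ^ 2), abs_mul (s * t - s₀ * t₀), abs_mul (t ^ 2 - t₀ ^ 2),
    abs_of_nonneg h1, abs_of_nonneg h2, abs_mul, abs_two]
  have := mul_le_mul_of_nonneg_right hss h1
  have := mul_le_mul_of_nonneg_right htt h2
  have := mul_le_mul_of_nonneg_right hst (mul_nonneg zero_le_two (abs_nonneg β))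
  have := mul_nonneg h3 (mul_nonneg hr hd)
  nlinarith

theorem div_sqrt_rpow {x : ℝ} (hx : 0 ≤ x) (n : ℕ) (δ : ℝ) :
    (x / √n) ^ δ = x ^ δ * (n : ℝ) ^ (-δ / 2) := by
  rw [Real.div_rpow hx (Real.sqrt_nonneg _), Real.sqrt_eq_rpow, ← Real.rpow_mul (Nat.cast_nonneg n),
    neg_div, Real.rpow_neg (Nat.cast_nonneg n), div_eq_mul_inv]
  congr 3
  ring

theorem div_sqrt_sq_add_le {n : ℕ} {x y z : ℝ} (h : x ^ 2 + y ^ 2 ≤ z ^ 2) :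
    (x / √n) ^ 2 + (y / √n) ^ 2 ≤ (z / √n) ^ 2 := by
  rw [div_pow, div_pow, div_pow, ← add_div]
  gcongr

namespace IsCenteredPair

theorem rpow_le_self (h : IsCenteredPair P V W δ) {r : ℝ} (hr : 1 ≤ r) : r ^ δ ≤ r := by
  simpa using Real.rpow_le_rpow_of_exponent_le hr h.le_one

theorem self_le_rpow (h : IsCenteredPair P V W δ) {d : ℝ} (hd : 0 ≤ d) (hd1 : d ≤ 1) :
    d ≤ d ^ δ := by
  rcases hd.eq_or_lt with rfl | hd0
  · exact Real.rpow_nonneg le_rfl _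
  · simpa using Real.rpow_le_rpow_of_exponent_ge hd0 hd1 h.le_one

theorem natCast_rpow_le_one (h : IsCenteredPair P V W δ) {n : ℕ} (hn : 1 ≤ n) :
    (n : ℝ) ^ (-δ / 2) ≤ 1 :=
  Real.rpow_le_one_of_one_le_of_nonpos (by exact_mod_cast hn) (by linarith [h.pos])

theorem inv_le_natCast_rpow (h : IsCenteredPair P V W δ) {n : ℕ} (hn : 1 ≤ n) :
    (n : ℝ)⁻¹ ≤ (n : ℝ) ^ (-δ / 2) := by
  rw [← Real.rpow_neg_one]
  exact Real.rpow_le_rpow_of_exponent_le (by exact_mod_cast hn) (by linarith [h.le_one])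

variable [IsProbabilityMeasure P]

/-- Hölder continuity at scale `1 / √n` yields both gains at once, as `(d / √n)^δ = d^δ n^(-δ/2)`.
The limit is the constant `E[W²]`, so its own increments vanish. -/
theorem gridBound_two (h : IsCenteredPair P V W δ) {n : ℕ} (hn : 1 ≤ n)
    {s t s₀ t₀ d r : ℝ} (hd : 0 ≤ d) (hsd : (s - s₀) ^ 2 + (t - t₀) ^ 2 ≤ d ^ 2)
    (hr : 1 ≤ r) (hsr : s ^ 2 + t ^ 2 ≤ r ^ 2) (hsr₀ : s₀ ^ 2 + t₀ ^ 2 ≤ r ^ 2) :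
    GridBound (2 * (momentBound P V W δ * r)) ((n : ℝ) ^ (-δ / 2)) (d ^ δ)
      (weightedCharFun P V W 2 (s / √n) (t / √n)) (weightedCharFun P V W 2 (s₀ / √n) (t₀ / √n))
      (∫ ω, W ω ^ 2 ∂P : ℝ) (∫ ω, W ω ^ 2 ∂P : ℝ) := by
  have h1 : 0 ≤ ∫ ω, V ω ^ 2 ∂P := integral_nonneg fun _ => sq_nonneg _
  have h2 : 0 ≤ ∫ ω, W ω ^ 2 ∂P := integral_nonneg fun _ => sq_nonneg _
  have h3 : 0 ≤ ∫ ω, Real.sqrt (V ω ^ 2 + W ω ^ 2) ^ (2 + δ) ∂P := integral_sqrt_rpow_nonneg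
  set M := ∫ ω, Real.sqrt (V ω ^ 2 + W ω ^ 2) ^ (2 + δ) ∂P with hM
  have hB : 2 * M ≤ momentBound P V W δ := by
    unfold momentBound; rw [← hM]; have := abs_nonneg (∫ ω, V ω * W ω ∂P); linarith
  have hB2 : (∫ ω, W ω ^ 2 ∂P) ≤ momentBound P V W δ := by
    unfold momentBound; rw [← hM]; have := abs_nonneg (∫ ω, V ω * W ω ∂P); linarith
  have hB0 : 0 ≤ momentBound P V W δ := momentBound_nonneg
  have hε : 0 ≤ (n : ℝ) ^ (-δ / 2) := Real.rpow_nonneg (Nat.cast_nonneg n) _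
  have hσ : 0 ≤ d ^ δ := Real.rpow_nonneg hd _
  have hw0 : weightedCharFun P V W 2 0 0 = (∫ ω, W ω ^ 2 ∂P : ℝ) := by
    rw [← integral_complex_ofReal]; simp [weightedCharFun]
  have hn' : ‖((∫ ω, W ω ^ 2 ∂P : ℝ) : ℂ)‖ ≤ momentBound P V W δ * r := by
    rw [Complex.norm_real, Real.norm_of_nonneg h2]
    nlinarith
  have huv : ∀ {s t : ℝ}, s ^ 2 + t ^ 2 ≤ r ^ 2 →
      ‖weightedCharFun P V W 2 (s / √n) (t / √n) - (∫ ω, W ω ^ 2 ∂P : ℝ)‖ ≤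
        momentBound P V W δ * r * (n : ℝ) ^ (-δ / 2) := by
    intro s t hsr
    rw [← hw0]
    refine (h.norm_weightedCharFun_two_sub_le (d := r / √n) (by positivity) ?_).trans ?_
    · simpa using div_sqrt_sq_add_le (n := n) hsr
    · rw [div_sqrt_rpow (by linarith)]
      have := h.rpow_le_self hr
      calc _ = r ^ δ * (n : ℝ) ^ (-δ / 2) * (2 * M) := by ring
        _ ≤ r * (n : ℝ) ^ (-δ / 2) * momentBound P V W δ := by gcongr
        _ = _ := by ring
  refine GridBound.of_sub hε (h.natCast_rpow_le_one hn) hσ hn' hn' ?_ (huv hsr) (huv hsr₀) ?_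
  · rw [sub_self, norm_zero]; positivity
  · rw [sub_self, sub_zero]
    refine (h.norm_weightedCharFun_two_sub_le (d := d / √n) (by positivity) ?_).trans ?_
    · rw [← sub_div, ← sub_div]
      exact div_sqrt_sq_add_le hsd
    · rw [div_sqrt_rpow hd]
      calc _ = 1 * (2 * M) * (n : ℝ) ^ (-δ / 2) * d ^ δ := by ring
        _ ≤ r * momentBound P V W δ * (n : ℝ) ^ (-δ / 2) * d ^ δ := by gcongr
        _ = _ := by ring

/-- Because `E[W] = 0`, the transform with weight `W` is of order `1 / √n`, and the factor `√n`
turns it into its linear part. The increment estimate from the origin also supplies the distance to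
the limit. -/
theorem gridBound_one (h : IsCenteredPair P V W δ) {n : ℕ} (hn : 1 ≤ n)
    {s t s₀ t₀ d r : ℝ} (hd : 0 ≤ d) (hd1 : d ≤ 1) (hsd : (s - s₀) ^ 2 + (t - t₀) ^ 2 ≤ d ^ 2)
    (hr : 1 ≤ r) (hsr : s ^ 2 + t ^ 2 ≤ r ^ 2) (hsr₀ : s₀ ^ 2 + t₀ ^ 2 ≤ r ^ 2) :
    GridBound (2 * (momentBound P V W δ * r ^ 2)) ((n : ℝ) ^ (-δ / 2)) (d ^ δ)
      (√n * weightedCharFun P V W 1 (s / √n) (t / √n))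
      (√n * weightedCharFun P V W 1 (s₀ / √n) (t₀ / √n))
      (momentLin P V W s t * Complex.I) (momentLin P V W s₀ t₀ * Complex.I) := by
  have h1 : 0 ≤ ∫ ω, V ω ^ 2 ∂P := integral_nonneg fun _ => sq_nonneg _
  have h2 : 0 ≤ ∫ ω, W ω ^ 2 ∂P := integral_nonneg fun _ => sq_nonneg _
  have h3 : 0 ≤ ∫ ω, Real.sqrt (V ω ^ 2 + W ω ^ 2) ^ (2 + δ) ∂P := integral_sqrt_rpow_nonneg
  set M := ∫ ω, Real.sqrt (V ω ^ 2 + W ω ^ 2) ^ (2 + δ) ∂P with hM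
  have hB : 2 * M ≤ momentBound P V W δ := by
    unfold momentBound; rw [← hM]; have := abs_nonneg (∫ ω, V ω * W ω ∂P); linarith
  have hB0 : 0 ≤ momentBound P V W δ := momentBound_nonneg
  have hε : 0 ≤ (n : ℝ) ^ (-δ / 2) := Real.rpow_nonneg (Nat.cast_nonneg n) _
  have hσ : 0 ≤ d ^ δ := Real.rpow_nonneg hd _
  have hdσ := h.self_le_rpow hd hd1
  have hrδ := h.rpow_le_self hr
  have hr0 : 0 ≤ r := by linarith
  have hn0 : 0 < √(n : ℝ) := Real.sqrt_pos.2 (by exact_mod_cast hn)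
  have hrr : r ≤ r ^ 2 := by nlinarith
  have hw0 : weightedCharFun P V W 1 0 0 = 0 := by
    simp [weightedCharFun, integral_complex_ofReal, h.integral_snd]
  have hl0 : momentLin P V W 0 0 = 0 := by simp [momentLin]
  have hv : ∀ {s t : ℝ}, s ^ 2 + t ^ 2 ≤ r ^ 2 →
      ‖(momentLin P V W s t * Complex.I : ℂ)‖ ≤ momentBound P V W δ * r ^ 2 := by
    intro s t hsr
    rw [norm_mul, Complex.norm_I, mul_one, Complex.norm_real, Real.norm_eq_abs]
    have := abs_momentLin_sub_le (P := P) (V := V) (W := W) (δ := δ) (s := s) (t := t) (s₀ := 0)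
      (t₀ := 0) hr0 (by simpa using hsr)
    rw [hl0, sub_zero] at this
    exact this.trans (by gcongr)
  have hdiff : ∀ {s t s₀ t₀ d : ℝ}, 0 ≤ d → (s - s₀) ^ 2 + (t - t₀) ^ 2 ≤ d ^ 2 →
      s ^ 2 + t ^ 2 ≤ r ^ 2 → s₀ ^ 2 + t₀ ^ 2 ≤ r ^ 2 →
      ‖√n * weightedCharFun P V W 1 (s / √n) (t / √n) - momentLin P V W s t * Complex.I -
        (√n * weightedCharFun P V W 1 (s₀ / √n) (t₀ / √n) - momentLin P V W s₀ t₀ * Complex.I)‖ ≤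
        momentBound P V W δ * (r * d) * (n : ℝ) ^ (-δ / 2) := by
    intro s t s₀ t₀ d hd hsd hsr hsr₀
    have key := h.norm_weightedCharFun_one_sub_le (s := s / √n) (t := t / √n) (s₀ := s₀ / √n)
      (t₀ := t₀ / √n) (d := d / √n) (r := r / √n) (by positivity)
      (by rw [← sub_div, ← sub_div]; exact div_sqrt_sq_add_le hsd) (by positivity)
      (div_sqrt_sq_add_le hsr) (div_sqrt_sq_add_le hsr₀)
    change ‖(_ - (momentLin P V W _ _ : ℂ) * _) - (_ - (momentLin P V W _ _ : ℂ) * _)‖ ≤ _ at key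
    rw [momentLin_smul, momentLin_smul, div_sqrt_rpow hr0] at key
    have e : √n * weightedCharFun P V W 1 (s / √n) (t / √n) - momentLin P V W s t * Complex.I -
        (√n * weightedCharFun P V W 1 (s₀ / √n) (t₀ / √n) - momentLin P V W s₀ t₀ * Complex.I) =
        √n * (weightedCharFun P V W 1 (s / √n) (t / √n)
          - (momentLin P V W s t / √n : ℝ) * Complex.I -
        (weightedCharFun P V W 1 (s₀ / √n) (t₀ / √n)
          - (momentLin P V W s₀ t₀ / √n : ℝ) * Complex.I)) := by
      have : (√n : ℂ) ≠ 0 := by exact_mod_cast hn0.ne'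
      push_cast
      field_simp
    rw [e, norm_mul, Complex.norm_real, Real.norm_of_nonneg hn0.le]
    calc _ ≤ √n * (2 * (r ^ δ * (n : ℝ) ^ (-δ / 2)) * (d / √n) * M) := by gcongr
      _ = (2 * M) * (r ^ δ * d) * (n : ℝ) ^ (-δ / 2) := by field_simp
      _ ≤ _ := by gcongr
  have huv : ∀ {s t : ℝ}, s ^ 2 + t ^ 2 ≤ r ^ 2 →
      ‖√n * weightedCharFun P V W 1 (s / √n) (t / √n) - momentLin P V W s t * Complex.I‖ ≤
        momentBound P V W δ * r ^ 2 * (n : ℝ) ^ (-δ / 2) := by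
    intro s t hsr
    have := hdiff (s := s) (t := t) (s₀ := 0) (t₀ := 0) hr0 (by simpa using hsr) hsr
      (by simpa using sq_nonneg r)
    simp only [zero_div, hw0, hl0, mul_zero, Complex.ofReal_zero, zero_mul, sub_zero] at this
    rwa [← sq] at this
  refine GridBound.of_sub hε (h.natCast_rpow_le_one hn) hσ (hv hsr) (hv hsr₀) ?_ (huv hsr)
    (huv hsr₀) ?_
  · rw [← sub_mul, norm_mul, Complex.norm_I, mul_one, ← Complex.ofReal_sub, Complex.norm_real,
      Real.norm_eq_abs]
    refine (abs_momentLin_sub_le (δ := δ) hd hsd).trans ?_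
    calc momentBound P V W δ * d = momentBound P V W δ * 1 * d := by ring
      _ ≤ momentBound P V W δ * r ^ 2 * d ^ δ := by
        gcongr
        exact hr.trans hrr
  · rw [sub_sub_sub_comm]
    refine (hdiff hd hsd hsr hsr₀).trans ?_
    calc _ ≤ momentBound P V W δ * (r ^ 2 * d ^ δ) * (n : ℝ) ^ (-δ / 2) := by gcongr
      _ = _ := by ring

end IsCenteredPair
end

/-! ### The one-step characteristic function, the Gaussian factor, and their powers -/

noncomputable section

variable {Ω : Type*} [MeasurableSpace Ω] {P : Measure Ω} {V W : Ω → ℝ} {δ : ℝ}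

theorem momentForm_nonneg_of_le {c : ℝ} (hc : 0 ≤ c)
    (hQ : ∀ s t, 2 * c * (s ^ 2 + t ^ 2) ≤ momentForm P V W s t) (s t : ℝ) :
    0 ≤ momentForm P V W s t :=
  le_trans (by positivity) (hQ s t)

theorem momentForm_zero : momentForm P V W 0 0 = 0 := by simp [momentForm]

theorem momentForm_le {s t r : ℝ} (hr : 0 ≤ r) (hsr : s ^ 2 + t ^ 2 ≤ r ^ 2) :
    momentForm P V W s t ≤ 2 * momentBound P V W δ * r ^ 2 := by
  have := abs_momentForm_sub_le (P := P) (V := V) (W := W) (δ := δ) (s₀ := 0) (t₀ := 0) hr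
    (by simpa using hsr) hr hsr (by simpa using sq_nonneg r)
  rw [momentForm_zero, sub_zero] at this
  calc _ ≤ _ := le_abs_self _
    _ ≤ _ := this
    _ = _ := by ring

/-- Increments and mixed differences of the Gaussian factor at scale `1 / √n`. -/
theorem gridBound_one_cexp (h : IsCenteredPair P V W δ) {n : ℕ} (hn : 1 ≤ n) {c : ℝ} (hc : 0 ≤ c)
    (hQ : ∀ s t, 2 * c * (s ^ 2 + t ^ 2) ≤ momentForm P V W s t)
    {s t s₀ t₀ d r : ℝ} (hd : 0 ≤ d) (hd1 : d ≤ 1) (hsd : (s - s₀) ^ 2 + (t - t₀) ^ 2 ≤ d ^ 2)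
    (hr : 1 ≤ r) (hsr : s ^ 2 + t ^ 2 ≤ r ^ 2) (hsr₀ : s₀ ^ 2 + t₀ ^ 2 ≤ r ^ 2) :
    GridBound ((1 + momentBound P V W δ) * r ^ 2) ((n : ℝ) ^ (-δ / 2)) (d ^ δ) 1 1
      (Real.exp (-(momentForm P V W (s / √n) (t / √n) / 2)) : ℝ)
      (Real.exp (-(momentForm P V W (s₀ / √n) (t₀ / √n) / 2)) : ℝ) := by
  have hB0 : 0 ≤ momentBound P V W δ := momentBound_nonneg
  have hε : 0 ≤ (n : ℝ) ^ (-δ / 2) := Real.rpow_nonneg (Nat.cast_nonneg n) _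
  have hσ : 0 ≤ d ^ δ := Real.rpow_nonneg hd _
  have hdσ := h.self_le_rpow hd hd1
  have hnε := h.inv_le_natCast_rpow hn
  have hε1 := h.natCast_rpow_le_one hn
  have hr0 : 0 ≤ r := by linarith
  have hn0 : (0 : ℝ) < n := by exact_mod_cast hn
  have hrr : r ≤ r ^ 2 := by nlinarith
  have hr1 : 1 ≤ r ^ 2 := by nlinarith
  have hQ0 := fun s t => momentForm_nonneg_of_le hc hQ s t
  set B := momentBound P V W δ
  have hA : 1 ≤ (1 + B) * r ^ 2 := by nlinarith
  have hA2 : B * r ^ 2 ≤ (1 + B) * r ^ 2 := by nlinarith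
  have hA3 : B * r ≤ (1 + B) * r ^ 2 := by nlinarith
  have hA0 : 0 ≤ (1 + B) * r ^ 2 := by linarith
  have hexp : ∀ s t : ℝ,
      ‖((Real.exp (-(momentForm P V W (s / √n) (t / √n) / 2)) : ℝ) : ℂ)‖ ≤ (1 + B) * r ^ 2 := by
    intro s t
    rw [Complex.norm_real, Real.norm_of_nonneg (Real.exp_pos _).le]
    exact (Real.exp_le_one_iff.2 (by linarith [hQ0 (s / √n) (t / √n)])).trans hA
  have hsub : ∀ s t : ℝ, s ^ 2 + t ^ 2 ≤ r ^ 2 →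
      ‖(1 : ℂ) - (Real.exp (-(momentForm P V W (s / √n) (t / √n) / 2)) : ℝ)‖ ≤
        (1 + B) * r ^ 2 * (n : ℝ) ^ (-δ / 2) := by
    intro s t hsr
    have h1 := momentForm_le (P := P) (V := V) (W := W) (δ := δ) hr0 hsr
    have h2 := hQ0 (s / √n) (t / √n)
    have h3 := Real.add_one_le_exp (-(momentForm P V W (s / √n) (t / √n) / 2))
    have h4 : Real.exp (-(momentForm P V W (s / √n) (t / √n) / 2)) ≤ 1 :=
      Real.exp_le_one_iff.2 (by linarith)
    rw [← Complex.ofReal_one, ← Complex.ofReal_sub, Complex.norm_real, Real.norm_of_nonneg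
      (by linarith)]
    calc _ ≤ momentForm P V W (s / √n) (t / √n) / 2 := by linarith
      _ = momentForm P V W s t * (n : ℝ)⁻¹ / 2 := by
        rw [momentForm_smul, Real.sq_sqrt hn0.le, div_eq_mul_inv (momentForm P V W s t)]
      _ ≤ 2 * B * r ^ 2 * (n : ℝ) ^ (-δ / 2) / 2 := by gcongr
      _ = B * r ^ 2 * (n : ℝ) ^ (-δ / 2) := by ring
      _ ≤ _ := by gcongr
  have hdiff : ‖((Real.exp (-(momentForm P V W (s / √n) (t / √n) / 2)) : ℝ) : ℂ) -
      (Real.exp (-(momentForm P V W (s₀ / √n) (t₀ / √n) / 2)) : ℝ)‖ ≤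
      (1 + B) * r ^ 2 * (n : ℝ) ^ (-δ / 2) * d ^ δ := by
    rw [← Complex.ofReal_sub, Complex.norm_real, Real.norm_eq_abs]
    refine (abs_exp_neg_sub_le (by linarith [hQ0 (s / √n) (t / √n)])
      (by linarith [hQ0 (s₀ / √n) (t₀ / √n)])).trans ?_
    have h1 := abs_momentForm_sub_le (P := P) (V := V) (W := W) (δ := δ) hd hsd hr0 hsr hsr₀
    rw [momentForm_smul, momentForm_smul, Real.sq_sqrt hn0.le, ← sub_div, ← sub_div, abs_div,
      abs_div, abs_of_pos hn0, abs_two]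
    calc _ ≤ 2 * B * (r * d) / n / 2 := by gcongr
      _ = B * r * (n : ℝ)⁻¹ * d := by field_simp
      _ ≤ _ := by gcongr
  refine ⟨?_, ?_, hexp _ _, hexp _ _, ?_, hdiff.trans ?_, hsub _ _ hsr, hsub _ _ hsr₀, ?_⟩
  · simpa using hA
  · simpa using hA
  · simp only [sub_self, norm_zero]; positivity
  · exact mul_le_mul_of_nonneg_right (mul_le_of_le_one_right hA0 hε1) hσ
  · rw [sub_self, zero_sub, norm_neg]
    exact hdiff

theorem abs_momentForm_div_sqrt_sub_le {n : ℕ} (hn : 1 ≤ n)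
    {s t s₀ t₀ d r : ℝ} (hd : 0 ≤ d) (hsd : (s - s₀) ^ 2 + (t - t₀) ^ 2 ≤ d ^ 2)
    (hr : 0 ≤ r) (hsr : s ^ 2 + t ^ 2 ≤ r ^ 2) (hsr₀ : s₀ ^ 2 + t₀ ^ 2 ≤ r ^ 2) :
    |momentForm P V W (s / √n) (t / √n) / 2 - momentForm P V W (s₀ / √n) (t₀ / √n) / 2| ≤
      momentBound P V W δ * (r * d) * (n : ℝ)⁻¹ := by
  have hn0 : (0 : ℝ) < n := by exact_mod_cast hn
  have hsn2 : √(n : ℝ) ^ 2 = n := Real.sq_sqrt hn0.le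
  have := abs_momentForm_sub_le (P := P) (V := V) (W := W) (δ := δ) hd hsd hr hsr hsr₀
  rw [momentForm_smul, momentForm_smul, hsn2, ← sub_div, ← sub_div, abs_div, abs_div,
    abs_of_pos hn0, abs_two]
  calc _ ≤ 2 * momentBound P V W δ * (r * d) / n / 2 := by gcongr
    _ = _ := by field_simp

namespace IsCenteredPair

variable [IsProbabilityMeasure P]

/-- The increment bound `r^(1+δ) d` is homogeneous of degree `2 + δ`, so rescaling by `√n` produces
`n^(-1) n^(-δ/2)`: the `n^(-1)` is spent on the `n` factors, the rest is the rate. -/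
theorem norm_taylor_remainder_sub_le (h : IsCenteredPair P V W δ) {n : ℕ} (hn : 1 ≤ n)
    {s t s₀ t₀ d r : ℝ} (hd : 0 ≤ d) (hsd : (s - s₀) ^ 2 + (t - t₀) ^ 2 ≤ d ^ 2)
    (hr : 1 ≤ r) (hsr : s ^ 2 + t ^ 2 ≤ r ^ 2) (hsr₀ : s₀ ^ 2 + t₀ ^ 2 ≤ r ^ 2) :
    ‖(weightedCharFun P V W 0 (s / √n) (t / √n) +
        (momentForm P V W (s / √n) (t / √n) / 2 : ℝ)) -
      (weightedCharFun P V W 0 (s₀ / √n) (t₀ / √n) +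
        (momentForm P V W (s₀ / √n) (t₀ / √n) / 2 : ℝ))‖ ≤
      momentBound P V W δ * (r ^ 2 * d) * (n : ℝ) ^ (-δ / 2) * (n : ℝ)⁻¹ := by
  have h1 : 0 ≤ ∫ ω, V ω ^ 2 ∂P := integral_nonneg fun _ => sq_nonneg _
  have h2 : 0 ≤ ∫ ω, W ω ^ 2 ∂P := integral_nonneg fun _ => sq_nonneg _
  have h3 : 0 ≤ ∫ ω, Real.sqrt (V ω ^ 2 + W ω ^ 2) ^ (2 + δ) ∂P := integral_sqrt_rpow_nonneg
  set M := ∫ ω, Real.sqrt (V ω ^ 2 + W ω ^ 2) ^ (2 + δ) ∂P with hM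
  have hB : 2 * M ≤ momentBound P V W δ := by
    unfold momentBound; rw [← hM]; have := abs_nonneg (∫ ω, V ω * W ω ∂P); linarith
  have hB0 : 0 ≤ momentBound P V W δ := momentBound_nonneg
  have hε : 0 ≤ (n : ℝ) ^ (-δ / 2) := Real.rpow_nonneg (Nat.cast_nonneg n) _
  have hrδ := h.rpow_le_self hr
  have hnε := h.inv_le_natCast_rpow hn
  have hr0 : 0 ≤ r := by linarith
  have hn0 : (0 : ℝ) < n := by exact_mod_cast hn
  have hsn2 : √(n : ℝ) ^ 2 = n := Real.sq_sqrt hn0.le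
  set B := momentBound P V W δ
  set ε := (n : ℝ) ^ (-δ / 2)
  have key := h.norm_weightedCharFun_zero_sub_le (s := s / √n) (t := t / √n) (s₀ := s₀ / √n)
    (t₀ := t₀ / √n) (d := d / √n) (r := r / √n) (by positivity)
    (by rw [← sub_div, ← sub_div]; exact div_sqrt_sq_add_le hsd) (by positivity)
    (div_sqrt_sq_add_le hsr) (div_sqrt_sq_add_le hsr₀)
  rw [div_sqrt_rpow hr0, ← hM] at key
  refine key.trans ?_
  calc _ = (2 * M) * (r * r ^ δ * d) * ε * (√(n : ℝ) ^ 2)⁻¹ := by ring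
    _ = (2 * M) * (r * r ^ δ * d) * ε * (n : ℝ)⁻¹ := by rw [hsn2]
    _ ≤ B * (r * r * d) * ε * (n : ℝ)⁻¹ := by gcongr
    _ = _ := by ring

/-- The characteristic function and the Gaussian factor share the expansion `1 - Q/2`, so the mixed
difference is a difference of increments of the two remainders. The Gaussian remainder is even of
order `n^(-2)`, weakened by `n^(-1) ≤ n^(-δ/2)`. -/
theorem norm_mixed_sub_le (h : IsCenteredPair P V W δ) {n : ℕ} (hn : 1 ≤ n)
    (hQ0 : ∀ s t, 0 ≤ momentForm P V W s t)
    {s t s₀ t₀ d r : ℝ} (hd : 0 ≤ d) (hsd : (s - s₀) ^ 2 + (t - t₀) ^ 2 ≤ d ^ 2)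
    (hr : 1 ≤ r) (hsr : s ^ 2 + t ^ 2 ≤ r ^ 2) (hsr₀ : s₀ ^ 2 + t₀ ^ 2 ≤ r ^ 2) :
    ‖weightedCharFun P V W 0 (s / √n) (t / √n) - weightedCharFun P V W 0 (s₀ / √n) (t₀ / √n) -
      ((Real.exp (-(momentForm P V W (s / √n) (t / √n) / 2)) : ℝ) -
        (Real.exp (-(momentForm P V W (s₀ / √n) (t₀ / √n) / 2)) : ℝ))‖ ≤
      momentBound P V W δ * (1 + momentBound P V W δ) * (r ^ 3 * d) * (n : ℝ) ^ (-δ / 2) *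
        (n : ℝ)⁻¹ := by
  have k1 := h.norm_taylor_remainder_sub_le hn hd hsd hr hsr hsr₀
  have hB0 : 0 ≤ momentBound P V W δ := momentBound_nonneg
  have hε : 0 ≤ (n : ℝ) ^ (-δ / 2) := Real.rpow_nonneg (Nat.cast_nonneg n) _
  have hrδ := h.rpow_le_self hr
  have hnε := h.inv_le_natCast_rpow hn
  have hr0 : 0 ≤ r := by linarith
  have hn0 : (0 : ℝ) < n := by exact_mod_cast hn
  have hsn2 : √(n : ℝ) ^ 2 = n := Real.sq_sqrt hn0.le
  set B := momentBound P V W δ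
  set ε := (n : ℝ) ^ (-δ / 2)
  have hr23 : r ^ 2 ≤ r ^ 3 := by nlinarith [sq_nonneg r]
  have hz : ∀ {s t : ℝ}, s ^ 2 + t ^ 2 ≤ r ^ 2 →
      momentForm P V W (s / √n) (t / √n) / 2 ≤ B * r ^ 2 * (n : ℝ)⁻¹ := by
    intro s t hsr
    have := momentForm_le (P := P) (V := V) (W := W) (δ := δ) hr0 hsr
    rw [momentForm_smul, hsn2]
    calc _ ≤ 2 * B * r ^ 2 / n / 2 := by gcongr
      _ = _ := by field_simp
  have k2 : ‖(((Real.exp (-(momentForm P V W (s / √n) (t / √n) / 2)) - 1 +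
        momentForm P V W (s / √n) (t / √n) / 2 : ℝ) : ℂ)) -
      ((Real.exp (-(momentForm P V W (s₀ / √n) (t₀ / √n) / 2)) - 1 +
        momentForm P V W (s₀ / √n) (t₀ / √n) / 2 : ℝ) : ℂ)‖ ≤
      B ^ 2 * (r ^ 3 * d) * ε * (n : ℝ)⁻¹ := by
    rw [← Complex.ofReal_sub, Complex.norm_real, Real.norm_eq_abs]
    refine (abs_exp_neg_sub_one_add_sub_le (by linarith [hQ0 (s / √n) (t / √n)])
      (by linarith [hQ0 (s₀ / √n) (t₀ / √n)]) (hz hsr) (hz hsr₀)).trans ?_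
    calc _ ≤ B * r ^ 2 * ε * (B * (r * d) * (n : ℝ)⁻¹) := by
          gcongr
          exact abs_momentForm_div_sqrt_sub_le hn hd hsd hr0 hsr hsr₀
      _ = _ := by ring
  have := (norm_sub_le _ _).trans (add_le_add k1 k2)
  refine le_trans (le_of_eq ?_) (this.trans ?_)
  · congr 1
    push_cast
    ring
  · calc _ ≤ B * (r ^ 3 * d) * ε * (n : ℝ)⁻¹ + B ^ 2 * (r ^ 3 * d) * ε * (n : ℝ)⁻¹ := by gcongr
      _ = _ := by ring

/-- Raising to the power `N` must not lose the Gaussian decay, so the one-step estimates, which are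
absolute, are made relative to `θ = exp(-c m² / n)` before `GridBound.pow` is applied. -/
theorem gridBound_zero_pow (h : IsCenteredPair P V W δ) {n N : ℕ} (hn : 1 ≤ n) (hNn : N ≤ n)
    (hnN : n ≤ N + 2) {c K : ℝ} (hc : 0 ≤ c)
    (hQ : ∀ s t, 2 * c * (s ^ 2 + t ^ 2) ≤ momentForm P V W s t)
    {s t s₀ t₀ d r m : ℝ} (hd : 0 ≤ d) (hd1 : d ≤ 1) (hsd : (s - s₀) ^ 2 + (t - t₀) ^ 2 ≤ d ^ 2)
    (hr : 1 ≤ r) (hsr : s ^ 2 + t ^ 2 ≤ r ^ 2) (hsr₀ : s₀ ^ 2 + t₀ ^ 2 ≤ r ^ 2)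
    (hm : m ^ 2 ≤ s ^ 2 + t ^ 2) (hm₀ : m ^ 2 ≤ s₀ ^ 2 + t₀ ^ 2) (hK : m ^ 2 ≤ K * n)
    (hdec : ‖weightedCharFun P V W 0 (s / √n) (t / √n)‖ ≤
      Real.exp (-(c * ((s / √n) ^ 2 + (t / √n) ^ 2))))
    (hdec₀ : ‖weightedCharFun P V W 0 (s₀ / √n) (t₀ / √n)‖ ≤
      Real.exp (-(c * ((s₀ / √n) ^ 2 + (t₀ / √n) ^ 2)))) :
    GridBound (((1 + momentBound P V W δ) ^ 2 * r ^ 4 * Real.exp (c * K) + 1) ^ 2 *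
        Real.exp (2 * c * K) * Real.exp (-(c * m ^ 2)))
      ((n : ℝ) ^ (-δ / 2)) (d ^ δ)
      (weightedCharFun P V W 0 (s / √n) (t / √n) ^ N)
      (weightedCharFun P V W 0 (s₀ / √n) (t₀ / √n) ^ N)
      ((Real.exp (-(momentForm P V W (s / √n) (t / √n) / 2)) : ℝ) ^ N)
      ((Real.exp (-(momentForm P V W (s₀ / √n) (t₀ / √n) / 2)) : ℝ) ^ N) := by
  have hB0 : 0 ≤ momentBound P V W δ := momentBound_nonneg
  have hBB : ∀ b : ℝ, 0 ≤ b → b ≤ (1 + b) ^ 2 ∧ b * (1 + b) ≤ (1 + b) ^ 2 ∧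
      b * (1 + b) + b ≤ (1 + b) ^ 2 := fun b hb => by
    have : (1 + b) ^ 2 = 1 + 2 * b + b ^ 2 := by ring
    have : b * (1 + b) = b + b ^ 2 := by ring
    have : 0 ≤ b ^ 2 := sq_nonneg b
    refine ⟨?_, ?_, ?_⟩ <;> linarith only [hb, this, ‹(1 + b) ^ 2 = _›, ‹b * (1 + b) = _›]
  obtain ⟨hB1, hB2, hB3⟩ := hBB _ hB0
  have hr14 : r ≤ r ^ 4 := le_self_pow₀ hr (by norm_num)
  have hr34 : r ^ 3 ≤ r ^ 4 := pow_le_pow_right₀ hr (by norm_num)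
  have hε : 0 ≤ (n : ℝ) ^ (-δ / 2) := Real.rpow_nonneg (Nat.cast_nonneg n) _
  have hσ : 0 ≤ d ^ δ := Real.rpow_nonneg hd _
  have hdσ := h.self_le_rpow hd hd1
  have hrδ := h.rpow_le_self hr
  have hnε := h.inv_le_natCast_rpow hn
  have hε1 := h.natCast_rpow_le_one hn
  have hr0 : 0 ≤ r := by linarith
  have hn0 : (0 : ℝ) < n := by exact_mod_cast hn
  have hsn : 0 < √(n : ℝ) := Real.sqrt_pos.2 hn0
  have hsn2 : √(n : ℝ) ^ 2 = n := Real.sq_sqrt hn0.le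
  have hQ0 := fun s t => momentForm_nonneg_of_le hc hQ s t
  set B := momentBound P V W δ
  set ε := (n : ℝ) ^ (-δ / 2)
  set θ := Real.exp (-(c * m ^ 2 / n)) with hθ
  have hθ0 : 0 < θ := Real.exp_pos _
  have hw0 : weightedCharFun P V W 0 0 0 = 1 := by simp [weightedCharFun]
  -- Since `m² ≤ K n`, one factor `θ` is bounded below by `exp(-cK)`, so inserting it costs only a
  -- constant.
  have hθK : 1 ≤ Real.exp (c * K) * θ := by
    rw [hθ, ← Real.exp_add]
    refine Real.one_le_exp ?_
    have : c * m ^ 2 / n ≤ c * K := by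
      rw [div_le_iff₀ hn0, mul_assoc]; gcongr
    linarith
  set L := (1 + B) ^ 2 * r ^ 4 * Real.exp (c * K) with hL
  have hL0 : 0 ≤ L := by positivity
  have habs : ∀ {x y : ℝ}, 0 ≤ y → x ≤ (1 + B) ^ 2 * r ^ 4 * y * (n : ℝ)⁻¹ →
      x ≤ L * (n : ℝ)⁻¹ * y * θ := by
    intro x y hy hx
    refine hx.trans ?_
    calc (1 + B) ^ 2 * r ^ 4 * y * (n : ℝ)⁻¹ =
        (1 + B) ^ 2 * r ^ 4 * y * (n : ℝ)⁻¹ * 1 := (mul_one _).symm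
      _ ≤ (1 + B) ^ 2 * r ^ 4 * y * (n : ℝ)⁻¹ * (Real.exp (c * K) * θ) := by gcongr
      _ = _ := by rw [hL]; ring
  have hmθ : ∀ {s t : ℝ}, m ^ 2 ≤ s ^ 2 + t ^ 2 →
      Real.exp (-(c * ((s / √n) ^ 2 + (t / √n) ^ 2))) ≤ θ := by
    intro s t hm
    refine Real.exp_le_exp.2 (neg_le_neg ?_)
    rw [div_pow, div_pow, hsn2, ← add_div, mul_div_assoc]
    gcongr
  have hvθ : ∀ {s t : ℝ}, m ^ 2 ≤ s ^ 2 + t ^ 2 →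
      ‖((Real.exp (-(momentForm P V W (s / √n) (t / √n) / 2)) : ℝ) : ℂ)‖ ≤ θ := by
    intro s t hm
    rw [Complex.norm_real, Real.norm_of_nonneg (Real.exp_pos _).le]
    refine le_trans (Real.exp_le_exp.2 (neg_le_neg ?_)) (hmθ hm)
    linarith [hQ (s / √n) (t / √n)]
  have huv : ∀ {s t : ℝ}, s ^ 2 + t ^ 2 ≤ r ^ 2 →
      ‖weightedCharFun P V W 0 (s / √n) (t / √n) -
        (Real.exp (-(momentForm P V W (s / √n) (t / √n) / 2)) : ℝ)‖ ≤
        L * (n : ℝ)⁻¹ * ε * θ := by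
    intro s t hsr
    have := h.norm_mixed_sub_le hn hQ0 (s := s) (t := t) (s₀ := 0) (t₀ := 0) hr0 (by simpa using hsr) hr hsr
      (by simpa using sq_nonneg r)
    simp only [zero_div, hw0, momentForm_zero, neg_zero, Real.exp_zero, Complex.ofReal_one] at this
    refine habs hε ?_
    rw [sub_sub_sub_cancel_right] at this
    refine this.trans ?_
    calc _ = B * (1 + B) * r ^ 4 * ε * (n : ℝ)⁻¹ := by ring
      _ ≤ _ := by gcongr
  have hdv : ‖((Real.exp (-(momentForm P V W (s / √n) (t / √n) / 2)) : ℝ) : ℂ) -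
      (Real.exp (-(momentForm P V W (s₀ / √n) (t₀ / √n) / 2)) : ℝ)‖ ≤
      B * (r * d) * (n : ℝ)⁻¹ := by
    rw [← Complex.ofReal_sub, Complex.norm_real, Real.norm_eq_abs]
    exact (abs_exp_neg_sub_le (by linarith [hQ0 (s / √n) (t / √n)])
      (by linarith [hQ0 (s₀ / √n) (t₀ / √n)])).trans 
        (abs_momentForm_div_sqrt_sub_le hn hd hsd hr0 hsr hsr₀)
  have hdd := h.norm_mixed_sub_le hn hQ0 hd hsd hr hsr hsr₀
  refine (GridBound.pow (a := L * (n : ℝ)⁻¹) hε hσ (by positivity) hθ0.le (hdec.trans (hmθ hm))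
    (hdec₀.trans (hmθ hm₀)) (hvθ hm) (hvθ hm₀) ?_ (habs hσ (hdv.trans ?_)) (huv hsr) (huv hsr₀)
    ?_ N).mono hε hσ ?_
  · have := norm_add_le _ _ |>.trans (add_le_add hdd hdv)
    rw [sub_add_cancel] at this
    refine habs hσ (this.trans ?_)
    calc _ ≤ B * (1 + B) * (r ^ 4 * d ^ δ) * 1 * (n : ℝ)⁻¹ + B * (r ^ 4 * d ^ δ) * (n : ℝ)⁻¹ := by
          gcongr
      _ = (B * (1 + B) + B) * (r ^ 4 * d ^ δ * (n : ℝ)⁻¹) := by ring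
      _ ≤ (1 + B) ^ 2 * (r ^ 4 * d ^ δ * (n : ℝ)⁻¹) := by
          gcongr
      _ = _ := by ring
  · calc _ ≤ (1 + B) ^ 2 * (r ^ 4 * d ^ δ) * (n : ℝ)⁻¹ := by gcongr
      _ = _ := by ring
  · have := habs (mul_nonneg hε hσ) (x := B * (1 + B) * (r ^ 3 * d) * ε * (n : ℝ)⁻¹) ?_
    · refine hdd.trans (this.trans (le_of_eq ?_))
      ring
    · calc _ ≤ (1 + B) ^ 2 * (r ^ 4 * d ^ δ) * ε * (n : ℝ)⁻¹ := by gcongr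
        _ = _ := by ring
  · have hN1 : (N : ℝ) * (L * (n : ℝ)⁻¹) ≤ L := by
      have : (N : ℝ) * (n : ℝ)⁻¹ ≤ 1 := by
        rw [← div_eq_mul_inv, div_le_one hn0]; exact_mod_cast hNn
      calc _ = (N * (n : ℝ)⁻¹) * L := by ring
        _ ≤ 1 * L := by gcongr
        _ = L := one_mul L
    -- Up to two factors are missing from the full power `n`; each costs at most `exp(cK)`.
    have hθN : θ ^ N ≤ Real.exp (2 * c * K) * Real.exp (-(c * m ^ 2)) := by
      rw [hθ, ← Real.exp_nat_mul, ← Real.exp_add]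
      refine Real.exp_le_exp.2 ?_
      have hN2 : (n : ℝ) ≤ N + 2 := by exact_mod_cast hnN
      have e : (N : ℝ) * -(c * m ^ 2 / n) = -(c * m ^ 2) + (n - N) * (c * (m ^ 2 / n)) := by
        field_simp; ring
      have : m ^ 2 / n ≤ K := (div_le_iff₀ hn0).2 hK
      have h5 : 0 ≤ c * (m ^ 2 / n) := by positivity
      have h6 : c * (m ^ 2 / n) ≤ c * K := by gcongr
      have h7 : (n - N : ℝ) * (c * (m ^ 2 / n)) ≤ 2 * (c * K) :=
        mul_le_mul (by linarith only [hN2]) h6 h5 zero_le_two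
      rw [e]
      linarith only [h7]
    have : 0 ≤ (N : ℝ) * (L * (n : ℝ)⁻¹) := by positivity
    rw [add_comm L 1, mul_assoc ((1 + L) ^ 2)]
    exact mul_le_mul (by gcongr) hθN (by positivity) (by positivity)

end IsCenteredPair
end

/-! ### Comparison of the sum with its Gaussian limit -/

noncomputable section

variable {Ω : Type*} [MeasurableSpace Ω] {P : Measure Ω} {V W : Ω → ℝ} {δ : ℝ}

namespace IsCenteredPair

variable [IsProbabilityMeasure P]

/-- The exponents `n`, `n - 1`, `n - 2` in `sumCharFun` share the limit `exp(-Q/2)`, the `n`-th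
power of the Gaussian factor. The missing `j ≤ 2` factors are compared with `1` and multiplied in.
-/
theorem exists_gridBound_pow_limit (h : IsCenteredPair P V W δ) {c K : ℝ} (hc : 0 ≤ c)
    (hQ : ∀ s t, 2 * c * (s ^ 2 + t ^ 2) ≤ momentForm P V W s t) :
    ∃ C : ℝ, 0 < C ∧ ∀ (n N : ℕ), 1 ≤ n → N ≤ n → n ≤ N + 2 → ∀ (s t s₀ t₀ d r m : ℝ), 0 ≤ d →
    d ≤ 1 → (s - s₀) ^ 2 + (t - t₀) ^ 2 ≤ d ^ 2 → 1 ≤ r → s ^ 2 + t ^ 2 ≤ r ^ 2 →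
    s₀ ^ 2 + t₀ ^ 2 ≤ r ^ 2 → m ^ 2 ≤ s ^ 2 + t ^ 2 → m ^ 2 ≤ s₀ ^ 2 + t₀ ^ 2 → m ^ 2 ≤ K * n →
    ‖weightedCharFun P V W 0 (s / √n) (t / √n)‖ ≤
      Real.exp (-(c * ((s / √n) ^ 2 + (t / √n) ^ 2))) →
    ‖weightedCharFun P V W 0 (s₀ / √n) (t₀ / √n)‖ ≤
      Real.exp (-(c * ((s₀ / √n) ^ 2 + (t₀ / √n) ^ 2))) →
    GridBound (C * r ^ 12 * Real.exp (-(c * m ^ 2))) ((n : ℝ) ^ (-δ / 2)) (d ^ δ)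
      (weightedCharFun P V W 0 (s / √n) (t / √n) ^ N)
      (weightedCharFun P V W 0 (s₀ / √n) (t₀ / √n) ^ N)
      (Real.exp (-(momentForm P V W s t / 2)) : ℝ)
      (Real.exp (-(momentForm P V W s₀ t₀ / 2)) : ℝ) := by
  set B := momentBound P V W δ with hB
  have hB0 : 0 ≤ B := momentBound_nonneg
  set E := Real.exp (c * K)
  have hE : 0 < E := Real.exp_pos _
  refine ⟨((1 + B) ^ 2 * E + 1) ^ 2 * Real.exp (2 * c * K) * (4 * (4 * (1 + B) * (1 + B))),
    by positivity, ?_⟩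
  intro n N hn hNn hnN s t s₀ t₀ d r m hd hd1 hsd hr hsr hsr₀ hm hm₀ hK hdec hdec₀
  have hε : 0 ≤ (n : ℝ) ^ (-δ / 2) := Real.rpow_nonneg (Nat.cast_nonneg n) _
  have hσ : 0 ≤ d ^ δ := Real.rpow_nonneg hd _
  have hn0 : (0 : ℝ) < n := by exact_mod_cast hn
  have g := h.gridBound_zero_pow hn hNn hnN hc hQ hd hd1 hsd hr hsr hsr₀ hm hm₀ hK hdec hdec₀
  have g1 := gridBound_one_cexp h hn hc hQ hd hd1 hsd hr hsr hsr₀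
  have hr2 : 1 ≤ r ^ 2 := one_le_pow₀ hr
  have hr4 : 1 ≤ r ^ 4 := one_le_pow₀ hr
  obtain ⟨j, hj⟩ : ∃ j, n = N + j := ⟨n - N, by omega⟩
  have hj2 : j ≤ 2 := by omega
  have gj : GridBound (4 * ((1 + B) * r ^ 2) * ((1 + B) * r ^ 2)) ((n : ℝ) ^ (-δ / 2)) (d ^ δ)
      1 1 ((Real.exp (-(momentForm P V W (s / √n) (t / √n) / 2)) : ℝ) ^ j)
      ((Real.exp (-(momentForm P V W (s₀ / √n) (t₀ / √n) / 2)) : ℝ) ^ j) := by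
    have hA : 1 ≤ (1 + B) * r ^ 2 := one_le_mul_of_one_le_of_one_le (by linarith) hr2
    have hA2 : 1 * ((1 + B) * r ^ 2) ≤ 4 * ((1 + B) * r ^ 2) * ((1 + B) * r ^ 2) :=
      mul_le_mul_of_nonneg_right (by linarith) (by linarith)
    rw [one_mul] at hA2
    interval_cases j
    · simp only [pow_zero]
      refine GridBound.const hε hσ ?_ ?_ ?_
      · simpa using hA.trans hA2
      · simpa using hA.trans hA2
      · rw [sub_self, norm_zero]; positivity
    · simp only [pow_one]
      exact g1.mono hε hσ hA2
    · have := g1.mul hε hσ g1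
      simpa only [mul_one, ← sq, one_pow] using this
  have hexp : ∀ s t : ℝ, ((Real.exp (-(momentForm P V W (s / √n) (t / √n) / 2)) : ℝ) : ℂ) ^ N *
      ((Real.exp (-(momentForm P V W (s / √n) (t / √n) / 2)) : ℝ) : ℂ) ^ j =
      (Real.exp (-(momentForm P V W s t / 2)) : ℝ) := by
    intro s t
    rw [← pow_add, ← hj, ← Complex.ofReal_pow, ← Real.exp_nat_mul, momentForm_smul,
      Real.sq_sqrt hn0.le]
    congr 2
    field_simp
  have := (g.mul hε hσ gj)
  rw [hexp, hexp, mul_one, mul_one] at this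
  refine this.mono hε hσ ?_
  have hle : ((1 + B) ^ 2 * r ^ 4 * E + 1) ^ 2 ≤ (((1 + B) ^ 2 * E + 1) * r ^ 4) ^ 2 := by
    refine pow_le_pow_left₀ (by positivity) ?_ 2
    calc _ ≤ (1 + B) ^ 2 * r ^ 4 * E + r ^ 4 := by gcongr
      _ = _ := by ring
  calc _ ≤ 4 * ((((1 + B) ^ 2 * E + 1) * r ^ 4) ^ 2 * Real.exp (2 * c * K) *
        Real.exp (-(c * m ^ 2))) * (4 * ((1 + B) * r ^ 2) * ((1 + B) * r ^ 2)) := by gcongr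
    _ = _ := by ring

/-- Each summand of `sumCharFun` is a product of quantities already compared with their limits. The
power `r^16` is `r^12` from the powers times `r^4` from the squared linear term. -/
theorem exists_gridBound_sumCharFun (h : IsCenteredPair P V W δ) {c K : ℝ} (hc : 0 ≤ c)
    (hQ : ∀ s t, 2 * c * (s ^ 2 + t ^ 2) ≤ momentForm P V W s t) :
    ∃ C : ℝ, 0 < C ∧ ∀ (n : ℕ), 1 ≤ n → ∀ (s t s₀ t₀ d r m : ℝ), 0 ≤ d →
    d ≤ 1 → (s - s₀) ^ 2 + (t - t₀) ^ 2 ≤ d ^ 2 → 1 ≤ r → s ^ 2 + t ^ 2 ≤ r ^ 2 →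
    s₀ ^ 2 + t₀ ^ 2 ≤ r ^ 2 → m ^ 2 ≤ s ^ 2 + t ^ 2 → m ^ 2 ≤ s₀ ^ 2 + t₀ ^ 2 → m ^ 2 ≤ K * n →
    ‖weightedCharFun P V W 0 (s / √n) (t / √n)‖ ≤
      Real.exp (-(c * ((s / √n) ^ 2 + (t / √n) ^ 2))) →
    ‖weightedCharFun P V W 0 (s₀ / √n) (t₀ / √n)‖ ≤
      Real.exp (-(c * ((s₀ / √n) ^ 2 + (t₀ / √n) ^ 2))) →
    GridBound (C * r ^ 16 * Real.exp (-(c * m ^ 2))) ((n : ℝ) ^ (-δ / 2)) (d ^ δ)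
      (sumCharFun P V W n s t) (sumCharFun P V W n s₀ t₀)
      (limitCharFun P V W s t) (limitCharFun P V W s₀ t₀) := by
  obtain ⟨C, hC, hpow⟩ := h.exists_gridBound_pow_limit (K := K) hc hQ
  set B := momentBound P V W δ with hB
  have hB0 : 0 ≤ B := momentBound_nonneg
  refine ⟨C + 4 * (4 * 1 * C) * (4 * (2 * B) * (2 * B)) + 4 * C * (2 * B), by positivity, ?_⟩
  intro n hn s t s₀ t₀ d r m hd hd1 hsd hr hsr hsr₀ hm hm₀ hK hdec hdec₀
  have hε : 0 ≤ (n : ℝ) ^ (-δ / 2) := Real.rpow_nonneg (Nat.cast_nonneg n) _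
  have hσ : 0 ≤ d ^ δ := Real.rpow_nonneg hd _
  have hn0 : (0 : ℝ) < n := by exact_mod_cast hn
  have hn1 : (1 : ℝ) ≤ n := by exact_mod_cast hn
  have g := fun N hNn hnN =>
    hpow n N hn hNn hnN s t s₀ t₀ d r m hd hd1 hsd hr hsr hsr₀ hm hm₀ hK hdec hdec₀
  have g1 := h.gridBound_one hn hd hd1 hsd hr hsr hsr₀
  have g2 := h.gridBound_two hn hd hsd hr hsr hsr₀
  have hnε := h.inv_le_natCast_rpow hn
  -- The coefficient differs from its limit `1` by `1 / n ≤ n^(-δ/2)`. For `n = 1` it is zero, and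
  -- the truncated exponent `n - 2 = 0` is harmless.
  have gc : GridBound 1 ((n : ℝ) ^ (-δ / 2)) (d ^ δ) (((n - 1) / n : ℝ) : ℂ) (((n - 1) / n : ℝ) : ℂ)
      1 1 := by
    have e : ((n : ℝ) - 1) / n = 1 - (n : ℝ)⁻¹ := by field_simp
    have h0 : 0 ≤ (n : ℝ)⁻¹ := by positivity
    have h1 : (n : ℝ)⁻¹ ≤ 1 := inv_le_one_of_one_le₀ hn1
    refine GridBound.const hε hσ ?_ (by simp) ?_
    · rw [Complex.norm_real, e, Real.norm_of_nonneg (by linarith)]; linarith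
    · rw [← Complex.ofReal_one, ← Complex.ofReal_sub, Complex.norm_real, e, sub_sub_cancel_left,
        norm_neg, Real.norm_of_nonneg h0, one_mul]
      exact hnε
  have main := ((g n le_rfl (by omega)).add
    ((gc.mul hε hσ (g (n - 2) (by omega) (by omega))).mul hε hσ (g1.mul hε hσ g1))).add
    ((g (n - 1) (by omega) (by omega)).mul hε hσ g2)
  have e : ∀ s t, limitCharFun P V W s t = (Real.exp (-(momentForm P V W s t / 2)) : ℝ) +
      1 * (Real.exp (-(momentForm P V W s t / 2)) : ℝ) *
        (momentLin P V W s t * Complex.I * (momentLin P V W s t * Complex.I)) +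
      (Real.exp (-(momentForm P V W s t / 2)) : ℝ) * (∫ ω, W ω ^ 2 ∂P : ℝ) := by
    intro s t
    unfold limitCharFun
    ring
  rw [e, e]
  unfold sumCharFun
  rw [sq ((√n : ℂ) * weightedCharFun P V W 1 (s / √n) (t / √n)),
    sq ((√n : ℂ) * weightedCharFun P V W 1 (s₀ / √n) (t₀ / √n))]
  refine main.mono hε hσ ?_
  have hE := Real.exp_pos (-(c * m ^ 2))
  have p1 : r ^ 12 ≤ r ^ 16 := pow_le_pow_right₀ hr (by norm_num)
  have p2 : r ^ 13 ≤ r ^ 16 := pow_le_pow_right₀ hr (by norm_num)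
  calc _ = (C * r ^ 12 + 4 * (4 * 1 * C) * (4 * (2 * B) * (2 * B)) * r ^ 16 +
        4 * C * (2 * B) * r ^ 13) * Real.exp (-(c * m ^ 2)) := by ring
    _ ≤ (C * r ^ 16 + 4 * (4 * 1 * C) * (4 * (2 * B) * (2 * B)) * r ^ 16 +
        4 * C * (2 * B) * r ^ 16) * Real.exp (-(c * m ^ 2)) := by gcongr
    _ = _ := by ring

end IsCenteredPair
end

/-! ### Decay of the one-step characteristic function -/

noncomputable section

variable {Ω : Type*} [MeasurableSpace Ω] {P : Measure Ω} {V W : Ω → ℝ} {δ : ℝ}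

namespace IsCenteredPair

variable [IsProbabilityMeasure P]

/-- Modulus `1` would make `exp(itW)` almost surely constant, placing `W` on a lattice of step `2π /
|t| ≥ 2`, larger than the span. -/
theorem norm_weightedCharFun_zero_lt_one (h : IsCenteredPair P V W δ)
    (hspan : IsLatticeWithSpan P W 1) {t : ℝ} (ht0 : t ≠ 0) (ht : |t| ≤ Real.pi) :
    ‖weightedCharFun P V W 0 0 t‖ < 1 := by
  by_contra! hcon
  set z := weightedCharFun P V W 0 0 t with hz
  have hzi : z = ∫ ω, Complex.exp ((t * W ω : ℝ) * Complex.I) ∂P := by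
    simp [hz, weightedCharFun]
  have hint : Integrable (fun ω => Complex.exp ((t * W ω : ℝ) * Complex.I)) P := by
    simpa using h.integrable_pow_mul_cexp zero_le_two 0 t
  have hz1 : ‖z‖ = 1 := by
    refine le_antisymm ?_ hcon
    rw [hzi]
    refine (norm_integral_le_integral_norm _).trans ?_
    simp_rw [Complex.norm_exp_ofReal_mul_I]
    simp
  set θ := z.arg
  have hzθ : z = Complex.exp (θ * Complex.I) := by
    have := Complex.norm_mul_exp_arg_mul_I z
    rw [hz1] at this
    simpa using this.symm
  have hcosint : Integrable (fun ω => Real.cos (t * W ω - θ)) P := by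
    refine Integrable.of_bound (C := 1) ?_ (ae_of_all _ fun ω => Real.abs_cos_le_one _)
    exact (Real.continuous_cos.measurable.comp_aemeasurable
      ((h.aemeasurable_snd.const_mul t).sub_const θ)).aestronglyMeasurable
  have hcos : ∫ ω, Real.cos (t * W ω - θ) ∂P = 1 := by
    have e : ∀ ω, Real.cos (t * W ω - θ) =
        RCLike.re (Complex.exp (-(θ * Complex.I)) *
          Complex.exp ((t * W ω : ℝ) * Complex.I)) := by
      intro ω
      rw [← Complex.exp_add, ← Complex.exp_ofReal_mul_I_re (t * W ω - θ)]
      change _ = Complex.re _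
      congr 2
      push_cast
      ring
    simp_rw [e]
    rw [integral_re (hint.const_mul _), integral_const_mul, ← hzi, hzθ, ← Complex.exp_add]
    simp
  -- A nonnegative function with integral zero vanishes almost surely, which pins the phase `tW`
  -- modulo `2π`.
  have hzero : ∫ ω, (1 - Real.cos (t * W ω - θ)) ∂P = 0 := by
    rw [integral_sub (integrable_const _) hcosint, hcos]
    simp
  rw [integral_eq_zero_iff_of_nonneg (fun ω => sub_nonneg.2 (Real.cos_le_one _))
    ((integrable_const _).sub hcosint)] at hzero
  have hh : 1 < |2 * Real.pi / t| := by
    rw [abs_div, lt_div_iff₀ (abs_pos.2 ht0), abs_of_pos Real.two_pi_pos]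
    linarith [Real.pi_pos]
  refine hspan.2.2 _ hh (θ / t) ?_
  filter_upwards [hzero] with ω hω
  have hω1 : Real.cos (t * W ω - θ) = 1 := by
    simp only [Pi.zero_apply] at hω
    linarith
  obtain ⟨k, hk⟩ := (Real.cos_eq_one_iff _).1 hω1
  have hW : W ω = θ / t + 2 * Real.pi / t * k := by
    field_simp
    linarith
  rcases abs_choice (2 * Real.pi / t) with h1 | h1
  · exact ⟨k, by rw [h1, hW]⟩
  · exact ⟨-k, by rw [h1, hW]; push_cast; ring⟩

theorem norm_weightedCharFun_zero_sub_le_fst (h : IsCenteredPair P V W δ) (s t : ℝ) :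
    ‖weightedCharFun P V W 0 s t - weightedCharFun P V W 0 0 t‖ ≤
      2 * |s| * ∫ ω, |V ω| ∂P := by
  unfold weightedCharFun
  have hV := h.memLp_fst.integrable one_le_two
  rw [← integral_sub (h.integrable_pow_mul_cexp zero_le_two s t)
    (h.integrable_pow_mul_cexp zero_le_two 0 t), ← integral_const_mul]
  refine norm_integral_le_of_norm_le (hV.abs.const_mul _) (ae_of_all _ fun ω => ?_)
  have := norm_cexp_sub_cexp_le_rpow (δ := 1) ⟨zero_le_one, le_rfl⟩ (s * V ω + t * W ω)
    (0 * V ω + t * W ω)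
  rw [Real.rpow_one, add_sub_add_right_eq_sub, zero_mul, sub_zero, abs_mul] at this
  simp only [pow_zero, Complex.ofReal_one, one_mul, zero_mul]
  linarith

/-- The quadratic part removes at least `l/2 · r²` from `1`, and on a small disc the Taylor
remainder gives back at most half of that. The disc is also so small that `1 - Q/2 ≥ 0`. -/
theorem exists_norm_weightedCharFun_zero_le_near (h : IsCenteredPair P V W δ) {l : ℝ} (hl : 0 < l)
    (hQ : ∀ s t, l * (s ^ 2 + t ^ 2) ≤ momentForm P V W s t) :
    ∃ r₀ : ℝ, 0 < r₀ ∧ ∀ s t, s ^ 2 + t ^ 2 ≤ r₀ ^ 2 →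
      ‖weightedCharFun P V W 0 s t‖ ≤ Real.exp (-(l / 4 * (s ^ 2 + t ^ 2))) := by
  have h3 : 0 ≤ ∫ ω, Real.sqrt (V ω ^ 2 + W ω ^ 2) ^ (2 + δ) ∂P := integral_sqrt_rpow_nonneg
  set M := ∫ ω, Real.sqrt (V ω ^ 2 + W ω ^ 2) ^ (2 + δ) ∂P with hM
  set B := momentBound P V W δ
  have hc1 : Filter.Tendsto (fun r : ℝ => B * r ^ 2) (nhds 0) (nhds 0) := by
    have : Continuous fun r : ℝ => B * r ^ 2 := by fun_prop
    simpa using this.tendsto 0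
  have hc2 : Filter.Tendsto (fun r : ℝ => 2 * r ^ δ * M) (nhds 0) (nhds 0) := by
    have := ((Real.continuousAt_rpow_const 0 δ (Or.inr h.pos.le)).tendsto.const_mul 2).mul_const M
    simpa [Real.zero_rpow h.pos.ne'] using this
  have hev := (hc1.eventually (eventually_le_nhds one_pos)).and
    (hc2.eventually (eventually_le_nhds (show 0 < l / 4 by positivity)))
  obtain ⟨e, he, hball⟩ := Metric.eventually_nhds_iff.1 hev
  refine ⟨e / 2, by positivity, fun s t hst => ?_⟩
  set r := Real.sqrt (s ^ 2 + t ^ 2) with hr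
  have hr0 : 0 ≤ r := Real.sqrt_nonneg _
  have hr2 : s ^ 2 + t ^ 2 = r ^ 2 := (Real.sq_sqrt (by positivity)).symm
  have hre : r ≤ e / 2 := by
    rw [hr2] at hst
    exact le_of_sq_le_sq hst (by positivity)
  obtain ⟨hb1, hb2⟩ := hball (y := r) (by
    rw [dist_zero_right, Real.norm_of_nonneg hr0]; linarith)
  have key := h.norm_weightedCharFun_zero_sub_le (s := s) (t := t) (s₀ := 0) (t₀ := 0) hr0
    (by simpa using hr2.le) hr0 hr2.le (by simpa using sq_nonneg r)
  change ‖(_ + ((momentForm P V W s t / 2 : ℝ) : ℂ)) -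
    (_ + ((momentForm P V W 0 0 / 2 : ℝ) : ℂ))‖ ≤ _ at key
  have hw0 : weightedCharFun P V W 0 0 0 = 1 := by simp [weightedCharFun]
  rw [hw0, momentForm_zero, zero_div, Complex.ofReal_zero, add_zero, ← hM] at key
  have hQle := momentForm_le (P := P) (V := V) (W := W) (δ := δ) hr0 hr2.le
  have hQge := hQ s t
  have e1 : weightedCharFun P V W 0 s t = (weightedCharFun P V W 0 s t +
    ((momentForm P V W s t / 2 : ℝ) : ℂ) - 1) + ((1 - momentForm P V W s t / 2 : ℝ) : ℂ) := by
    push_cast; ring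
  rw [e1]
  refine (norm_add_le _ _).trans ((add_le_add_left key _).trans ?_)
  change _ ≤ 2 * B * r ^ 2 at hQle
  rw [Complex.norm_real, Real.norm_of_nonneg (by linarith), hr2]
  rw [hr2] at hQge
  have h5 := Real.add_one_le_exp (-(l / 4 * r ^ 2))
  have h6 : 2 * (r * r ^ δ) * r * M = 2 * r ^ δ * M * r ^ 2 := by ring
  have h7 : 2 * r ^ δ * M * r ^ 2 ≤ l / 4 * r ^ 2 := by gcongr
  rw [h6]
  linarith

/-- Near the origin the Taylor bound applies. On the compact set `r₁ ≤ |t| ≤ π` of the axis `s = 0`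
the modulus has a maximum below `1`, and Lipschitz dependence on `s` extends the gap to a thin
strip. Nothing similar can be expected for large `s`, where the law of `V` is unrestricted. -/
theorem exists_norm_weightedCharFun_zero_le (h : IsCenteredPair P V W δ)
    (hspan : IsLatticeWithSpan P W 1) {l : ℝ} (hl : 0 < l)
    (hQ : ∀ s t, l * (s ^ 2 + t ^ 2) ≤ momentForm P V W s t) :
    ∃ c c₀ : ℝ, 0 < c ∧ 2 * c ≤ l ∧ 0 < c₀ ∧ ∀ s t, |s| ≤ c₀ → |t| ≤ Real.pi →
      ‖weightedCharFun P V W 0 s t‖ ≤ Real.exp (-(c * (s ^ 2 + t ^ 2))) := by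
  obtain ⟨r₀, hr₀, hnear⟩ := h.exists_norm_weightedCharFun_zero_le_near hl hQ
  set r₁ := min (r₀ / 2) Real.pi with hr₁
  have hr₁0 : 0 < r₁ := lt_min (by positivity) Real.pi_pos
  set S : Set ℝ := {t | r₁ ≤ |t|} ∩ Set.Icc (-Real.pi) Real.pi with hS
  have hScomp : IsCompact S :=
    isCompact_Icc.inter_left (isClosed_le continuous_const continuous_abs)
  have hSne : S.Nonempty := by
    refine ⟨Real.pi, ?_, by linarith [Real.pi_pos], le_rfl⟩
    change r₁ ≤ |Real.pi|
    rw [abs_of_pos Real.pi_pos]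
    exact min_le_right _ _
  have hcont : Continuous fun t => weightedCharFun P V W 0 0 t := by
    unfold weightedCharFun
    refine continuous_of_dominated (bound := fun _ => 1)
      (fun t => (h.integrable_pow_mul_cexp zero_le_two 0 t).aestronglyMeasurable)
      (fun t => ae_of_all _ fun ω => ?_) (integrable_const _) (ae_of_all _ fun ω => ?_)
    · rw [norm_mul, Complex.norm_exp_ofReal_mul_I]
      simp
    · fun_prop
  obtain ⟨t₁, ht₁, hmax⟩ := hScomp.exists_isMaxOn hSne hcont.norm.continuousOn
  have ht₁0 : t₁ ≠ 0 := by
    rintro rfl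
    have : r₁ ≤ |(0 : ℝ)| := ht₁.1
    rw [abs_zero] at this
    linarith
  have hlt := h.norm_weightedCharFun_zero_lt_one hspan ht₁0 (abs_le.2 ht₁.2)
  set η := 1 - ‖weightedCharFun P V W 0 0 t₁‖ with hη
  have hη0 : 0 < η := by linarith
  set A := ∫ ω, |V ω| ∂P
  have hA : 0 ≤ A := integral_nonneg fun _ => abs_nonneg _
  -- The second bound lets a move of length `c₀` in `s` use up at most half of the gap `η`; the
  -- first keeps small `t` inside the disc of radius `r₀`.
  set c₀ := min (r₀ / 2) (η / (4 * A + 1)) with hc₀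
  have hc₀0 : 0 < c₀ := lt_min (by positivity) (by positivity)
  set D := c₀ ^ 2 + Real.pi ^ 2 with hD
  have hD0 : 0 < D := by positivity
  refine ⟨min (l / 4) (η / (2 * D)), c₀, lt_min (by positivity) (by positivity), ?_, hc₀0, ?_⟩
  · linarith [min_le_left (l / 4) (η / (2 * D))]
  intro s t hs ht
  have hs2 : s ^ 2 ≤ c₀ ^ 2 := sq_le_sq' (abs_le.1 hs).1 (abs_le.1 hs).2
  have ht2 : t ^ 2 ≤ Real.pi ^ 2 := sq_le_sq' (abs_le.1 ht).1 (abs_le.1 ht).2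
  have hst : 0 ≤ s ^ 2 + t ^ 2 := by positivity
  rcases lt_or_ge |t| r₁ with htr | htr
  · refine (hnear s t ?_).trans (Real.exp_le_exp.2 (neg_le_neg ?_))
    · have h1 : c₀ ≤ r₀ / 2 := min_le_left _ _
      have h2 : c₀ ^ 2 ≤ (r₀ / 2) ^ 2 := pow_le_pow_left₀ hc₀0.le h1 2
      have h3 : |t| ≤ r₀ / 2 := htr.le.trans (min_le_left _ _)
      have h4 : t ^ 2 ≤ (r₀ / 2) ^ 2 := sq_le_sq' (abs_le.1 h3).1 (abs_le.1 h3).2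
      nlinarith
    · exact mul_le_mul_of_nonneg_right (min_le_left _ _) hst
  · have h1 : ‖weightedCharFun P V W 0 0 t‖ ≤ 1 - η := by
      have : ‖weightedCharFun P V W 0 0 t‖ ≤ ‖weightedCharFun P V W 0 0 t₁‖ :=
        hmax ⟨htr, abs_le.1 ht⟩
      linarith
    have h2 := h.norm_weightedCharFun_zero_sub_le_fst s t
    have h3 : 2 * |s| * A ≤ η / 2 := by
      have h4 : |s| ≤ η / (4 * A + 1) := hs.trans (min_le_right _ _)
      rw [le_div_iff₀ (by positivity)] at h4
      nlinarith [abs_nonneg s]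
    have h5 : ‖weightedCharFun P V W 0 s t‖ ≤ 1 - η / 2 := by
      have := norm_add_le (weightedCharFun P V W 0 s t - weightedCharFun P V W 0 0 t)
        (weightedCharFun P V W 0 0 t)
      rw [sub_add_cancel] at this
      linarith
    have h6 : min (l / 4) (η / (2 * D)) * (s ^ 2 + t ^ 2) ≤ η / 2 := by
      calc _ ≤ η / (2 * D) * D := by
            refine mul_le_mul (min_le_right _ _) (by linarith) hst (by positivity)
        _ = η / 2 := by field_simp
    have h7 := Real.add_one_le_exp (-(min (l / 4) (η / (2 * D)) * (s ^ 2 + t ^ 2)))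
    linarith

end IsCenteredPair
end

/-! ### Integrable bounds for the transforms -/

noncomputable section

variable {Ω : Type*} [MeasurableSpace Ω] {P : Measure Ω} {V W : Ω → ℝ} {δ : ℝ}

/-- Half of the Gaussian decay absorbs the polynomial factor: `(2 + m)² ≤ 8 + 2m²`, and an eighth
power is at most a constant times an exponential. -/
theorem exists_pow_mul_exp_neg_le {c : ℝ} (hc : 0 < c) : ∃ C : ℝ, 0 < C ∧ ∀ m : ℝ, 0 ≤ m →
    (2 + m) ^ 16 * Real.exp (-(c * m ^ 2)) ≤ C * Real.exp (-(c / 2 * m ^ 2)) := by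
  set a := c / 4 with ha
  have ha0 : 0 < a := by positivity
  refine ⟨(Nat.factorial 8 : ℝ) / a ^ 8 * Real.exp (a * 8), by positivity, fun m hm => ?_⟩
  have h1 := Real.pow_div_factorial_le_exp (a * (8 + 2 * m ^ 2)) (by positivity) 8
  have h2 : (2 + m) ^ 16 ≤ (8 + 2 * m ^ 2) ^ 8 := by
    rw [show (2 + m) ^ 16 = ((2 + m) ^ 2) ^ 8 by ring]
    exact pow_le_pow_left₀ (sq_nonneg _) (by nlinarith [sq_nonneg (m - 2)]) 8
  have h3 : (8 + 2 * m ^ 2) ^ 8 ≤ (Nat.factorial 8 : ℝ) / a ^ 8 *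
      Real.exp (a * (8 + 2 * m ^ 2)) := by
    rw [mul_pow, div_le_iff₀ (by positivity)] at h1
    rw [div_mul_eq_mul_div, le_div_iff₀ (by positivity)]
    linarith
  calc _ ≤ (Nat.factorial 8 : ℝ) / a ^ 8 * Real.exp (a * (8 + 2 * m ^ 2)) *
        Real.exp (-(c * m ^ 2)) := by gcongr; exact h2.trans h3
    _ = _ := by
      rw [mul_assoc, mul_assoc, ← Real.exp_add, ← Real.exp_add]
      congr 2
      rw [ha]; ring

/-- The Fourier transform `sumCharFun` cut off outside one period in the lattice direction. -/
def sumCharFunTrunc (P : Measure Ω) (V W : Ω → ℝ) (n : ℕ) (s t : ℝ) : ℂ :=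
  (Set.Ioc (-(Real.pi * √n)) (Real.pi * √n)).indicator (fun t => sumCharFun P V W n s t) t

namespace IsCenteredPair

variable [IsProbabilityMeasure P]

/-- The general comparison is used twice: with coinciding points, where `m = |(s, t)|` gives decay
in both variables, and between `(s, t)` and `(0, t)`, where only `m = |t|` is available but the
increment gains `|s|^δ`. -/
theorem exists_gridBound_exp (h : IsCenteredPair P V W δ)
    (hspan : IsLatticeWithSpan P W 1) {l : ℝ} (hl : 0 < l)
    (hQ : ∀ s t, l * (s ^ 2 + t ^ 2) ≤ momentForm P V W s t) :
    ∃ C c c₀ : ℝ, 0 < C ∧ 0 < c ∧ 0 < c₀ ∧ ∀ n : ℕ, 1 ≤ n → ∀ s t, |s| ≤ c₀ * √n →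
      |t| ≤ Real.pi * √n →
      GridBound (C * Real.exp (-(c * (s ^ 2 + t ^ 2)))) ((n : ℝ) ^ (-δ / 2)) 0
        (sumCharFun P V W n s t) (sumCharFun P V W n s t)
        (limitCharFun P V W s t) (limitCharFun P V W s t) ∧
      (|s| ≤ 1 → GridBound (C * Real.exp (-(c * t ^ 2))) ((n : ℝ) ^ (-δ / 2)) (|s| ^ δ)
        (sumCharFun P V W n s t) (sumCharFun P V W n 0 t)
        (limitCharFun P V W s t) (limitCharFun P V W 0 t)) := by
  obtain ⟨c, c₀, hc, hcl, hc₀, hdec⟩ := h.exists_norm_weightedCharFun_zero_le hspan hl hQ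
  obtain ⟨C, hC, hgrid⟩ := h.exists_gridBound_sumCharFun (K := c₀ ^ 2 + Real.pi ^ 2) hc.le
    (fun s t => (mul_le_mul_of_nonneg_right hcl (by positivity)).trans (hQ s t))
  obtain ⟨C', hC', habs⟩ := exists_pow_mul_exp_neg_le hc
  refine ⟨C * C', c / 2, c₀, by positivity, by positivity, hc₀, ?_⟩
  intro n hn s t hs ht
  have hε : 0 ≤ (n : ℝ) ^ (-δ / 2) := Real.rpow_nonneg (Nat.cast_nonneg n) _
  have hn0 : (0 : ℝ) < n := by exact_mod_cast hn
  have hsn : 0 < √(n : ℝ) := Real.sqrt_pos.2 hn0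
  have hsn2 : √(n : ℝ) ^ 2 = n := Real.sq_sqrt hn0.le
  have hs' : |s / √n| ≤ c₀ := by
    rwa [abs_div, abs_of_pos hsn, div_le_iff₀ hsn]
  have ht' : |t / √n| ≤ Real.pi := by
    rwa [abs_div, abs_of_pos hsn, div_le_iff₀ hsn]
  have hs2 : s ^ 2 ≤ c₀ ^ 2 * n := by
    have := sq_le_sq' (abs_le.1 hs).1 (abs_le.1 hs).2
    rwa [mul_pow, hsn2] at this
  have ht2 : t ^ 2 ≤ Real.pi ^ 2 * n := by
    have := sq_le_sq' (abs_le.1 ht).1 (abs_le.1 ht).2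
    rwa [mul_pow, hsn2] at this
  have hcn : 0 ≤ c₀ ^ 2 * n := by positivity
  have hfin : ∀ m r : ℝ, 0 ≤ m → 0 ≤ r → r ≤ 2 + m →
      C * r ^ 16 * Real.exp (-(c * m ^ 2)) ≤ C * C' * Real.exp (-(c / 2 * m ^ 2)) := by
    intro m r hm hr hrm
    calc _ ≤ C * (2 + m) ^ 16 * Real.exp (-(c * m ^ 2)) := by gcongr
      _ = C * ((2 + m) ^ 16 * Real.exp (-(c * m ^ 2))) := by ring
      _ ≤ C * (C' * Real.exp (-(c / 2 * m ^ 2))) := mul_le_mul_of_nonneg_left (habs m hm) hC.le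
      _ = _ := by ring
  refine ⟨?_, fun hs1 => ?_⟩
  · set m := √(s ^ 2 + t ^ 2) with hm
    have hm0 : 0 ≤ m := Real.sqrt_nonneg _
    have hm2 : m ^ 2 = s ^ 2 + t ^ 2 := Real.sq_sqrt (by positivity)
    have g := hgrid n hn s t s t 0 (1 + m) m le_rfl zero_le_one (by simp) (by linarith)
      (by nlinarith) (by nlinarith) hm2.le hm2.le (by rw [hm2]; linarith) (hdec _ _ hs' ht')
      (hdec _ _ hs' ht')
    rw [Real.zero_rpow h.pos.ne'] at g
    rw [← hm2]
    exact g.mono hε le_rfl (hfin m _ hm0 (by linarith) (by linarith))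
  · have hss : s ^ 2 ≤ 1 := by
      have := sq_le_sq' (abs_le.1 hs1).1 (abs_le.1 hs1).2
      rwa [one_pow] at this
    have htt : |t| ^ 2 = t ^ 2 := sq_abs t
    have ht0 := abs_nonneg t
    have g := hgrid n hn s t 0 t |s| (2 + |t|) |t| (abs_nonneg _) hs1 (by simp) (by linarith)
      (by nlinarith) (by nlinarith) (by nlinarith) (by nlinarith) (by linarith)
      (hdec _ _ hs' ht') (hdec _ _ (by simpa using hc₀.le) ht')
    rw [← htt]
    exact g.mono hε (Real.rpow_nonneg (abs_nonneg _) _) (hfin |t| _ ht0 (by linarith) le_rfl)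

theorem exists_norm_sumCharFunTrunc_sub_le (h : IsCenteredPair P V W δ)
    (hspan : IsLatticeWithSpan P W 1) {l : ℝ} (hl : 0 < l)
    (hQ : ∀ s t, l * (s ^ 2 + t ^ 2) ≤ momentForm P V W s t) :
    ∃ C c c₀ : ℝ, 0 < C ∧ 0 < c ∧ 0 < c₀ ∧
      (∀ s t, ‖limitCharFun P V W s t‖ ≤ C * Real.exp (-(c * (s ^ 2 + t ^ 2)))) ∧
      ∀ n : ℕ, 1 ≤ n → ∀ s t, |s| ≤ c₀ * √n →
      ‖sumCharFunTrunc P V W n s t - limitCharFun P V W s t‖ ≤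
        C * (n : ℝ) ^ (-δ / 2) * Real.exp (-(c * (s ^ 2 + t ^ 2))) ∧
      (|s| ≤ 1 → ‖sumCharFunTrunc P V W n s t - limitCharFun P V W s t -
          (sumCharFunTrunc P V W n 0 t - limitCharFun P V W 0 t)‖ ≤
        C * (n : ℝ) ^ (-δ / 2) * |s| ^ δ * Real.exp (-(c * t ^ 2))) := by
  obtain ⟨C, c, c₀, hC, hc, hc₀, hgrid⟩ := h.exists_gridBound_exp hspan hl hQ
  -- The limit does not depend on `n`, so its bounds at any point can be read off from an `n` large
  -- enough for that point to be admissible.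
  have hex : ∀ s t : ℝ, ∃ n : ℕ, 1 ≤ n ∧ |s| ≤ c₀ * √n ∧ |t| ≤ Real.pi * √n := by
    intro s t
    have hlim : Filter.Tendsto (fun n : ℕ => √(n : ℝ)) Filter.atTop Filter.atTop :=
      Real.tendsto_sqrt_atTop.comp tendsto_natCast_atTop_atTop
    obtain ⟨n, h1, h2, h3⟩ := ((Filter.eventually_ge_atTop 1).and
      (((hlim.const_mul_atTop hc₀).eventually_ge_atTop |s|).and
        ((hlim.const_mul_atTop Real.pi_pos).eventually_ge_atTop |t|))).exists
    exact ⟨n, h1, h2, h3⟩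
  have hlim1 : ∀ s t, ‖limitCharFun P V W s t‖ ≤ C * Real.exp (-(c * (s ^ 2 + t ^ 2))) := by
    intro s t
    obtain ⟨n, hn, hs, ht⟩ := hex s t
    exact (hgrid n hn s t hs ht).1.nv
  have hlim2 : ∀ s t, |s| ≤ 1 → ‖limitCharFun P V W s t - limitCharFun P V W 0 t‖ ≤
      C * Real.exp (-(c * t ^ 2)) * |s| ^ δ := by
    intro s t hs1
    obtain ⟨n, hn, hs, ht⟩ := hex s t
    exact ((hgrid n hn s t hs ht).2 hs1).dv
  -- The extra term pays for the truncated region, where `exp(-x) ≤ 1/x` at `x = c π² n / 2` is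
  -- used.
  set D := 1 + 2 / (c * Real.pi ^ 2) with hD
  have hD1 : 1 ≤ D := by
    have : 0 ≤ 2 / (c * Real.pi ^ 2) := by positivity
    linarith
  have hCD : C ≤ C * D := le_mul_of_one_le_right hC.le hD1
  have hexp : ∀ x : ℝ, 0 ≤ x → Real.exp (-(c * x)) ≤ Real.exp (-(c / 2 * x)) := fun x hx =>
    Real.exp_le_exp.2 (neg_le_neg (by nlinarith))
  refine ⟨C * D, c / 2, c₀, by positivity, by positivity, hc₀, fun s t => (hlim1 s t).trans ?_, ?_⟩
  · exact mul_le_mul hCD (hexp _ (by positivity)) (Real.exp_pos _).le (by positivity)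
  intro n hn s t hs
  have hε : 0 ≤ (n : ℝ) ^ (-δ / 2) := Real.rpow_nonneg (Nat.cast_nonneg n) _
  have hn0 : (0 : ℝ) < n := by exact_mod_cast hn
  have hsn2 : √(n : ℝ) ^ 2 = n := Real.sq_sqrt hn0.le
  have hσ : 0 ≤ |s| ^ δ := Real.rpow_nonneg (abs_nonneg _) _
  by_cases htr : t ∈ Set.Ioc (-(Real.pi * √n)) (Real.pi * √n)
  · have ht : |t| ≤ Real.pi * √n := abs_le.2 ⟨htr.1.le, htr.2⟩
    obtain ⟨g1, g2⟩ := hgrid n hn s t hs ht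
    simp only [sumCharFunTrunc, Set.indicator_of_mem htr]
    refine ⟨g1.uv.trans ?_, fun hs1 => ?_⟩
    · calc _ = C * (n : ℝ) ^ (-δ / 2) * Real.exp (-(c * (s ^ 2 + t ^ 2))) := by ring
        _ ≤ _ := by
          gcongr
          linarith
    · have := (g2 hs1).dd
      rw [sub_sub_sub_comm]
      refine this.trans ?_
      calc _ = C * (n : ℝ) ^ (-δ / 2) * |s| ^ δ * Real.exp (-(c * t ^ 2)) := by ring
        _ ≤ _ := by
          gcongr
          linarith
  · have ht2 : Real.pi ^ 2 * n ≤ t ^ 2 := by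
      have h1 : Real.pi * √n ≤ |t| := by
        by_contra! hlt
        exact htr ⟨(abs_lt.1 hlt).1, (abs_lt.1 hlt).2.le⟩
      have := pow_le_pow_left₀ (by positivity) h1 2
      rwa [mul_pow, hsn2, sq_abs] at this
    -- Outside the period only the limit remains; half of its decay in `t` is traded for `1 / n ≤
    -- n^(-δ/2)`.
    have htail : Real.exp (-(c / 2 * t ^ 2)) ≤ D * (n : ℝ) ^ (-δ / 2) := by
      have hy : 0 < c / 2 * (Real.pi ^ 2 * n) := by positivity
      calc Real.exp (-(c / 2 * t ^ 2)) ≤ Real.exp (-(c / 2 * (Real.pi ^ 2 * n))) :=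
            Real.exp_le_exp.2 (neg_le_neg (by gcongr))
        _ ≤ (c / 2 * (Real.pi ^ 2 * n))⁻¹ := by
            rw [Real.exp_neg]
            exact inv_anti₀ hy (by linarith [Real.add_one_le_exp (c / 2 * (Real.pi ^ 2 * n))])
        _ = 2 / (c * Real.pi ^ 2) * (n : ℝ)⁻¹ := by field_simp
        _ ≤ D * (n : ℝ) ^ (-δ / 2) := by
            refine mul_le_mul (by linarith) (h.inv_le_natCast_rpow hn) (by positivity)
              (by linarith)
    have hsplit : ∀ x : ℝ, 0 ≤ x → Real.exp (-(c * (x + t ^ 2))) ≤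
        D * (n : ℝ) ^ (-δ / 2) * Real.exp (-(c / 2 * (x + t ^ 2))) := by
      intro x hx
      have e : -(c * (x + t ^ 2)) = -(c / 2 * t ^ 2) + -(c / 2 * (x + t ^ 2) + c / 2 * x) := by ring
      rw [e, Real.exp_add]
      refine mul_le_mul htail (Real.exp_le_exp.2 (neg_le_neg ?_)) (Real.exp_pos _).le
        (by positivity)
      have : 0 ≤ c / 2 * x := by positivity
      linarith
    simp only [sumCharFunTrunc, Set.indicator_of_notMem htr, zero_sub]
    refine ⟨?_, fun hs1 => ?_⟩
    · rw [norm_neg]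
      refine (hlim1 s t).trans ?_
      have := mul_le_mul_of_nonneg_left (hsplit (s ^ 2) (sq_nonneg _)) hC.le
      refine this.trans (le_of_eq (by ring))
    · rw [neg_sub_neg, norm_sub_rev]
      refine (hlim2 s t hs1).trans ?_
      have h0 := hsplit 0 le_rfl
      rw [zero_add] at h0
      calc _ ≤ C * (D * (n : ℝ) ^ (-δ / 2) * Real.exp (-(c / 2 * t ^ 2))) * |s| ^ δ := by gcongr
        _ = _ := by ring

end IsCenteredPair
end

/-! ### Weighted transforms of sums of independent copies -/

noncomputable section

section
variable {Ω : Type*} [MeasurableSpace Ω] {P : Measure Ω} {V W : Ω → ℝ}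

theorem aestronglyMeasurable_cexp_of_aemeasurable (hV : AEMeasurable V P) (hW : AEMeasurable W P)
    (s t : ℝ) : AEStronglyMeasurable
      (fun ω => Complex.exp ((s * V ω + t * W ω : ℝ) * Complex.I)) P := by
  have : Measurable fun x : ℝ => Complex.exp (x * Complex.I) := by fun_prop
  exact (this.comp_aemeasurable ((hV.const_mul s).add (hW.const_mul t))).aestronglyMeasurable

theorem integrable_pow_mul_cexp_of_integrable (hV : AEMeasurable V P) (hW : AEMeasurable W P)
    {k : ℕ} (hk : Integrable (fun ω => W ω ^ k) P) (s t : ℝ) : Integrable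
      (fun ω => ((W ω ^ k : ℝ) : ℂ) * Complex.exp ((s * V ω + t * W ω : ℝ) * Complex.I)) P :=
  hk.ofReal.mul_bdd (c := 1) (aestronglyMeasurable_cexp_of_aemeasurable hV hW s t)
    (ae_of_all _ fun _ => (Complex.norm_exp_ofReal_mul_I _).le)

theorem hasDerivAt_weightedCharFun (hV : AEMeasurable V P) (hW : AEMeasurable W P) {k : ℕ}
    (hk : Integrable (fun ω => W ω ^ k) P) (hk1 : Integrable (fun ω => W ω ^ (k + 1)) P)
    (s t : ℝ) :
    HasDerivAt (fun t => weightedCharFun P V W k s t)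
      (Complex.I * weightedCharFun P V W (k + 1) s t) t := by
  have e : Complex.I * weightedCharFun P V W (k + 1) s t =
      ∫ ω, Complex.I * (((W ω ^ (k + 1) : ℝ) : ℂ) *
        Complex.exp ((s * V ω + t * W ω : ℝ) * Complex.I)) ∂P := by
    rw [integral_const_mul]; rfl
  rw [e]
  refine (hasDerivAt_integral_of_dominated_loc_of_deriv_le (Metric.ball_mem_nhds t one_pos)
    (bound := fun ω => |W ω ^ (k + 1)|)
    (F' := fun t ω => Complex.I * (((W ω ^ (k + 1) : ℝ) : ℂ) *
        Complex.exp ((s * V ω + t * W ω : ℝ) * Complex.I)))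
    (Filter.Eventually.of_forall fun t =>
      (integrable_pow_mul_cexp_of_integrable hV hW hk s t).aestronglyMeasurable)
    (integrable_pow_mul_cexp_of_integrable hV hW hk s t)
    ((integrable_pow_mul_cexp_of_integrable hV hW hk1 s t).const_mul _).aestronglyMeasurable
    (ae_of_all _ fun ω t _ => ?_) hk1.abs (ae_of_all _ fun ω t _ => ?_)).2
  · rw [norm_mul, Complex.norm_I, norm_mul, Complex.norm_exp_ofReal_mul_I, Complex.norm_real]
    simp
  · have h1 : HasDerivAt (fun t : ℝ => s * V ω + t * W ω) (W ω) t := by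
      simpa using ((hasDerivAt_id t).mul_const (W ω)).const_add (s * V ω)
    have h2 := ((h1.ofReal_comp.mul_const Complex.I).cexp).const_mul ((W ω ^ k : ℝ) : ℂ)
    refine h2.congr_deriv ?_
    push_cast
    ring
end

section Sum

variable {Ω : Type*} [MeasurableSpace Ω] {P : Measure Ω} {V W : Ω → ℝ}
  {δ : ℝ} {Ω' : Type*} [MeasurableSpace Ω'] {P' : Measure Ω'}
  {V' W' : ℕ → Ω' → ℝ}

theorem weightedCharFun_zero_sum
    (hind : iIndepFun (fun i ω => (V' i ω, W' i ω)) P')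
    (hid : ∀ i, IdentDistrib (fun ω => (V' i ω, W' i ω)) (fun ω => (V ω, W ω)) P' P)
    (n : ℕ) (s t : ℝ) :
    weightedCharFun P' (fun ω => ∑ i ∈ Finset.range n, V' i ω)
      (fun ω => ∑ i ∈ Finset.range n, W' i ω) 0 s t = weightedCharFun P V W 0 s t ^ n := by
  have hg : Measurable fun z : ℝ × ℝ => Complex.exp ((s * z.1 + t * z.2 : ℝ) * Complex.I) := by
    fun_prop
  have hfin := (hind.precomp (g := fun i : Fin n => (i : ℕ)) Fin.val_injective)
  have key := hfin.integral_fun_prod_comp (𝕜 := ℂ)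
    (f := fun _ z => Complex.exp ((s * z.1 + t * z.2 : ℝ) * Complex.I))
    (fun i => (hid i).aemeasurable_fst) (fun i => hg.aestronglyMeasurable)
  have e1 : ∀ i : Fin n, ∫ ω, Complex.exp ((s * V' i ω + t * W' i ω : ℝ) * Complex.I) ∂P' =
      weightedCharFun P V W 0 s t := by
    intro i
    have := ((hid i).comp hg).integral_eq
    simp only [Function.comp_def] at this
    rw [this]
    simp [weightedCharFun]
  simp only [e1, Finset.prod_const, Finset.card_univ, Fintype.card_fin] at key
  rw [← key]
  unfold weightedCharFun
  refine integral_congr_ae (ae_of_all _ fun ω => ?_)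
  simp only [pow_zero, Complex.ofReal_one, one_mul]
  rw [← Complex.exp_sum, Finset.sum_range, Finset.sum_range, Finset.mul_sum, Finset.mul_sum,
    ← Finset.sum_add_distrib]
  congr 1
  push_cast
  rw [Finset.sum_mul]

theorem aemeasurable_sum_fst
    (hid : ∀ i, IdentDistrib (fun ω => (V' i ω, W' i ω)) (fun ω => (V ω, W ω)) P' P) (n : ℕ) :
    AEMeasurable (fun ω => ∑ i ∈ Finset.range n, V' i ω) P' :=
  Finset.aemeasurable_fun_sum _ fun i _ => (hid i).aemeasurable_fst.fst

theorem aemeasurable_sum_snd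
    (hid : ∀ i, IdentDistrib (fun ω => (V' i ω, W' i ω)) (fun ω => (V ω, W ω)) P' P) (n : ℕ) :
    AEMeasurable (fun ω => ∑ i ∈ Finset.range n, W' i ω) P' :=
  Finset.aemeasurable_fun_sum _ fun i _ => (hid i).aemeasurable_fst.snd

theorem memLp_sum_snd [IsProbabilityMeasure P] (h : IsCenteredPair P V W δ)
    (hid : ∀ i, IdentDistrib (fun ω => (V' i ω, W' i ω)) (fun ω => (V ω, W ω)) P' P) (n : ℕ) :
    MemLp (fun ω => ∑ i ∈ Finset.range n, W' i ω) 2 P' :=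
  memLp_finsetSum _ fun i _ =>
    ((hid i).comp measurable_snd).memLp_iff.2 h.memLp_snd

/-- Weights come from differentiation in `t`: the unweighted transform of the sum is an `n`-th
power, and differentiating both sides twice, with uniqueness of derivatives, gives the formula
without expanding the square of the sum. -/
theorem weightedCharFun_two_sum [IsProbabilityMeasure P] [IsProbabilityMeasure P']
    (h : IsCenteredPair P V W δ)
    (hind : iIndepFun (fun i ω => (V' i ω, W' i ω)) P')
    (hid : ∀ i, IdentDistrib (fun ω => (V' i ω, W' i ω)) (fun ω => (V ω, W ω)) P' P)
    (n : ℕ) (s t : ℝ) :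
    weightedCharFun P' (fun ω => ∑ i ∈ Finset.range n, V' i ω)
      (fun ω => ∑ i ∈ Finset.range n, W' i ω) 2 s t =
    n * (n - 1 : ℕ) * weightedCharFun P V W 0 s t ^ (n - 2) * weightedCharFun P V W 1 s t ^ 2 +
      n * weightedCharFun P V W 0 s t ^ (n - 1) * weightedCharFun P V W 2 s t := by
  have hX := aemeasurable_sum_fst hid n
  have hY := aemeasurable_sum_snd hid n
  have hY2 := memLp_sum_snd h hid n
  set X := fun ω => ∑ i ∈ Finset.range n, V' i ω
  set Y := fun ω => ∑ i ∈ Finset.range n, W' i ω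
  have hp : ∀ {Q : Measure Ω'} [IsProbabilityMeasure Q] {Z : Ω' → ℝ}, MemLp Z 2 Q →
      Integrable (fun ω => Z ω ^ 0) Q ∧ Integrable (fun ω => Z ω ^ 1) Q ∧
        Integrable (fun ω => Z ω ^ 2) Q := fun hZ =>
    ⟨by simp, by simpa using hZ.integrable one_le_two, hZ.integrable_sq⟩
  obtain ⟨i0, i1, i2⟩ := hp hY2
  have j0 : Integrable (fun ω => W ω ^ 0) P := by simp
  have j1 : Integrable (fun ω => W ω ^ 1) P := by simpa using h.memLp_snd.integrable one_le_two
  have j2 : Integrable (fun ω => W ω ^ 2) P := h.memLp_snd.integrable_sq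
  have dV0 := hasDerivAt_weightedCharFun h.aemeasurable_fst h.aemeasurable_snd j0 j1
  have dV1 := hasDerivAt_weightedCharFun h.aemeasurable_fst h.aemeasurable_snd j1 j2
  have first : ∀ t, weightedCharFun P' X Y 1 s t =
      n * weightedCharFun P V W 0 s t ^ (n - 1) * weightedCharFun P V W 1 s t := by
    intro t
    have d1 := hasDerivAt_weightedCharFun hX hY i0 i1 s t
    have d2 := (dV0 s t).pow n
    have e : (fun t => weightedCharFun P' X Y 0 s t) =
        (fun t => weightedCharFun P V W 0 s t) ^ n := by
      ext t; exact weightedCharFun_zero_sum hind hid n s t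
    rw [e] at d1
    have := d1.unique d2
    have hI : Complex.I ≠ 0 := Complex.I_ne_zero
    simp only [zero_add] at this
    refine mul_left_cancel₀ hI (this.trans ?_)
    ring
  have d1 := hasDerivAt_weightedCharFun hX hY i1 i2 s t
  have d2 := (((dV0 s t).pow (n - 1)).const_mul (n : ℂ)).mul (dV1 s t)
  have e : (fun t => weightedCharFun P' X Y 1 s t) =
      (fun t => (n : ℂ) * ((fun t => weightedCharFun P V W 0 s t) ^ (n - 1)) t) *
        fun t => weightedCharFun P V W 1 s t := by
    ext t; exact first t
  rw [e] at d1
  have := d1.unique d2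
  refine mul_left_cancel₀ Complex.I_ne_zero (this.trans ?_)
  rw [Nat.sub_sub]
  simp only [Pi.pow_apply, Nat.reduceAdd]
  ring

theorem sumCharFun_eq_integral [IsProbabilityMeasure P] [IsProbabilityMeasure P']
    (h : IsCenteredPair P V W δ)
    (hind : iIndepFun (fun i ω => (V' i ω, W' i ω)) P')
    (hid : ∀ i, IdentDistrib (fun ω => (V' i ω, W' i ω)) (fun ω => (V ω, W ω)) P' P)
    {n : ℕ} (hn : 1 ≤ n) (s t : ℝ) :
    sumCharFun P V W n s t = ∫ ω, ((1 + (∑ i ∈ Finset.range n, W' i ω) ^ 2 / n : ℝ) : ℂ) *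
      Complex.exp ((s / √n * (∑ i ∈ Finset.range n, V' i ω) +
        t / √n * ∑ i ∈ Finset.range n, W' i ω : ℝ) * Complex.I) ∂P' := by
  have hX := aemeasurable_sum_fst hid n
  have hY := aemeasurable_sum_snd hid n
  have hY2 := (memLp_sum_snd h hid n).integrable_sq
  have hn0 : (n : ℂ) ≠ 0 := by exact_mod_cast (by omega : n ≠ 0)
  have k0 := integrable_pow_mul_cexp_of_integrable hX hY (k := 0) (by simp) (s / √n) (t / √n)
  have k2 := integrable_pow_mul_cexp_of_integrable hX hY (k := 2) hY2 (s / √n) (t / √n)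
  have e : ∀ ω, ((1 + (∑ i ∈ Finset.range n, W' i ω) ^ 2 / n : ℝ) : ℂ) *
      Complex.exp ((s / √n * (∑ i ∈ Finset.range n, V' i ω) +
        t / √n * ∑ i ∈ Finset.range n, W' i ω : ℝ) * Complex.I) =
      (((∑ i ∈ Finset.range n, W' i ω) ^ 0 : ℝ) : ℂ) *
        Complex.exp ((s / √n * (∑ i ∈ Finset.range n, V' i ω) +
        t / √n * ∑ i ∈ Finset.range n, W' i ω : ℝ) * Complex.I) + (n : ℂ)⁻¹ *
      ((((∑ i ∈ Finset.range n, W' i ω) ^ 2 : ℝ) : ℂ) *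
        Complex.exp ((s / √n * (∑ i ∈ Finset.range n, V' i ω) +
        t / √n * ∑ i ∈ Finset.range n, W' i ω : ℝ) * Complex.I)) := by
    intro ω
    push_cast
    ring
  simp_rw [e]
  rw [integral_add k0 (k2.const_mul _), integral_const_mul]
  change _ = weightedCharFun P' _ _ 0 _ _ + (n : ℂ)⁻¹ * weightedCharFun P' _ _ 2 _ _
  rw [weightedCharFun_zero_sum hind hid, weightedCharFun_two_sum h hind hid, sumCharFun]
  have hsn : (√n : ℂ) ^ 2 = n := by
    rw [← Complex.ofReal_pow, Real.sq_sqrt (Nat.cast_nonneg n)]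
    simp
  rw [mul_pow, hsn]
  push_cast [Nat.cast_sub hn]
  field_simp
  exact add_assoc _ _ _

end Sum
end

/-! ### Fourier inversion in the lattice direction -/

noncomputable section

theorem setIntegral_cexp_mul_int_div_sqrt {n : ℕ} (hn : 1 ≤ n) (k : ℤ) :
    ∫ t in Set.Ioc (-(Real.pi * √n)) (Real.pi * √n), Complex.exp ((t * (k / √n) : ℝ) * Complex.I) =
      if k = 0 then ((2 * Real.pi * √n : ℝ) : ℂ) else 0 := by
  have hn0 : (0 : ℝ) < n := by exact_mod_cast hn
  have hsn : 0 < √(n : ℝ) := Real.sqrt_pos.2 hn0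
  have hsn' : (√(n : ℝ) : ℂ) ≠ 0 := by exact_mod_cast hsn.ne'
  have hle : -(Real.pi * √n) ≤ Real.pi * √n := by
    have : 0 ≤ Real.pi * √n := by positivity
    linarith
  rw [← intervalIntegral.integral_of_le hle]
  split_ifs with hk
  · subst hk
    simp only [Int.cast_zero, zero_div, mul_zero, Complex.ofReal_zero, zero_mul, Complex.exp_zero,
      intervalIntegral.integral_const, Complex.real_smul, mul_one]
    push_cast
    ring
  · have hk' : (k : ℂ) ≠ 0 := by exact_mod_cast hk
    have hc : (k / √n * Complex.I : ℂ) ≠ 0 :=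
      mul_ne_zero (div_ne_zero hk' hsn') Complex.I_ne_zero
    have e : ∀ t : ℝ, Complex.exp ((t * (k / √n) : ℝ) * Complex.I) =
        Complex.exp (k / √n * Complex.I * t) := by
      intro t
      push_cast
      ring_nf
    simp_rw [e]
    rw [integral_exp_mul_complex hc]
    have e1 : (k / √n * Complex.I * (Real.pi * √n : ℝ) : ℂ) =
        k / √n * Complex.I * (-(Real.pi * √n) : ℝ) + k * (2 * Real.pi * Complex.I) := by
      push_cast
      field_simp
      ring
    rw [e1, Complex.exp_add, Complex.exp_int_mul_two_pi_mul_I]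
    simp

section Sum

variable {Ω : Type*} [MeasurableSpace Ω] {P : Measure Ω} {V W : Ω → ℝ}
  {δ ρ : ℝ} {Ω' : Type*} [MeasurableSpace Ω'] {P' : Measure Ω'}
  {V' W' : ℕ → Ω' → ℝ}

theorem supportedOnLattice_sum (hρ : SupportedOnLattice P W ρ 1)
    (hid : ∀ i, IdentDistrib (fun ω => (V' i ω, W' i ω)) (fun ω => (V ω, W ω)) P' P) (n : ℕ) :
    SupportedOnLattice P' (fun ω => ∑ i ∈ Finset.range n, W' i ω) (n * ρ) 1 := by
  have hmeas : MeasurableSet {x : ℝ | ∃ k : ℤ, x = ρ + 1 * k} := by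
    refine (Set.Countable.mono ?_ (Set.countable_range fun k : ℤ => ρ + 1 * (k : ℝ))).measurableSet
    rintro x ⟨k, rfl⟩
    exact ⟨k, rfl⟩
  have h1 : ∀ᵐ ω ∂P', ∀ i, ∃ k : ℤ, W' i ω = ρ + 1 * k :=
    ae_all_iff.2 fun i => ((hid i).symm.comp measurable_snd).ae_snd hmeas hρ
  filter_upwards [h1] with ω hω
  choose k hk using hω
  refine ⟨∑ i ∈ Finset.range n, k i, ?_⟩
  simp [hk, Finset.sum_add_distrib]

/-- After Fubini, `Y_n` sits almost surely on `nρ + ℤ`, so the integral over one period of length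
`2π√n` retains only the outcomes with `Y_n = y + nρ`. There the weight `1 + Y_n² / n` is the
constant `1 + y_n²`. -/
theorem integral_sumCharFunTrunc_mul_cexp [IsProbabilityMeasure P] [IsProbabilityMeasure P']
    (h : IsCenteredPair P V W δ) (hρ : SupportedOnLattice P W ρ 1)
    (hind : iIndepFun (fun i ω => (V' i ω, W' i ω)) P')
    (hid : ∀ i, IdentDistrib (fun ω => (V' i ω, W' i ω)) (fun ω => (V ω, W ω)) P' P)
    {n : ℕ} (hn : 1 ≤ n) (s : ℝ) (y : ℤ) :
    ∫ t : ℝ, sumCharFunTrunc P V W n s t *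
        Complex.exp ((-(t * latticePoint ρ n y) : ℝ) * Complex.I) =
      ((2 * Real.pi * √n * (1 + latticePoint ρ n y ^ 2) : ℝ) : ℂ) *
        ∫ ω in {ω | ∑ i ∈ Finset.range n, W' i ω = y + n * ρ},
          Complex.exp ((s / √n * ∑ i ∈ Finset.range n, V' i ω : ℝ) * Complex.I) ∂P' := by
  have hX := aemeasurable_sum_fst hid n
  have hY := aemeasurable_sum_snd hid n
  have hY2 := (memLp_sum_snd h hid n).integrable_sq
  have hlat := supportedOnLattice_sum hρ hid n
  have hn0 : (0 : ℝ) < n := by exact_mod_cast hn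
  have hsn : 0 < √(n : ℝ) := Real.sqrt_pos.2 hn0
  have hsn2 : √(n : ℝ) ^ 2 = n := Real.sq_sqrt hn0.le
  have hrep := fun t => sumCharFun_eq_integral h hind hid hn s t
  set X := fun ω => ∑ i ∈ Finset.range n, V' i ω with hXdef
  set Y := fun ω => ∑ i ∈ Finset.range n, W' i ω with hYdef
  set I := Set.Ioc (-(Real.pi * √n)) (Real.pi * √n) with hI
  set v := latticePoint ρ n y with hv
  let F : ℝ → Ω' → ℂ := fun t ω => ((1 + Y ω ^ 2 / n : ℝ) : ℂ) *
    Complex.exp ((s / √n * X ω + t / √n * Y ω - t * v : ℝ) * Complex.I)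
  have e1 : ∫ t : ℝ, sumCharFunTrunc P V W n s t * Complex.exp ((-(t * v) : ℝ) * Complex.I) =
      ∫ t in I, ∫ ω, F t ω ∂P' := by
    rw [← integral_indicator measurableSet_Ioc]
    congr 1
    ext t
    unfold sumCharFunTrunc
    rw [← hI]
    by_cases ht : t ∈ I
    · rw [Set.indicator_of_mem ht, Set.indicator_of_mem ht, hrep, ← integral_mul_const]
      congr 1
      ext ω
      simp only [F]
      rw [mul_assoc, ← Complex.exp_add, hXdef, hYdef]
      congr 2
      push_cast
      ring
    · rw [Set.indicator_of_notMem ht, Set.indicator_of_notMem ht, zero_mul]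
  have hint : Integrable (Function.uncurry F) ((volume.restrict I).prod P') := by
    have i1 : Integrable (fun ω => ((1 + Y ω ^ 2 / n : ℝ) : ℂ)) P' :=
      ((integrable_const 1).add (hY2.div_const _)).ofReal
    have i2 := i1.comp_snd (volume.restrict I)
    refine i2.mul_bdd (c := 1) ?_ (ae_of_all _ fun _ => (Complex.norm_exp_ofReal_mul_I _).le)
    have hm : Measurable fun x : ℝ => Complex.exp (x * Complex.I) := by fun_prop
    have hX' : AEMeasurable (fun z : ℝ × Ω' => X z.2) ((volume.restrict I).prod P') := hX.comp_snd
    have hY' : AEMeasurable (fun z : ℝ × Ω' => Y z.2) ((volume.restrict I).prod P') := hY.comp_snd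
    have hf : Measurable (fun z : ℝ × Ω' => z.1) := measurable_fst
    exact (hm.comp_aemeasurable (((hX'.const_mul _).add
      ((hf.div_const _).aemeasurable.mul hY')).sub
      (hf.mul_const _).aemeasurable)).aestronglyMeasurable
  have hset : NullMeasurableSet {ω | Y ω = y + n * ρ} P' :=
    hY.nullMeasurable (measurableSet_singleton _)
  rw [e1, integral_integral_swap hint, ← integral_const_mul, ← integral_indicator₀ hset]
  refine integral_congr_ae ?_
  filter_upwards [hlat] with ω hω
  obtain ⟨k, hk⟩ := hω
  change Y ω = _ at hk
  have e2 : ∀ t, F t ω = ((1 + Y ω ^ 2 / n : ℝ) : ℂ) *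
      Complex.exp ((s / √n * X ω : ℝ) * Complex.I) *
        Complex.exp ((t * ((k - y : ℤ) / √n) : ℝ) * Complex.I) := by
    intro t
    simp only [F]
    rw [mul_assoc, ← Complex.exp_add, ← add_mul, ← Complex.ofReal_add]
    congr 5
    rw [hv, latticePoint, hk]
    push_cast
    ring
  simp_rw [e2]
  rw [integral_const_mul, setIntegral_cexp_mul_int_div_sqrt hn]
  by_cases hky : k = y
  · have hmem : ω ∈ {ω | Y ω = y + n * ρ} := by
      change Y ω = _
      rw [hk, hky]; ring
    rw [Set.indicator_of_mem hmem, if_pos (sub_eq_zero.2 hky)]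
    have : Y ω ^ 2 / n = v ^ 2 := by
      rw [hv, latticePoint, div_pow, hsn2]
      congr 2
    rw [this, hXdef]
    push_cast
    ring
  · have hmem : ω ∉ {ω | Y ω = y + n * ρ} := by
      intro hm
      change Y ω = _ at hm
      apply hky
      have : (k : ℝ) = y := by linarith
      exact_mod_cast this
    rw [Set.indicator_of_notMem hmem, if_neg (sub_ne_zero.2 hky), mul_zero]

end Sum
end

/-! ### The Gaussian side -/

noncomputable section

/-- Inverting the Gaussian transform in one variable gives the marginal density at `y` times the
characteristic function of the conditional law, of mean `βy/τ` and variance `(ατ - β²)/τ`. -/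
theorem integral_exp_quadratic_mul_cexp {α β τ : ℝ} (hτ : 0 < τ) (hD : 0 < α * τ - β ^ 2)
    (s y : ℝ) :
    ∫ t : ℝ, (Real.exp (-((s ^ 2 * α + 2 * s * t * β + t ^ 2 * τ) / 2)) : ℂ) *
        Complex.exp ((-(t * y) : ℝ) * Complex.I) =
      ((2 * Real.pi * gaussianPDFReal 0 τ.toNNReal y : ℝ) : ℂ) *
        charFun (gaussianReal (β * y / τ) ((α * τ - β ^ 2) / τ).toNNReal) s := by
  have hτ' : (τ : ℂ) ≠ 0 := by exact_mod_cast hτ.ne'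
  have e : ∀ t : ℝ, (Real.exp (-((s ^ 2 * α + 2 * s * t * β + t ^ 2 * τ) / 2)) : ℂ) *
        Complex.exp ((-(t * y) : ℝ) * Complex.I) =
      Complex.exp (((-(τ / 2) : ℝ) : ℂ) * t ^ 2 + (-(s * β + y * Complex.I)) * t +
        ((-(s ^ 2 * α / 2) : ℝ) : ℂ)) := by
    intro t
    rw [Complex.ofReal_exp, ← Complex.exp_add]
    congr 1
    push_cast
    ring
  simp_rw [e]
  rw [integral_cexp_quadratic (by rw [Complex.ofReal_re]; linarith), charFun_gaussianReal,
    gaussianPDFReal_def, Real.coe_toNNReal _ hτ.le, Real.coe_toNNReal _ (div_pos hD hτ).le]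
  have e1 : ((Real.pi : ℂ) / -((-(τ / 2) : ℝ) : ℂ)) ^ (1 / 2 : ℂ) =
      ((2 * Real.pi * (√(2 * Real.pi * τ))⁻¹ : ℝ) : ℂ) := by
    rw [show (Real.pi : ℂ) / -((-(τ / 2) : ℝ) : ℂ) = ((2 * Real.pi / τ : ℝ) : ℂ) by
      push_cast; field_simp, show (1 / 2 : ℂ) = ((1 / 2 : ℝ) : ℂ) by push_cast; rfl,
      ← Complex.ofReal_cpow (by positivity), ← Real.sqrt_eq_rpow]
    congr 1
    rw [Real.sqrt_eq_iff_mul_self_eq (by positivity) (by positivity)]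
    have : √(2 * Real.pi * τ) * √(2 * Real.pi * τ) = 2 * Real.pi * τ :=
      Real.mul_self_sqrt (by positivity)
    have h2 : 0 < √(2 * Real.pi * τ) := by positivity
    rw [mul_mul_mul_comm, ← mul_inv, this]
    field_simp
  rw [e1]
  push_cast
  rw [← mul_assoc, mul_assoc _ (Complex.exp _) (Complex.exp _), ← Complex.exp_add]
  congr 2
  field_simp
  ring_nf
  rw [Complex.I_sq]
  ring

theorem gaussianDensity_eq_mul {α β τ : ℝ} (hτ : 0 < τ) (hD : 0 < α * τ - β ^ 2) (t y : ℝ) :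
    gaussianDensity !![α, β; β, τ] ![t, y] = gaussianPDFReal 0 τ.toNNReal y *
      gaussianPDFReal (β * y / τ) ((α * τ - β ^ 2) / τ).toNNReal t := by
  have hdet : (!![α, β; β, τ] : Matrix (Fin 2) (Fin 2) ℝ).det = α * τ - β ^ 2 := by
    rw [Matrix.det_fin_two_of]; ring
  unfold gaussianDensity
  rw [Matrix.inv_def, hdet, Matrix.adjugate_fin_two_of, gaussianPDFReal_def, gaussianPDFReal_def,
    Real.coe_toNNReal _ hτ.le, Real.coe_toNNReal _ (div_pos hD hτ).le, Ring.inverse_eq_inv']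
  set D := α * τ - β ^ 2 with hDdef
  rw [mul_mul_mul_comm, ← mul_inv, ← Real.exp_add, ← Real.sqrt_mul (by positivity)]
  congr 2
  · rw [show 2 * Real.pi * τ * (2 * Real.pi * (D / τ)) = (2 * Real.pi) ^ 2 * D by field_simp,
      Real.sqrt_mul (by positivity), Real.sqrt_sq (by positivity)]
  · simp [Matrix.mulVec, dotProduct, Fin.sum_univ_two]
    field_simp
    rw [hDdef]
    ring

theorem semiLocalGaussian_eq_mul {α β τ : ℝ} (hτ : 0 < τ) (hD : 0 < α * τ - β ^ 2) (x y : ℝ) :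
    semiLocalGaussian !![α, β; β, τ] x y = gaussianPDFReal 0 τ.toNNReal y *
      (gaussianReal (β * y / τ) ((α * τ - β ^ 2) / τ).toNNReal).real (Set.Iic x) := by
  unfold semiLocalGaussian
  simp_rw [gaussianDensity_eq_mul hτ hD]
  have hv : ((α * τ - β ^ 2) / τ).toNNReal ≠ 0 := (Real.toNNReal_pos.2 (div_pos hD hτ)).ne'
  rw [integral_const_mul, measureReal_def, gaussianReal_apply_eq_integral _ hv,
    ENNReal.toReal_ofReal (integral_nonneg fun _ => gaussianPDFReal_nonneg _ _ _)]

section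

variable {Ω : Type*} [MeasurableSpace Ω] {P : Measure Ω} {V W : Ω → ℝ}

/-- Two integrations by parts in one: with `l = sβ + tτ`, the derivative of `(l - iy) E u` is
exactly the difference of the two integrands, and it integrates to zero. -/
theorem integral_limitCharFun_mul_cexp (hτ : 0 < ∫ ω, W ω ^ 2 ∂P) {s : ℝ}
    (hint : Integrable (fun t => limitCharFun P V W s t)) (y : ℝ) :
    ∫ t : ℝ, limitCharFun P V W s t * Complex.exp ((-(t * y) : ℝ) * Complex.I) =
      ((1 + y ^ 2 : ℝ) : ℂ) * ∫ t : ℝ, (Real.exp (-(momentForm P V W s t / 2)) : ℂ) *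
        Complex.exp ((-(t * y) : ℝ) * Complex.I) := by
  unfold limitCharFun momentLin momentForm at *
  set α := ∫ ω, V ω ^ 2 ∂P
  set β := ∫ ω, V ω * W ω ∂P
  set τ := ∫ ω, W ω ^ 2 ∂P
  set E : ℝ → ℂ := fun t => (Real.exp (-((s ^ 2 * α + 2 * s * t * β + t ^ 2 * τ) / 2)) : ℂ)
    with hE
  set u : ℝ → ℂ := fun t => Complex.exp ((-(t * y) : ℝ) * Complex.I) with hu
  have hnu : ∀ t, ‖u t‖ ≤ 1 := fun t => (Complex.norm_exp_ofReal_mul_I _).le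
  have hcu : Continuous u := by fun_prop
  have hcE : Continuous E := by fun_prop
  have iE : Integrable E := by
    have := integrable_cexp_quadratic (b := ((τ / 2 : ℝ) : ℂ))
      (by rw [Complex.ofReal_re]; linarith) (-(s * β)) ((-(s ^ 2 * α / 2) : ℝ) : ℂ)
    refine this.congr (ae_of_all _ fun t => ?_)
    simp only [hE]
    rw [Complex.ofReal_exp]
    congr 1
    push_cast
    ring
  have iEu : Integrable (fun t => E t * u t) :=
    iE.mul_bdd hcu.aestronglyMeasurable (ae_of_all _ hnu)
  have iLu := hint.mul_bdd hcu.aestronglyMeasurable (ae_of_all _ hnu)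
  change Integrable (fun t => E t * _) at hint
  change Integrable (fun t => E t * _ * u t) at iLu
  change ∫ t, E t * _ * u t = _ * ∫ t, E t * u t
  set l : ℝ → ℝ := fun t => s * β + t * τ with hl
  have hcl : Continuous l := by fun_prop
  have iG : Integrable (fun t => ((l t : ℂ) - y * Complex.I) * (E t * u t)) := by
    have i1 : Integrable (fun t => (l t : ℂ) * (E t * u t)) := by
      -- Integrability of `l² E` comes for free: it is `(1 + τ) E` minus the limit transform, both
      -- integrable. The bound `|l| ≤ l² + 1` then suffices.
      have i2 := (iE.const_mul (1 + τ : ℂ)).sub hint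
      refine (i2.norm.add iE.norm).mono' (by fun_prop) (ae_of_all _ fun t => ?_)
      simp only [Pi.add_apply, Pi.sub_apply]
      have e : (1 + τ : ℂ) * E t - E t * (1 + (((l t : ℝ) : ℂ) * Complex.I) ^ 2 + (τ : ℝ)) =
          ((l t ^ 2 : ℝ) : ℂ) * E t := by
        rw [mul_pow, Complex.I_sq]
        push_cast
        ring
      rw [e, norm_mul, norm_mul, norm_mul, Complex.norm_real (l t), Complex.norm_real (l t ^ 2),
        Real.norm_eq_abs, Real.norm_eq_abs, abs_of_nonneg (sq_nonneg (l t))]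
      have h1 : |l t| ≤ l t ^ 2 + 1 := by
        rw [← sq_abs]; nlinarith [sq_nonneg (|l t| - 1), abs_nonneg (l t)]
      calc |l t| * (‖E t‖ * ‖u t‖) ≤ (l t ^ 2 + 1) * (‖E t‖ * 1) := by
            gcongr; exact hnu t
        _ = _ := by ring
    have := i1.sub (iEu.const_mul (y * Complex.I))
    refine this.congr (ae_of_all _ fun t => ?_)
    simp only [Pi.sub_apply]
    ring
  have dG : ∀ t, HasDerivAt (fun t => ((l t : ℂ) - y * Complex.I) * (E t * u t))
      (E t * (1 + (((l t : ℝ) : ℂ) * Complex.I) ^ 2 + (τ : ℝ)) * u t -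
        ((1 + y ^ 2 : ℝ) : ℂ) * (E t * u t)) t := by
    intro t
    have d1 : HasDerivAt l τ t := by
      have a := ((hasDerivAt_id t).mul_const τ).const_add (s * β)
      rw [one_mul] at a
      exact a
    have d2 : HasDerivAt E (E t * (-(l t) : ℝ)) t := by
      have : HasDerivAt (fun t : ℝ => -((s ^ 2 * α + 2 * s * t * β + t ^ 2 * τ) / 2)) (-(l t)) t := by
        have a := (((hasDerivAt_id t).const_mul (2 * s)).mul_const β).const_add (s ^ 2 * α)
        have b := ((hasDerivAt_id t).pow 2).mul_const τ
        refine (((a.add b).div_const 2).neg).congr_deriv ?_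
        simp [hl]
        ring
      refine (this.exp.ofReal_comp).congr_deriv ?_
      simp [hE]
    have d3 : HasDerivAt u (u t * (-y * Complex.I)) t := by
      have : HasDerivAt (fun t : ℝ => -(t * y)) (-y) t := by
        have a := ((hasDerivAt_id t).mul_const y).neg
        rw [one_mul] at a
        exact a
      refine ((this.ofReal_comp.mul_const Complex.I).cexp).congr_deriv ?_
      simp [hu]
    refine ((d1.ofReal_comp.sub_const (y * Complex.I)).mul (d2.mul d3)).congr_deriv ?_
    push_cast
    simp only [Pi.mul_apply]
    ring_nf
    rw [Complex.I_sq]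
    ring
  have := integral_eq_zero_of_hasDerivAt_of_integrable dG (iLu.sub (iEu.const_mul _)) iG
  rw [integral_sub iLu (iEu.const_mul _), integral_const_mul] at this
  exact sub_eq_zero.1 this

end
end

/-! ### Esseen's inequality for unequal masses; measurability of the transforms -/

noncomputable section

theorem integrableOn_abs_rpow {r : ℝ} (hr : -1 < r) :
    IntegrableOn (fun s : ℝ => |s| ^ r) (Set.Icc (-1) 1) := by
  have h1 : IntervalIntegrable (fun s : ℝ => |s| ^ r) volume 0 1 := by
    refine (intervalIntegral.intervalIntegrable_rpow' hr).congr fun s hs => ?_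
    rw [Set.uIoc_of_le zero_le_one] at hs
    simp only [abs_of_pos hs.1]
  have h2 : IntervalIntegrable (fun s : ℝ => |s| ^ r) volume (-1) 0 := by
    have := (IntervalIntegrable.iff_comp_neg (f := fun s : ℝ => |s| ^ r) (a := 0) (b := 1)).1 h1
    simpa using this.symm
  exact (intervalIntegrable_iff_integrableOn_Icc_of_le (by norm_num)).1 (h2.trans h1)

theorem gaussianReal_real_Iic_sub_le (a : ℝ) {v : NNReal} (hv : v ≠ 0) {x y : ℝ} (hxy : x ≤ y) :
    |(gaussianReal a v).real (Set.Iic y) - (gaussianReal a v).real (Set.Iic x)| ≤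
      (√(2 * Real.pi * v))⁻¹ * (y - x) := by
  have e : ∀ z, (gaussianReal a v).real (Set.Iic z) = ∫ t in Set.Iic z, gaussianPDFReal a v t :=
    fun z => by
      rw [measureReal_def, gaussianReal_apply_eq_integral _ hv,
        ENNReal.toReal_ofReal (integral_nonneg fun _ => gaussianPDFReal_nonneg _ _ _)]
  rw [e, e, intervalIntegral.integral_Iic_sub_Iic (integrable_gaussianPDFReal a v).integrableOn
    (integrable_gaussianPDFReal a v).integrableOn]
  have := intervalIntegral.norm_integral_le_of_norm_le_const (a := x) (b := y)
    (f := gaussianPDFReal a v) (C := (√(2 * Real.pi * v))⁻¹) fun t _ => by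
      rw [Real.norm_of_nonneg (gaussianPDFReal_nonneg _ _ _), gaussianPDFReal_def]
      refine mul_le_of_le_one_right (by positivity) (Real.exp_le_one_iff.2 ?_)
      exact div_nonpos_of_nonpos_of_nonneg (neg_nonpos.2 (sq_nonneg _)) (by positivity)
  rwa [abs_of_nonneg (sub_nonneg.2 hxy)] at this

/-- Esseen's inequality for a measure and a multiple of a probability measure whose Fourier
transforms are close, with a Hölder condition on the difference at the origin that makes up for
unequal total masses. -/
theorem exists_abs_sub_le_of_charFun_sub_le {δ c c₀ K M : ℝ} (hδ : 0 < δ) (hδ1 : δ ≤ 1)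
    (hc : 0 < c) (hc₀ : 0 < c₀) (hK : 0 ≤ K) (hM : 0 ≤ M) :
    ∃ C : ℝ, 0 < C ∧ ∀ (μ ν : Measure ℝ) [IsFiniteMeasure μ] [IsProbabilityMeasure ν]
      (w a T ε : ℝ), 0 ≤ w → 0 < T → 0 ≤ ε → ε ≤ 1 → c₀ / T ≤ ε →
      (∀ x y, x ≤ y → a * ν.real (Set.Iic y) - a * ν.real (Set.Iic x) ≤ M * (y - x)) →
      (∀ s, |s| ≤ T → ‖w * charFun μ s - a * charFun ν s‖ ≤ K * ε * Real.exp (-(c * s ^ 2))) →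
      (∀ s, |s| ≤ T → |s| ≤ 1 → ‖w * charFun μ s - a * charFun ν s -
        (w * charFun μ 0 - a * charFun ν 0)‖ ≤ K * ε * |s| ^ δ) →
      ∀ x, |w * μ.real (Set.Iic x) - a * ν.real (Set.Iic x)| ≤ C * ε := by
  obtain ⟨A, hA, hsmooth⟩ := exists_esseen_smoothing
  -- The singular part `2|s|^(δ-1)` serves `|s| ≤ 1`: one copy for the Hölder hypothesis, one for
  -- the correcting normal law. The Gaussian terms serve `|s| > 1`, where division by `|s|` is
  -- harmless.
  set B : ℝ → ℝ := fun s => (Set.Icc (-1 : ℝ) 1).indicator (fun s => 2 * |s| ^ (δ - 1)) s +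
    (Real.exp (-c * s ^ 2) + Real.exp (-(1 / 2) * s ^ 2)) with hBdef
  have hB0 : ∀ s, 0 ≤ B s := fun s =>
    add_nonneg (Set.indicator_nonneg (fun s _ => by positivity) s) (by positivity)
  have hB : Integrable B := by
    refine Integrable.add ?_ ((integrable_exp_neg_mul_sq hc).add
      (integrable_exp_neg_mul_sq (by norm_num)))
    exact (integrable_indicator_iff measurableSet_Icc).2
      ((integrableOn_abs_rpow (by linarith)).const_mul 2)
  have hIB : 0 ≤ ∫ s, B s := integral_nonneg hB0
  set L := (√(2 * Real.pi * (1 : NNReal)))⁻¹ with hL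
  have hL0 : 0 ≤ L := by positivity
  refine ⟨A * (K * (∫ s, B s) + (M + K * L) / c₀) + K + 1, by positivity, ?_⟩
  intro μ ν _ _ w a T ε hw hT hε hε1 hTε hlip hφ hφ0 x
  set κ := w * μ.real Set.univ - a with hκdef
  have hφκ : w * charFun μ 0 - a * charFun ν 0 = (κ : ℂ) := by
    rw [charFun_zero, charFun_zero, probReal_univ (μ := ν), hκdef]
    push_cast
    ring
  have hκ : |κ| ≤ K * ε := by
    have := hφ 0 (by rw [abs_zero]; exact hT.le)
    rw [hφκ, Complex.norm_real] at this
    simpa using this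
  have hγ : ∀ s : ℝ, charFun (gaussianReal 0 1) s = (Real.exp (-(1 / 2) * s ^ 2) : ℂ) := by
    intro s
    rw [charFun_gaussianReal, Complex.ofReal_exp]
    congr 1
    simp
    ring
  -- The mass defect `κ` is carried by a standard normal law, so the combined transform vanishes at
  -- the origin. Removing the correction afterwards costs at most `|κ| ≤ Kε`.
  have key := hsmooth μ ν (gaussianReal 0 1) w a κ T (M + K * ε * L) (fun s => K * ε * B s) hw hT
    (by positivity) (hB.const_mul _) (fun s => mul_nonneg (by positivity) (hB0 s)) ?_ ?_ x
  · rw [integral_const_mul] at key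
    have hle : (gaussianReal 0 1).real (Set.Iic x) ≤ 1 := measureReal_le_one
    have hge : 0 ≤ (gaussianReal 0 1).real (Set.Iic x) := measureReal_nonneg
    have h1 : |κ * (gaussianReal 0 1).real (Set.Iic x)| ≤ K * ε := by
      rw [abs_mul, abs_of_nonneg hge]
      calc _ ≤ K * ε * 1 := by gcongr
        _ = _ := mul_one _
    have hT' : 1 / T ≤ ε / c₀ := by
      rw [le_div_iff₀ hc₀, one_div_mul_eq_div]; exact hTε
    have h2 : (M + K * ε * L) / T ≤ (M + K * L) / c₀ * ε := by
      have hKL : K * ε * L ≤ K * L := by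
        have := mul_le_mul_of_nonneg_left hε1 (mul_nonneg hK hL0)
        linarith
      calc (M + K * ε * L) / T = (M + K * ε * L) * (1 / T) := by ring
        _ ≤ (M + K * L) * (ε / c₀) := by gcongr
        _ = _ := by ring
    have h3 : A * (K * ε * (∫ s, B s) + (M + K * ε * L) / T) ≤
        A * ((K * (∫ s, B s) + (M + K * L) / c₀) * ε) := by
      refine mul_le_mul_of_nonneg_left ?_ hA.le
      linarith
    have h4 := abs_add_le (w * μ.real (Set.Iic x) - a * ν.real (Set.Iic x) -
      κ * (gaussianReal 0 1).real (Set.Iic x)) (κ * (gaussianReal 0 1).real (Set.Iic x))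
    rw [sub_add_cancel] at h4
    linarith
  · intro x y hxy
    have h1 := hlip x y hxy
    have h2 := gaussianReal_real_Iic_sub_le 0 (one_ne_zero (α := NNReal)) hxy
    have h3 : κ * ((gaussianReal 0 1).real (Set.Iic y) - (gaussianReal 0 1).real (Set.Iic x)) ≤
        K * ε * (L * (y - x)) := by
      refine (le_abs_self _).trans ?_
      rw [abs_mul]
      exact mul_le_mul hκ h2 (abs_nonneg _) (by positivity)
    linarith
  · intro s hsT hs0
    have hspos : 0 < |s| := abs_pos.2 hs0
    rw [hγ]
    by_cases hs1 : |s| ≤ 1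
    · have hmem : s ∈ Set.Icc (-1 : ℝ) 1 := abs_le.1 hs1
      have h1 := hφ0 s hsT hs1
      rw [hφκ] at h1
      have hsδ : |s| ≤ |s| ^ δ := by
        simpa using Real.rpow_le_rpow_of_exponent_ge hspos hs1 hδ1
      -- For `|s| ≤ 1` one has `1 - exp(-s²/2) ≤ s² ≤ |s| ≤ |s|^δ`.
      have h2 : ‖(κ : ℂ) * (1 - (Real.exp (-(1 / 2) * s ^ 2) : ℂ))‖ ≤ K * ε * |s| ^ δ := by
        have h3 : Real.exp (-(1 / 2) * s ^ 2) ≤ 1 := Real.exp_le_one_iff.2 (by nlinarith)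
        have h4 := Real.add_one_le_exp (-(1 / 2) * s ^ 2)
        have h5 : s ^ 2 ≤ |s| := by
          rw [← sq_abs]; nlinarith
        rw [← Complex.ofReal_one, ← Complex.ofReal_sub, ← Complex.ofReal_mul, Complex.norm_real,
          Real.norm_eq_abs, abs_mul, abs_of_nonneg (sub_nonneg.2 h3)]
        refine mul_le_mul hκ ?_ (sub_nonneg.2 h3) (by positivity)
        linarith
      have h6 : |s| * |s| ^ (δ - 1) = |s| ^ δ := by
        rw [← Real.rpow_one_add' hspos.le (by linarith [hδ.ne'])]
        · congr 1; ring
      calc _ = ‖(w * charFun μ s - a * charFun ν s - κ) +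
            (κ : ℂ) * (1 - (Real.exp (-(1 / 2) * s ^ 2) : ℂ))‖ := by congr 1; ring
        _ ≤ K * ε * |s| ^ δ + K * ε * |s| ^ δ := (norm_add_le _ _).trans (add_le_add h1 h2)
        _ = |s| * (K * ε * (2 * |s| ^ (δ - 1))) := by rw [← h6]; ring
        _ ≤ _ := by
          refine mul_le_mul_of_nonneg_left (mul_le_mul_of_nonneg_left ?_ (by positivity))
            hspos.le
          simp only [hBdef]
          rw [Set.indicator_of_mem hmem]
          have : 0 ≤ Real.exp (-c * s ^ 2) + Real.exp (-(1 / 2) * s ^ 2) := by positivity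
          linarith
    · have hmem : s ∉ Set.Icc (-1 : ℝ) 1 := fun h => hs1 (abs_le.2 h)
      have h2 : ‖(κ : ℂ) * (Real.exp (-(1 / 2) * s ^ 2) : ℂ)‖ ≤
          K * ε * Real.exp (-(1 / 2) * s ^ 2) := by
        rw [← Complex.ofReal_mul, Complex.norm_real, Real.norm_eq_abs, abs_mul,
          abs_of_nonneg (Real.exp_pos _).le]
        gcongr
      have h3 : B s = Real.exp (-c * s ^ 2) + Real.exp (-(1 / 2) * s ^ 2) := by
        simp only [hBdef]
        rw [Set.indicator_of_notMem hmem, zero_add]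
      calc _ ≤ K * ε * Real.exp (-(c * s ^ 2)) + K * ε * Real.exp (-(1 / 2) * s ^ 2) :=
            (norm_sub_le _ _).trans (add_le_add (hφ s hsT) h2)
        _ = 1 * (K * ε * B s) := by rw [h3, neg_mul c]; ring
        _ ≤ _ := mul_le_mul_of_nonneg_right (not_le.1 hs1).le (mul_nonneg (by positivity) (hB0 s))

section

variable {Ω : Type*} [MeasurableSpace Ω] {P : Measure Ω} {V W : Ω → ℝ} {δ : ℝ}

theorem continuous_weightedCharFun (hV : AEMeasurable V P) (hW : AEMeasurable W P) {k : ℕ}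
    (hk : Integrable (fun ω => W ω ^ k) P) (s : ℝ) :
    Continuous (fun t => weightedCharFun P V W k s t) := by
  refine continuous_of_dominated (bound := fun ω => |W ω ^ k|)
    (fun t => (integrable_pow_mul_cexp_of_integrable hV hW hk s t).aestronglyMeasurable)
    (fun t => ae_of_all _ fun ω => ?_) hk.abs (ae_of_all _ fun ω => by fun_prop)
  rw [norm_mul, Complex.norm_exp_ofReal_mul_I, Complex.norm_real, mul_one, Real.norm_eq_abs]

theorem aestronglyMeasurable_sumCharFunTrunc [IsProbabilityMeasure P]
    (h : IsCenteredPair P V W δ) (n : ℕ) (s : ℝ) :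
    AEStronglyMeasurable (fun t => sumCharFunTrunc P V W n s t) := by
  have j0 := continuous_weightedCharFun h.aemeasurable_fst h.aemeasurable_snd
    (k := 0) (by simp) (s / √n)
  have j1 := continuous_weightedCharFun h.aemeasurable_fst h.aemeasurable_snd
    (k := 1) (by simpa using h.memLp_snd.integrable one_le_two) (s / √n)
  have j2 := continuous_weightedCharFun h.aemeasurable_fst h.aemeasurable_snd
    (k := 2) h.memLp_snd.integrable_sq (s / √n)
  have hd : Continuous fun t : ℝ => t / √n := by fun_prop
  have : Continuous fun t => sumCharFun P V W n s t := by
    unfold sumCharFun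
    have := j0.comp hd
    have := j1.comp hd
    have := j2.comp hd
    simp only [Function.comp_def] at *
    fun_prop
  exact this.aestronglyMeasurable.indicator measurableSet_Ioc

theorem continuous_limitCharFun (s : ℝ) : Continuous (fun t => limitCharFun P V W s t) := by
  unfold limitCharFun momentForm momentLin
  fun_prop

end
end

/-! ### Assembly of the estimate -/

noncomputable section

/-- The point is uniformity in `y`: the weighted Gaussian distribution function then has a Lipschitz
constant independent of the lattice point. -/
theorem one_add_sq_mul_gaussianPDFReal_le {τ : ℝ} (hτ : 0 < τ) (y : ℝ) :
    (1 + y ^ 2) * gaussianPDFReal 0 τ.toNNReal y ≤ (1 + 2 * τ) * (√(2 * Real.pi * τ))⁻¹ := by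
  rw [gaussianPDFReal_def, Real.coe_toNNReal _ hτ.le]
  simp only [sub_zero]
  have h1 := Real.add_one_le_exp (y ^ 2 / (2 * τ))
  have h2 : 1 + y ^ 2 ≤ (1 + 2 * τ) * Real.exp (y ^ 2 / (2 * τ)) := by
    refine le_trans ?_ (mul_le_mul_of_nonneg_left h1 (by positivity))
    have e : (1 + 2 * τ) * (y ^ 2 / (2 * τ) + 1) = 1 + y ^ 2 + (y ^ 2 / (2 * τ) + 2 * τ) := by
      field_simp
      ring
    rw [e]
    have : 0 ≤ y ^ 2 / (2 * τ) + 2 * τ := by positivity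
    linarith
  rw [neg_div, Real.exp_neg]
  calc _ = ((1 + y ^ 2) * (Real.exp (y ^ 2 / (2 * τ)))⁻¹) * (√(2 * Real.pi * τ))⁻¹ := by ring
    _ ≤ _ := by
      refine mul_le_mul_of_nonneg_right ?_ (by positivity)
      rwa [mul_inv_le_iff₀ (Real.exp_pos _)]

namespace IsCenteredPair

variable {Ω : Type*} [MeasurableSpace Ω] {P : Measure Ω} [IsProbabilityMeasure P] {V W : Ω → ℝ}
  {δ ρ : ℝ}

theorem covMatrix_eq (h : IsCenteredPair P V W δ) :
    covMatrix P V W = !![∫ ω, V ω ^ 2 ∂P, ∫ ω, V ω * W ω ∂P; ∫ ω, V ω * W ω ∂P,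
      ∫ ω, W ω ^ 2 ∂P] := by
  unfold covMatrix
  rw [variance_of_integral_eq_zero h.aemeasurable_fst h.integral_fst,
    variance_of_integral_eq_zero h.aemeasurable_snd h.integral_snd,
    covariance_eq_sub h.memLp_fst h.memLp_snd, h.integral_fst, zero_mul, sub_zero]
  rfl

/-- Subtracting the two inversion formulas turns a difference of one-dimensional transforms into a
single integral in which `y` enters only through a unimodular factor. -/
theorem mul_charFun_sub_eq (h : IsCenteredPair P V W δ) (hρ : SupportedOnLattice P W ρ 1)
    (hτ : 0 < ∫ ω, W ω ^ 2 ∂P)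
    (hD : 0 < (∫ ω, V ω ^ 2 ∂P) * (∫ ω, W ω ^ 2 ∂P) - (∫ ω, V ω * W ω ∂P) ^ 2)
    {Ω' : Type*} [MeasurableSpace Ω'] {P' : Measure Ω'} [IsProbabilityMeasure P']
    {V' W' : ℕ → Ω' → ℝ} (hind : iIndepFun (fun i ω => (V' i ω, W' i ω)) P')
    (hid : ∀ i, IdentDistrib (fun ω => (V' i ω, W' i ω)) (fun ω => (V ω, W ω)) P' P)
    {n : ℕ} (hn : 1 ≤ n) (y : ℤ) {s : ℝ}
    (hlim : Integrable (fun t => limitCharFun P V W s t))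
    (hsum : Integrable (fun t => sumCharFunTrunc P V W n s t)) :
    ((√n * (1 + latticePoint ρ n y ^ 2) : ℝ) : ℂ) *
        charFun ((P'.restrict {ω | ∑ i ∈ Finset.range n, W' i ω = y + n * ρ}).map
          (fun ω => (∑ i ∈ Finset.range n, V' i ω) / √n)) s -
      (((1 + latticePoint ρ n y ^ 2) *
        gaussianPDFReal 0 (∫ ω, W ω ^ 2 ∂P).toNNReal (latticePoint ρ n y) : ℝ) : ℂ) *
        charFun (gaussianReal ((∫ ω, V ω * W ω ∂P) * latticePoint ρ n y / ∫ ω, W ω ^ 2 ∂P)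
          (((∫ ω, V ω ^ 2 ∂P) * (∫ ω, W ω ^ 2 ∂P) - (∫ ω, V ω * W ω ∂P) ^ 2) /
            ∫ ω, W ω ^ 2 ∂P).toNNReal) s =
      ((2 * Real.pi : ℝ) : ℂ)⁻¹ * ∫ t : ℝ,
        (sumCharFunTrunc P V W n s t - limitCharFun P V W s t) *
          Complex.exp ((-(t * latticePoint ρ n y) : ℝ) * Complex.I) := by
  have e1 := integral_sumCharFunTrunc_mul_cexp h hρ hind hid hn s y
  have e2 := integral_limitCharFun_mul_cexp hτ hlim (latticePoint ρ n y)
  have e3 := integral_exp_quadratic_mul_cexp hτ hD s (latticePoint ρ n y)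
  have hX := aemeasurable_sum_fst hid n
  have hm : Measurable fun x : ℝ => Complex.exp (s * x * Complex.I) := by fun_prop
  rw [charFun_apply_real, integral_map (hX.restrict.div_const _) hm.aestronglyMeasurable]
  set v := latticePoint ρ n y
  have hcu : Continuous fun t : ℝ => Complex.exp ((-(t * v) : ℝ) * Complex.I) := by fun_prop
  have hu : ∀ᵐ t : ℝ, ‖Complex.exp ((-(t * v) : ℝ) * Complex.I)‖ ≤ 1 :=
    ae_of_all _ fun _ => (Complex.norm_exp_ofReal_mul_I _).le
  simp_rw [sub_mul]
  rw [integral_sub (hsum.mul_bdd hcu.aestronglyMeasurable hu)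
    (hlim.mul_bdd hcu.aestronglyMeasurable hu), e1, e2]
  unfold momentForm
  rw [e3]
  have e4 : ∀ ω, Complex.exp (s * (((∑ i ∈ Finset.range n, V' i ω) / √n : ℝ) : ℂ) * Complex.I) =
      Complex.exp ((s / √n * ∑ i ∈ Finset.range n, V' i ω : ℝ) * Complex.I) := by
    intro ω
    congr 2
    push_cast
    ring
  simp_rw [e4]
  have hpi : (Real.pi : ℂ) ≠ 0 := by exact_mod_cast Real.pi_ne_zero
  have hcancel : ∀ (A B : ℂ) (r q g : ℝ), ((r * q : ℝ) : ℂ) * A - ((q * g : ℝ) : ℂ) * B =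
      ((2 * Real.pi : ℝ) : ℂ)⁻¹ * (((2 * Real.pi * r * q : ℝ) : ℂ) * A -
        (q : ℂ) * (((2 * Real.pi * g : ℝ) : ℂ) * B)) := by
    intro A B r q g
    push_cast
    field_simp
  exact hcancel _ _ _ _ _

theorem exists_abs_sub_le (h : IsCenteredPair P V W δ) (hρ : SupportedOnLattice P W ρ 1)
    (hspan : IsLatticeWithSpan P W 1) (hτ : 0 < ∫ ω, W ω ^ 2 ∂P)
    (hD : 0 < (∫ ω, V ω ^ 2 ∂P) * (∫ ω, W ω ^ 2 ∂P) - (∫ ω, V ω * W ω ∂P) ^ 2) :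
    ∃ C : ℝ, 0 < C ∧ ∀ {Ω' : Type*} [MeasurableSpace Ω'] (P' : Measure Ω')
      [IsProbabilityMeasure P'] (V' W' : ℕ → Ω' → ℝ),
      iIndepFun (fun i ω => (V' i ω, W' i ω)) P' →
      (∀ i, IdentDistrib (fun ω => (V' i ω, W' i ω)) (fun ω => (V ω, W ω)) P' P) →
      ∀ n : ℕ, 1 ≤ n → ∀ (x : ℝ) (y : ℤ),
        |√n * (1 + latticePoint ρ n y ^ 2) *
            P'.real {ω | (∑ i ∈ Finset.range n, V' i ω) / √n ≤ x ∧
              ∑ i ∈ Finset.range n, W' i ω = y + n * ρ} -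
          (1 + latticePoint ρ n y ^ 2) *
            semiLocalGaussian (covMatrix P V W) x (latticePoint ρ n y)| ≤
          C * (n : ℝ) ^ (-δ / 2) := by
  have hα0 : 0 ≤ ∫ ω, V ω ^ 2 ∂P := integral_nonneg fun _ => sq_nonneg _
  -- The smallest eigenvalue is at least determinant over trace; the inequality is an identity up to
  -- the two squares supplied to `nlinarith`.
  have hQ : ∀ s t, ((∫ ω, V ω ^ 2 ∂P) * (∫ ω, W ω ^ 2 ∂P) - (∫ ω, V ω * W ω ∂P) ^ 2) /
      ((∫ ω, V ω ^ 2 ∂P) + ∫ ω, W ω ^ 2 ∂P) * (s ^ 2 + t ^ 2) ≤ momentForm P V W s t := by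
    intro s t
    unfold momentForm
    rw [div_mul_eq_mul_div, div_le_iff₀ (by positivity)]
    nlinarith [sq_nonneg ((∫ ω, V ω ^ 2 ∂P) * s + (∫ ω, V ω * W ω ∂P) * t),
      sq_nonneg ((∫ ω, V ω * W ω ∂P) * s + (∫ ω, W ω ^ 2 ∂P) * t)]
  obtain ⟨C, c, c₀, hC, hc, hc₀, hlimit, hdiff⟩ :=
    h.exists_norm_sumCharFunTrunc_sub_le hspan (div_pos hD (by positivity)) hQ
  have hcharFun := fun {Ω' : Type _} [MeasurableSpace Ω'] {P' : Measure Ω'}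
    [IsProbabilityMeasure P'] {V' W' : ℕ → Ω' → ℝ} => h.mul_charFun_sub_eq (P' := P')
      (V' := V') (W' := W') hρ hτ hD
  rw [h.covMatrix_eq]
  simp_rw [semiLocalGaussian_eq_mul hτ hD]
  set α := ∫ ω, V ω ^ 2 ∂P
  set β := ∫ ω, V ω * W ω ∂P
  set τ := ∫ ω, W ω ^ 2 ∂P
  set σ := ((α * τ - β ^ 2) / τ).toNNReal
  have hσ : σ ≠ 0 := (Real.toNNReal_pos.2 (div_pos hD hτ)).ne'
  set J := ∫ t : ℝ, Real.exp (-c * t ^ 2)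
  have hiJ : Integrable fun t : ℝ => Real.exp (-c * t ^ 2) := integrable_exp_neg_mul_sq hc
  have hJ0 : 0 ≤ J := integral_nonneg fun _ => (Real.exp_pos _).le
  set K := (2 * Real.pi)⁻¹ * (C * J) with hK
  set M := (1 + 2 * τ) * (√(2 * Real.pi * τ))⁻¹ * (√(2 * Real.pi * σ))⁻¹ with hM
  obtain ⟨C', hC', hfin⟩ := exists_abs_sub_le_of_charFun_sub_le (c₀ := c₀) (K := K) (M := M)
    h.pos h.le_one hc hc₀ (by positivity) (by positivity)
  refine ⟨C', hC', ?_⟩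
  intro Ω' _ P' _ V' W' hind hid n hn x y
  have hn0 : (0 : ℝ) < n := by exact_mod_cast hn
  have hsn : 0 < √(n : ℝ) := Real.sqrt_pos.2 hn0
  set ε := (n : ℝ) ^ (-δ / 2) with hε
  have hε0 : 0 ≤ ε := Real.rpow_nonneg hn0.le _
  have hexp : ∀ s t : ℝ, Real.exp (-(c * (s ^ 2 + t ^ 2))) =
      Real.exp (-(c * s ^ 2)) * Real.exp (-c * t ^ 2) := by
    intro s t
    rw [← Real.exp_add]
    congr 1
    ring
  have ilim : ∀ s, Integrable (fun t => limitCharFun P V W s t) := by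
    intro s
    refine (hiJ.const_mul (C * Real.exp (-(c * s ^ 2)))).mono'
      (continuous_limitCharFun s).aestronglyMeasurable (ae_of_all _ fun t => ?_)
    rw [mul_assoc, ← hexp]
    exact hlimit s t
  have idiff : ∀ s, |s| ≤ c₀ * √n →
      Integrable (fun t => sumCharFunTrunc P V W n s t - limitCharFun P V W s t) := by
    intro s hs
    refine (hiJ.const_mul (C * ε * Real.exp (-(c * s ^ 2)))).mono'
      ((aestronglyMeasurable_sumCharFunTrunc h n s).sub
        (continuous_limitCharFun s).aestronglyMeasurable) (ae_of_all _ fun t => ?_)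
    rw [mul_assoc _ (Real.exp _), ← hexp]
    exact (hdiff n hn s t hs).1
  have isum : ∀ s, |s| ≤ c₀ * √n → Integrable (fun t => sumCharFunTrunc P V W n s t) := by
    intro s hs
    refine ((idiff s hs).add (ilim s)).congr (ae_of_all _ fun t => ?_)
    exact sub_add_cancel _ _
  set v := latticePoint ρ n y
  set μ := (P'.restrict {ω | ∑ i ∈ Finset.range n, W' i ω = y + n * ρ}).map
          (fun ω => (∑ i ∈ Finset.range n, V' i ω) / √n) with hμ
  have hX := aemeasurable_sum_fst hid n
  have hY := aemeasurable_sum_snd hid n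
  have hμx : μ.real (Set.Iic x) = P'.real {ω | (∑ i ∈ Finset.range n, V' i ω) / √n ≤ x ∧
      ∑ i ∈ Finset.range n, W' i ω = y + n * ρ} := by
    have hset : NullMeasurableSet {ω | ∑ i ∈ Finset.range n, W' i ω = y + n * ρ} P' :=
      hY.nullMeasurable (measurableSet_singleton _)
    rw [measureReal_def, measureReal_def, hμ,
      Measure.map_apply_of_aemeasurable (hX.restrict.div_const _) measurableSet_Iic,
      Measure.restrict_apply₀' hset]
    rfl
  have hrep : ∀ s, |s| ≤ c₀ * √n → _ := fun s hs =>
    hcharFun hind hid hn y (ilim s) (isum s hs)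
  -- Integrating out `t` with the triangle inequality discards `v`. The parameter `b` is later
  -- `exp(-cs²)` for the size and `|s|^δ` for the increment from `s = 0`.
  have hnorm : ∀ (f : ℝ → ℂ) (b : ℝ), (∀ t, ‖f t‖ ≤ C * ε * b * Real.exp (-c * t ^ 2)) →
      ‖((2 * Real.pi : ℝ) : ℂ)⁻¹ * ∫ t : ℝ, f t * Complex.exp ((-(t * v) : ℝ) * Complex.I)‖ ≤
        K * ε * b := by
    intro f b hf
    have h1 : ‖∫ t : ℝ, f t * Complex.exp ((-(t * v) : ℝ) * Complex.I)‖ ≤ C * ε * b * J := by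
      rw [← integral_const_mul]
      refine norm_integral_le_of_norm_le (hiJ.const_mul _) (ae_of_all _ fun t => ?_)
      rw [norm_mul, Complex.norm_exp_ofReal_mul_I, mul_one]
      exact hf t
    rw [norm_mul, norm_inv, Complex.norm_real, Real.norm_of_nonneg (by positivity)]
    calc _ ≤ (2 * Real.pi)⁻¹ * (C * ε * b * J) := by gcongr
      _ = _ := by rw [hK]; ring
  have key := hfin μ (gaussianReal (β * v / τ) σ) (√n * (1 + v ^ 2))
    ((1 + v ^ 2) * gaussianPDFReal 0 τ.toNNReal v) (c₀ * √n) ε (by positivity) (by positivity)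
    hε0 (h.natCast_rpow_le_one hn) ?_ ?_ ?_ ?_ x
  · rw [hμx] at key
    rwa [← mul_assoc]
  -- With cutoff `T = c₀√n`, the smoothing error is of order `n^(-1/2)`, within the rate since `δ ≤
  -- 1`.
  · rw [div_mul_eq_div_div, div_self hc₀.ne', one_div, Real.sqrt_eq_rpow, ← Real.rpow_neg hn0.le]
    exact Real.rpow_le_rpow_of_exponent_le (by exact_mod_cast hn) (by linarith [h.le_one])
  · intro x y hxy
    have h1 := one_add_sq_mul_gaussianPDFReal_le hτ v
    have h2 := (le_abs_self _).trans (gaussianReal_real_Iic_sub_le (β * v / τ) hσ hxy)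
    have h3 : 0 ≤ (1 + v ^ 2) * gaussianPDFReal 0 τ.toNNReal v :=
      mul_nonneg (by positivity) (gaussianPDFReal_nonneg _ _ _)
    rw [← mul_sub, hM, mul_assoc _ _ (y - x)]
    exact (mul_le_mul_of_nonneg_left h2 h3).trans
      (mul_le_mul_of_nonneg_right h1 (mul_nonneg (by positivity) (sub_nonneg.2 hxy)))
  · intro s hs
    rw [hrep s hs]
    refine hnorm _ _ fun t => ?_
    rw [mul_assoc _ (Real.exp _), ← hexp]
    exact (hdiff n hn s t hs).1
  · intro s hs hs1
    have h0 : |(0 : ℝ)| ≤ c₀ * √n := by rw [abs_zero]; positivity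
    have hcu : Continuous fun t : ℝ => Complex.exp ((-(t * v) : ℝ) * Complex.I) := by fun_prop
    have hu : ∀ᵐ t : ℝ, ‖Complex.exp ((-(t * v) : ℝ) * Complex.I)‖ ≤ 1 :=
      ae_of_all _ fun _ => (Complex.norm_exp_ofReal_mul_I _).le
    rw [hrep s hs, hrep 0 h0, ← mul_sub, ← integral_sub
      ((idiff s hs).mul_bdd hcu.aestronglyMeasurable hu)
      ((idiff 0 h0).mul_bdd hcu.aestronglyMeasurable hu)]
    simp_rw [← sub_mul]
    refine hnorm _ _ fun t => ?_
    rw [neg_mul]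
    exact (hdiff n hn s t hs).2 hs1

end IsCenteredPair

theorem mainTheorem2 {Ω : Type*} [MeasurableSpace Ω] (P : Measure Ω) [IsProbabilityMeasure P]
    (V W : Ω → ℝ) (hV : AEMeasurable V P) (hW : AEMeasurable W P)
    (δ ρ : ℝ) (hδ : δ ∈ Set.Ioc (0 : ℝ) 1)
    (hmoment : Integrable (fun ω => Real.sqrt (V ω ^ 2 + W ω ^ 2) ^ (2 + δ)) P)
    (hmeanV : ∫ ω, V ω ∂P = 0) (hmeanW : ∫ ω, W ω ∂P = 0)
    (hcov : (covMatrix P V W).PosDef)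
    (hρ : SupportedOnLattice P W ρ 1) (hspan : IsLatticeWithSpan P W 1) :
    -- the constant depends only on `δ`, `ρ` and the law of `(V, W)`
    ∃ C : ℝ, 0 < C ∧
      ∀ {Ω' : Type*} [MeasurableSpace Ω'] (P' : Measure Ω') [IsProbabilityMeasure P']
        (V' W' : ℕ → Ω' → ℝ),
        iIndepFun (fun i ω => (V' i ω, W' i ω)) P' →
        (∀ i, IdentDistrib (fun ω => (V' i ω, W' i ω)) (fun ω => (V ω, W ω)) P' P) →
        ∀ n : ℕ, 1 ≤ n → ∀ (x : ℝ) (y : ℤ),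
          (1 + latticePoint ρ n y ^ 2) *
            |P'.real {ω | (∑ i ∈ Finset.range n, V' i ω) / Real.sqrt n ≤ x ∧
                (∑ i ∈ Finset.range n, W' i ω) / Real.sqrt n = latticePoint ρ n y}
              - 1 / Real.sqrt n *
                semiLocalGaussian (covMatrix P V W) x (latticePoint ρ n y)|
          ≤ C * (n : ℝ) ^ (-(1 + δ) / 2) := by
  have h : IsCenteredPair P V W δ := ⟨hV, hW, hδ.1, hδ.2, hmoment, hmeanV, hmeanW⟩
  have hcov' := hcov
  rw [h.covMatrix_eq] at hcov'
  have hτ : 0 < ∫ ω, W ω ^ 2 ∂P := hcov'.diag_pos (i := 1)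
  have hD := hcov'.det_pos
  rw [Matrix.det_fin_two_of, ← sq] at hD
  obtain ⟨C, hC, hbound⟩ := h.exists_abs_sub_le hρ hspan hτ hD
  refine ⟨C, hC, ?_⟩
  intro Ω' _ P' _ V' W' hind hid n hn x y
  have hn0 : (0 : ℝ) < n := by exact_mod_cast hn
  have hsn : 0 < √(n : ℝ) := Real.sqrt_pos.2 hn0
  have key := hbound P' V' W' hind hid n hn x y
  have hset : {ω | (∑ i ∈ Finset.range n, V' i ω) / √n ≤ x ∧
      (∑ i ∈ Finset.range n, W' i ω) / √n = latticePoint ρ n y} =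
      {ω | (∑ i ∈ Finset.range n, V' i ω) / √n ≤ x ∧
        ∑ i ∈ Finset.range n, W' i ω = y + n * ρ} := by
    ext ω
    simp only [Set.mem_ofPred_eq, latticePoint, div_left_inj' hsn.ne']
  rw [hset]
  set p := P'.real {ω | (∑ i ∈ Finset.range n, V' i ω) / √n ≤ x ∧
        ∑ i ∈ Finset.range n, W' i ω = y + n * ρ}
  set ψ := semiLocalGaussian (covMatrix P V W) x (latticePoint ρ n y)
  set v := latticePoint ρ n y
  have e1 : √n * (1 + v ^ 2) * p - (1 + v ^ 2) * ψ =
      √n * (1 + v ^ 2) * (p - 1 / √n * ψ) := by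
    field_simp
  -- The factor `√n` from lattice inversion, carried in the weight so far, supplies the remaining
  -- `n^(-1/2)`.
  have e2 : (n : ℝ) ^ (-(1 + δ) / 2) = (n : ℝ) ^ (-δ / 2) / √n := by
    rw [Real.sqrt_eq_rpow, ← Real.rpow_sub hn0]
    congr 1
    ring
  rw [e1, abs_mul, abs_of_nonneg (by positivity : 0 ≤ √(n : ℝ) * (1 + v ^ 2))] at key
  rw [e2, ← mul_div_assoc, le_div_iff₀ hsn]
  linarith

end
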